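/- **Setting.** Let $(M,d)$ be a proper metric space and $\mathfrak m$ a Radon measure on $M$ with full support. Let $\le$ be a preorder and $\ll$ a transitive relation contained in $\le$ on $M$, and let $\tau:M^2\to[0,\infty]$ be lower semicontinuous with $\tau(x,y)=0$ if $x\not\le y$, with $\tau(x,y)>0\iff x\ll y$, and with $\tau(x,z)\ge\tau(x,y)+\tau(y,z)$ if $x\le y\le z$. A causal (timelike) curve is a locally Lipschitz $\gamma:[a,b]\to M$, $a<b$, with $\gamma_s\le\gamma_t$ ($\gamma_s\ll\gamma_t$) for all $s<t$; its length $L_\tau(\gamma)$ is the infimum of $\sum_i\tau(\gamma_{t_i},\gamma_{t_{i+1}})$ over all partitions of $[a,b]$. Assume: * *local causal closedness*: every point has an open neighbourhood $U$ such that $\{(x,y)\in\bar U^2:x\le y\}$ is closed; * *$\mathscr K$-global hyperbolicity*: for every compact $C$ the $d$-arclengths of all causal curves in $C$ are uniformly bounded, and $J(A,B)=\{z: x\le z\le y\text{ for some }x\in A,\ y\in B\}$ is compact for all compact $A,B\subset M$; * *geodesic space*: if $x\le y$, $x\ne y$, there is a causal curve $\gamma$ from $x$ to $y$ with $L_\tau(\gamma)=\tau(x,y)$;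 * *regularity* (regular localizability): every point has an open neighbourhood $\Omega$ such that the $d$-arclengths of causal curves in $\Omega$ are uniformly bounded; there is a continuous $\omega:\Omega^2\to[0,\infty)$ with the above properties of $\tau$ for the relations $\le,\ll$ restricted to $\Omega$; for every $y\in\Omega$ there are $z,z'\in\Omega$ with $z\ll y\ll z'$; and for all $x\le y$ in $\Omega$ with $x\neq y$ there is a causal curve $\gamma_{xy}$ in $\Omega$ from $x$ to $y$ which has maximal $\tau$-length among all such curves, with $L_\tau(\gamma_{xy})=\omega(x,y)$, and which, if $x\ll y$, is timelike and strictly longer than every causal curve in $\Omega$ from $x$ to $y$ that contains a null segment (a nonconstant restriction to some $[s,t]$ whose endpoints are not $\ll$-related). **Transport.** Let $p\in(0,1)$, $K\in\mathbb R$, $N\in(0,\infty)$. For probability measures $\mu,\nu$ on $M$, $\Pi_\le(\mu,\nu)$ and $\Pi_\ll(\mu,\nu)$ are the sets of couplings concentrated on $\{x\le y\}$ and $\{x\ll y\}$. Put $\ell_p(\mu,\nu)=\sup\{\|\tau\|_{L^p(\pi)}:\pi\in\Pi_\le(\mu,\nu)\}$ ($\sup\emptyset=-\infty$); $\pi\in\Pi_\le(\mu,\nu)$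 is $\ell_p$-optimal if it attains this supremum. Let $l^p(x,y)=\tau(x,y)^p$ if $x\le y$ and $-\infty$ otherwise. The pair $(\mu,\nu)$ is *strongly timelike $p$-dualizable* if (i) there is an $\ell_p$-optimal $\pi\in\Pi_\ll(\mu,\nu)$, and there are Borel $a,b:M\to\mathbb R$ with $(x,y)\mapsto a(x)+b(y)$ in $L^1(\mu\otimes\nu)$ and $l^p(x,y)\le a(x)+b(y)$ on $\operatorname{supp}\mu\times\operatorname{supp}\nu$; and (ii) there is an $l^p$-cyclically monotone Borel set $\Gamma\subset\{x\ll y\}\cap(\operatorname{supp}\mu\times\operatorname{supp}\nu)$ such that every $\sigma\in\Pi_\le(\mu,\nu)$ is $\ell_p$-optimal if and only if $\sigma(\Gamma)=1$. An *$\ell_p$-geodesic* is a family $(\mu_t)_{t\in[0,1]}$ of probability measures with $\ell_p(\mu_0,\mu_1)\in(0,\infty)$ and $\ell_p(\mu_s,\mu_t)=(t-s)\,\ell_p(\mu_0,\mu_1)$ for all $s<t$. **Curvature.** Let $\mathrm{Ent}(\mu)=\int\rho\log\rho\,d\mathfrak m$ if $\mu=\rho\,\mathfrak m$ and $(\rho\log\rho)^+\in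 L^1(\mathfrak m)$, and $\mathrm{Ent}(\mu)=\infty$ otherwise; $\mathrm{Dom}(\mathrm{Ent})=\{|\mathrm{Ent}|<\infty\}$, $\mathscr U_N=e^{-\mathrm{Ent}/N}$ and $T_\pi=\|\tau\|_{L^2(\pi)}$. For $r\in[0,1]$, $\theta\in[0,\infty]$ let $\sigma^{(r)}_{K,N}(\theta)$ be $\frac{\sin(r\theta\sqrt{K/N})}{\sin(\theta\sqrt{K/N})}$ if $0<K\theta^2<N\pi^2$, $\ r$ if $K\theta^2=0$, $\ \frac{\sinh(r\theta\sqrt{-K/N})}{\sinh(\theta\sqrt{-K/N})}$ if $K\theta^2<0$ (its limit if $\theta=\infty$), and $\infty$ if $K\theta^2\ge N\pi^2$, with $0\cdot\infty=0$. Assume $\mathrm{wTCD}^e_p(K,N)$: for every strongly timelike $p$-dualizable pair $(\nu_0,\nu_1)$ of compactly supported measures in $\mathrm{Dom}(\mathrm{Ent})$ with $\ell_p(\nu_0,\nu_1)<\infty$ there are an $\ell_p$-optimal $\pi\in\Pi_\ll(\nu_0,\nu_1)$ and an $\ell_p$-geodesic $(\nu_t)_{t\in[0,1]}$ from $\nu_0$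 to $\nu_1$ with $$\mathscr U_N(\nu_t)\ \ge\ \sigma^{(1-t)}_{K,N}(T_\pi)\,\mathscr U_N(\nu_0)+\sigma^{(t)}_{K,N}(T_\pi)\,\mathscr U_N(\nu_1)\qquad\text{for every }t\in[0,1].\tag{$*$}$$ **Theorem.** Under all of these assumptions, let $\mu_0=\rho_0\mathfrak m$ and $\mu_1=\rho_1\mathfrak m$ be compactly supported probability measures with $\rho_0,\rho_1\in L^\infty(\mathfrak m)$ such that $(\mu_0,\mu_1)$ is strongly timelike $p$-dualizable. Put $D=\sup\tau(\operatorname{supp}\mu_0\times\operatorname{supp}\mu_1)$. Then $D<\infty$, and there is an $\ell_p$-geodesic $(\mu_t)_{t\in[0,1]}$ from $\mu_0$ to $\mu_1$ which is good, that is, * there is an $\ell_p$-optimal coupling $\pi\in\Pi_\ll(\mu_0,\mu_1)$ with $T_\pi<\infty$ such that $(*)$ holds for $(\mu_t)$ and $\pi$, and $\mu_t=\rho_t\,\mathfrak m\in\mathrm{Dom}(\mathrm{Ent})$ for every $t\in[0,1]$; * $\sup_{t\in[0,1]}\|\rho_t\|_{L^\infty(\mathfrak m)}<\infty$; and which moreover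 satisfies, with $K^-=\max\{-K,0\}$, $$\|\rho_t\|_{L^\infty(\mathfrak m)}\ \le\ e^{D\sqrt{K^-N}/2}\,\max\{\|\rho_0\|_{L^\infty(\mathfrak m)},\|\rho_1\|_{L^\infty(\mathfrak m)}\}\qquad\text{for every }t\in[0,1].$$ -/

import Mathlib

open MeasureTheory Set
open scoped ENNReal

noncomputable section

/-- Causal relations `≤`, `≪` and a time separation function `τ` on a topological space `M`.
When `M` is a proper metric space this is the structure of a Lorentzian pre-length space. -/
structure LorentzianPreLength (M : Type*) [TopologicalSpace M] where
  /-- the causal relation `x ≤ y` -/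
  le : M → M → Prop
  /-- the chronological relation `x ≪ y` -/
  ll : M → M → Prop
  /-- the time separation function -/
  τ : M → M → ℝ≥0∞
  le_refl : ∀ x, le x x
  le_trans : ∀ x y z, le x y → le y z → le x z
  ll_trans : ∀ x y z, ll x y → ll y z → ll x z
  le_of_ll : ∀ x y, ll x y → le x y
  lowerSemicontinuous_τ : LowerSemicontinuous fun z : M × M => τ z.1 z.2
  τ_eq_zero : ∀ x y, ¬ le x y → τ x y = 0
  τ_pos_iff : ∀ x y, 0 < τ x y ↔ ll x y
  reverse_triangle : ∀ x y z, le x y → le y z → τ x y + τ y z ≤ τ x z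

namespace LorentzianPreLength

section Curves

variable {M : Type*} [MetricSpace M] (L : LorentzianPreLength M)

/-- Every point has an open neighbourhood `U` such that `≤` restricted to `closure U` is
closed. -/
def LocallyCausallyClosed : Prop :=
  ∀ x : M, ∃ U : Set M, IsOpen U ∧ x ∈ U ∧
    IsClosed {z : M × M | z.1 ∈ closure U ∧ z.2 ∈ closure U ∧ L.le z.1 z.2}

/-- `γ : [a, b] → M` is a future-directed causal curve (values of `γ` outside `[a, b]` are
irrelevant). -/
def IsCausalCurve (γ : ℝ → M) (a b : ℝ) : Prop :=
  a < b ∧ LocallyLipschitzOn (Icc a b) γ ∧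
    ∀ s ∈ Icc a b, ∀ t ∈ Icc a b, s < t → L.le (γ s) (γ t)

/-- `γ : [a, b] → M` is a future-directed timelike curve. -/
def IsTimelikeCurve (γ : ℝ → M) (a b : ℝ) : Prop :=
  a < b ∧ LocallyLipschitzOn (Icc a b) γ ∧
    ∀ s ∈ Icc a b, ∀ t ∈ Icc a b, s < t → L.ll (γ s) (γ t)

/-- The `τ`-length of `γ : [a, b] → M`: the infimum of `∑ τ(γ(t_i), γ(t_{i+1}))` over all
partitions `a = t_0 < ⋯ < t_n = b`. -/
def len (γ : ℝ → M) (a b : ℝ) : ℝ≥0∞ :=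
  ⨅ (n : ℕ) (u : ℕ → ℝ) (_ : u 0 = a ∧ u n = b ∧ ∀ i < n, u i < u (i + 1)),
    ∑ i ∈ Finset.range n, L.τ (γ (u i)) (γ (u (i + 1)))

/-- Any two points `x < y` (that is `x ≤ y`, `x ≠ y`) are joined by a causal curve of maximal
length `τ(x, y)`. -/
def IsGeodesicSpace : Prop :=
  ∀ x y : M, L.le x y → x ≠ y → ∃ (γ : ℝ → M) (a b : ℝ),
    L.IsCausalCurve γ a b ∧ γ a = x ∧ γ b = y ∧ L.len γ a b = L.τ x y

/-- The causal diamond `J(A, B) = J⁺(A) ∩ J⁻(B)`. -/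
def diamond (A B : Set M) : Set M :=
  {z | (∃ x ∈ A, L.le x z) ∧ ∃ y ∈ B, L.le z y}

/-- The `d`-arclengths of all causal curves in a given compact set are uniformly bounded. -/
def NonTotallyImprisoning : Prop :=
  ∀ C : Set M, IsCompact C → ∃ c : ℝ, ∀ (γ : ℝ → M) (a b : ℝ),
    L.IsCausalCurve γ a b → MapsTo γ (Icc a b) C →
      eVariationOn γ (Icc a b) ≤ ENNReal.ofReal c

def KGloballyHyperbolic : Prop :=
  L.NonTotallyImprisoning ∧
    ∀ A B : Set M, IsCompact A → IsCompact B → IsCompact (L.diamond A B)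

/-- The curve `γ : [a, b] → M` contains a (nonconstant) null segment: some restriction
`γ : [s, t] → M` is not constant and has endpoints that are not chronologically related. -/
def ContainsNullSegment (γ : ℝ → M) (a b : ℝ) : Prop :=
  ∃ s t : ℝ, a ≤ s ∧ s < t ∧ t ≤ b ∧ (∃ r ∈ Icc s t, γ r ≠ γ s) ∧ ¬ L.ll (γ s) (γ t)

/-- `Ω` is a regular localizing neighbourhood of its points (Kunzinger–Sämann). -/
def IsRegularLocalizing (Ω : Set M) : Prop :=
  -- causal curves in `Ω` have uniformly bounded arclength
  (∃ c : ℝ, ∀ (γ : ℝ → M) (a b : ℝ), L.IsCausalCurve γ a b → MapsTo γ (Icc a b) Ω →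
    eVariationOn γ (Icc a b) ≤ ENNReal.ofReal c) ∧
  -- a finite continuous time separation function `ω` on `Ω` for the restricted relations
  ∃ ω : LorentzianPreLength Ω,
    (∀ p q : Ω, ω.le p q ↔ L.le p q) ∧ (∀ p q : Ω, ω.ll p q ↔ L.ll p q) ∧
    (Continuous fun z : Ω × Ω => ω.τ z.1 z.2) ∧ (∀ p q : Ω, ω.τ p q ≠ ⊤) ∧
    (∀ y : Ω, (∃ z : Ω, L.ll y z) ∧ ∃ z : Ω, L.ll z y) ∧
    -- points `p < q` of `Ω` are joined by a maximal curve `γ` in `Ω` of length `ω(p, q)`;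
    -- if `p ≪ q`, then `γ` is timelike and strictly longer than every causal curve in `Ω`
    -- from `p` to `q` that contains a null segment
    ∀ p q : Ω, L.le p q → p ≠ q → ∃ (γ : ℝ → M) (a b : ℝ),
      L.IsCausalCurve γ a b ∧ MapsTo γ (Icc a b) Ω ∧ γ a = p ∧ γ b = q ∧
      L.len γ a b = ω.τ p q ∧
      (∀ (η : ℝ → M) (a' b' : ℝ), L.IsCausalCurve η a' b' → MapsTo η (Icc a' b') Ω →
        η a' = p → η b' = q → L.len η a' b' ≤ L.len γ a b) ∧
      (L.ll p q → L.IsTimelikeCurve γ a b ∧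
        ∀ (η : ℝ → M) (a' b' : ℝ), L.IsCausalCurve η a' b' → MapsTo η (Icc a' b') Ω →
          η a' = p → η b' = q → L.ContainsNullSegment η a' b' →
            L.len η a' b' < L.len γ a b)

/-- Regularity: `M` is regularly localizable. -/
def IsRegular : Prop :=
  ∀ x : M, ∃ Ω : Set M, IsOpen Ω ∧ x ∈ Ω ∧ L.IsRegularLocalizing Ω

end Curves

section Transport

variable {M : Type*} [TopologicalSpace M] [MeasurableSpace M] (L : LorentzianPreLength M)

/-- `π` is a coupling of `μ` and `ν`. -/
def IsCoupling (π : Measure (M × M)) (μ ν : ProbabilityMeasure M) : Prop :=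
  π.fst = μ ∧ π.snd = ν

/-- `π` belongs to `Π_≤(μ, ν)`. -/
def IsCausalCoupling (π : Measure (M × M)) (μ ν : ProbabilityMeasure M) : Prop :=
  IsCoupling π μ ν ∧ ∀ᵐ z ∂π, L.le z.1 z.2

/-- `π` belongs to `Π_≪(μ, ν)`. -/
def IsChronologicalCoupling (π : Measure (M × M)) (μ ν : ProbabilityMeasure M) : Prop :=
  IsCoupling π μ ν ∧ ∀ᵐ z ∂π, L.ll z.1 z.2

/-- `‖τ‖_{L^q(π)}`, for an exponent `q > 0`. -/
def tauNorm (q : ℝ) (π : Measure (M × M)) : ℝ≥0∞ :=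
  (∫⁻ z, L.τ z.1 z.2 ^ q ∂π) ^ (1 / q)

/-- The total transport cost `ℓ_p(μ, ν)`; it is `-∞` if there is no causal coupling. -/
def cost (p : ℝ) (μ ν : ProbabilityMeasure M) : EReal :=
  ⨆ (π : Measure (M × M)) (_ : L.IsCausalCoupling π μ ν), (L.tauNorm p π : EReal)

def IsOptimalCoupling (p : ℝ) (π : Measure (M × M)) (μ ν : ProbabilityMeasure M) : Prop :=
  L.IsCausalCoupling π μ ν ∧ L.cost p μ ν = (L.tauNorm p π : EReal)

open Classical in
/-- `l^p(x, y)`, which is `τ(x, y)^p` if `x ≤ y` and `-∞` otherwise. -/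
def lPow (p : ℝ) (x y : M) : EReal :=
  if L.le x y then ((L.τ x y ^ p : ℝ≥0∞) : EReal) else ⊥

/-- `l^p`-cyclical monotonicity; the index `i + 1` is cyclic in `Fin (n + 1)`, and sums are in
`EReal`, where `∞ + (-∞) = -∞`. -/
def CyclicallyMonotone (p : ℝ) (Γ : Set (M × M)) : Prop :=
  ∀ (n : ℕ) (z : Fin (n + 1) → M × M), (∀ i, z i ∈ Γ) →
    ∑ i, L.lPow p (z (i + 1)).1 (z i).2 ≤ ∑ i, L.lPow p (z i).1 (z i).2

/-- `(μ, ν)` is timelike `p`-dualizable by `π`. -/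
def TimelikeDualizableBy (p : ℝ) (π : Measure (M × M)) (μ ν : ProbabilityMeasure M) : Prop :=
  L.IsChronologicalCoupling π μ ν ∧ L.IsOptimalCoupling p π μ ν ∧
    ∃ a b : M → ℝ, Measurable a ∧ Measurable b ∧
      Integrable (fun z : M × M => a z.1 + b z.2)
        ((μ : Measure M).prod (ν : Measure M)) ∧
      ∀ x ∈ (μ : Measure M).support, ∀ y ∈ (ν : Measure M).support,
        L.lPow p x y ≤ ((a x + b y : ℝ) : EReal)

/-- `(μ, ν)` is strongly timelike `p`-dualizable. -/
def StronglyTimelikeDualizable (p : ℝ) (μ ν : ProbabilityMeasure M) : Prop :=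
  (∃ π : Measure (M × M), L.TimelikeDualizableBy p π μ ν) ∧
    ∃ Γ : Set (M × M), MeasurableSet Γ ∧ L.CyclicallyMonotone p Γ ∧
      (∀ z ∈ Γ, L.ll z.1 z.2 ∧
        z.1 ∈ (μ : Measure M).support ∧ z.2 ∈ (ν : Measure M).support) ∧
      ∀ σ : Measure (M × M), L.IsCausalCoupling σ μ ν →
        (L.IsOptimalCoupling p σ μ ν ↔ σ Γ = 1)

/-- `(μ_t)_{t ∈ [0, 1]}` is an `ℓ_p`-geodesic. -/
def IsCostGeodesic (p : ℝ) (μ : unitInterval → ProbabilityMeasure M) : Prop :=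
  0 < L.cost p (μ 0) (μ 1) ∧ L.cost p (μ 0) (μ 1) < ⊤ ∧
    ∀ s t : unitInterval, s < t →
      L.cost p (μ s) (μ t) = (((t : ℝ) - (s : ℝ) : ℝ) : EReal) * L.cost p (μ 0) (μ 1)

end Transport

end LorentzianPreLength

/-- The `L^∞(m)`-norm of the density `ρ` of `μ = ρ m`. -/
def densityBound {M : Type*} [MeasurableSpace M] (m : Measure M) (μ : ProbabilityMeasure M) :
    ℝ≥0∞ :=
  essSup ((μ : Measure M).rnDeriv m) m

open Classical in
/-- The relative entropy `Ent_m(μ) = ∫ ρ log ρ dm ∈ [-∞, ∞)` if `μ = ρ m` and the positive part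
of `ρ log ρ` is integrable, and `∞` otherwise. -/
def relEntropy {M : Type*} [MeasurableSpace M] (m : Measure M) (μ : ProbabilityMeasure M) :
    EReal :=
  let f : M → ℝ := fun x =>
    ((μ : Measure M).rnDeriv m x).toReal * Real.log ((μ : Measure M).rnDeriv m x).toReal
  if (μ : Measure M) ≪ m ∧ ∫⁻ x, ENNReal.ofReal (f x) ∂m < ⊤ then
    ((∫⁻ x, ENNReal.ofReal (f x) ∂m : ℝ≥0∞) : EReal) -
      ((∫⁻ x, ENNReal.ofReal (-f x) ∂m : ℝ≥0∞) : EReal)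
  else ⊤

/-- The finiteness domain of a functional `E`. -/
def finiteDomain {M : Type*} [MeasurableSpace M] (E : ProbabilityMeasure M → EReal) :
    Set (ProbabilityMeasure M) :=
  {μ | E μ ≠ ⊤ ∧ E μ ≠ ⊥}

/-- The exponentiated functional `U_N(μ) = exp(-E(μ) / N) ∈ [0, ∞]`. -/
def expFunctional {M : Type*} [MeasurableSpace M] (E : ProbabilityMeasure M → EReal) (N : ℝ)
    (μ : ProbabilityMeasure M) : ℝ≥0∞ :=
  EReal.exp (-E μ / (N : EReal))

open Classical in
/-- The distortion coefficient `σ_{K,N}^{(r)}(θ) ∈ [0, ∞]` for `r ∈ [0, 1]`, `θ ∈ [0, ∞]`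
and `N > 0`; for `K < 0` and `θ = ∞` it is the limit as `θ → ∞`. -/
def distortion (K N r : ℝ) (θ : ℝ≥0∞) : ℝ≥0∞ :=
  if K = 0 ∨ θ = 0 then ENNReal.ofReal r
  else if K < 0 then
    if θ = ⊤ then (if r = 1 then 1 else 0)
    else ENNReal.ofReal
      (Real.sinh (r * θ.toReal * √(-K / N)) / Real.sinh (θ.toReal * √(-K / N)))
  else if θ ≠ ⊤ ∧ K * θ.toReal ^ 2 < N * Real.pi ^ 2 then
    ENNReal.ofReal
      (Real.sin (r * θ.toReal * √(K / N)) / Real.sin (θ.toReal * √(K / N)))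
  else ⊤

namespace LorentzianPreLength

variable {M : Type*} [TopologicalSpace M] [MeasurableSpace M] (L : LorentzianPreLength M)

/-- The `(K, N)`-convexity inequality of `U_N = exp(-E / N)` along `(μ_t)`, for all
`t ∈ [0, 1]`, with `T_π = ‖τ‖_{L²(π)}`. -/
def ConvexityInequality (E : ProbabilityMeasure M → EReal) (K N : ℝ)
    (π : Measure (M × M)) (μ : unitInterval → ProbabilityMeasure M) : Prop :=
  ∀ t : unitInterval,
    distortion K N (1 - (t : ℝ)) (L.tauNorm 2 π) * expFunctional E N (μ 0) +
      distortion K N (t : ℝ) (L.tauNorm 2 π) * expFunctional E N (μ 1) ≤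
    expFunctional E N (μ t)

/-- `(K, N, p)`-convexity of the functional `E` relative to a set `Q` of pairs of probability
measures. -/
def IsConvexRelativeTo (E : ProbabilityMeasure M → EReal) (K N p : ℝ)
    (Q : Set (ProbabilityMeasure M × ProbabilityMeasure M)) : Prop :=
  ∀ μ₀ μ₁ : ProbabilityMeasure M, (μ₀, μ₁) ∈ Q →
    μ₀ ∈ finiteDomain E → μ₁ ∈ finiteDomain E → L.cost p μ₀ μ₁ < ⊤ →
    ∃ (π : Measure (M × M)) (μ : unitInterval → ProbabilityMeasure M),
      L.IsChronologicalCoupling π μ₀ μ₁ ∧ L.IsOptimalCoupling p π μ₀ μ₁ ∧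
      L.IsCostGeodesic p μ ∧ μ 0 = μ₀ ∧ μ 1 = μ₁ ∧ L.ConvexityInequality E K N π μ

/-- The weak entropic timelike curvature-dimension condition `wTCD_p^e(K, N)`. -/
def WTCD (m : Measure M) (p K N : ℝ) : Prop :=
  L.IsConvexRelativeTo (relEntropy m) K N p
    {P | L.StronglyTimelikeDualizable p P.1 P.2 ∧
      IsCompact (P.1 : Measure M).support ∧ IsCompact (P.2 : Measure M).support}

/-- The `ℓ_p`-geodesic `(μ_t)` is good. -/
def IsGood (m : Measure M) (p K N : ℝ) (μ : unitInterval → ProbabilityMeasure M) : Prop :=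
  (∃ π : Measure (M × M),
    L.IsChronologicalCoupling π (μ 0) (μ 1) ∧ L.IsOptimalCoupling p π (μ 0) (μ 1) ∧
    L.tauNorm 2 π < ⊤ ∧ L.ConvexityInequality (relEntropy m) K N π μ) ∧
  (∀ t : unitInterval, (μ t : Measure M) ≪ m ∧ μ t ∈ finiteDomain (relEntropy m)) ∧
  ⨆ t : unitInterval, densityBound m (μ t) < ⊤

end LorentzianPreLength

end

/-!
A measure on the geodesic is found as a midpoint, then as a midpoint of midpoints, and so on along
the dyadic times; the whole curve is a weak limit. What has to be controlled is the density of one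
midpoint, and that it is again a dualizable partner of the end points, so that the construction
can be repeated.

*The space.* Regularity, global hyperbolicity and geodesics make `τ` finite and continuous and `≤`
closed (`isTame`): nearby causal pairs are joined by chains of a uniform number of short causal
steps, on each of which `τ`-lengths are bounded by the continuous local time separation. Couplings
on compact sets then form weakly compact sets, and the transport cost is continuous on them.

*Midpoints.* By strict concavity of `r ↦ r ^ p`, gluing optimal plans through a measure that
splits the cost evenly gives a plan of triples `(x, z, y)` in which `z` is almost surely a
`τ`-midpoint of `x` and `y` (`IsTame.exists_isMidPlan`). The same concavity shows that the halves
of such triples inherit cyclical monotonicity (`CyclicallyMonotone.left`,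
`CyclicallyMonotone.right`), and that the two halves over a common middle point have equal length
(`CyclicallyMonotone.τ_eq`). Hence each half of a dualizable pair is dualizable (`IsDualSet.left`,
`IsDualSet.right`), and so is every normalized part of it (`IsDualSet.restrict`).

*The density of a midpoint* (`IsDualSet.exists_midpoint_le`). Put `C = (c (F + G)) ^ (-N)` if the
end points have densities at most `F ^ (-N)` and `G ^ (-N)` and `c` bounds the distortion
coefficients from below. Among all midpoints, a compact set, take a maximizer `ρ` of `ν ↦ inf_w (∫
w dν + C ∫ exp (-w) dm)` over bounded continuous `w ≥ 0`. This functional is upper semicontinuous;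
it equals `1 + log C - Ent` where the density is at most `C`, and it does not distinguish between
densities above `C`. If the density of `ρ` exceeded `C` on a set `A` of mass `a`, the curvature
condition, applied to the normalized part of the plan that passes through `A`, would give a
midpoint `ρ'` of entropy at most `log (C / a)`, which is less than `-log (m A)` since `C m(A) <
a`. By Jensen's inequality `ρ'` charges the complement of `A`, where mass is rewarded at first
order, while removing mass from `A` costs only at second order (`exists_dualEntropy_lt`), a
contradiction. So `ρ` has density at most `C`, and since the functional determines the entropy
there, `ρ` also has entropy at most that of the midpoint provided by the curvature condition.

*Iteration.* With `c` taken at distance `D / 2 ^ n`, the bounds propagate exactly along the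
solution `coshProfile` of `g'' = a ^ 2 g`, which is smallest at `1 / 2`; this is where the
constant of the theorem comes from. The exponentiated entropies propagate along the right-hand
side of the convexity inequality, formed with the optimal coupling whose `L²`-norm of `τ` is the
least favourable one (`IsTame.exists_extremal_coupling`), since the distortion coefficients
themselves satisfy the midpoint identity (`distortion_interpolation`). The limit along the dyadic
chains (`exists_dyadic_chain`, `IsTame.exists_limit_curve`) keeps all bounds, and its costs are
linear by the reverse triangle inequality (`IsTame.isCostGeodesic`).
-/

open Filter Topology
open scoped NNReal BoundedContinuousFunction ProbabilityTheory

noncomputable section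

namespace LorentzianPreLength

/-! ### Continuity of the time separation -/

section Causality

variable {M : Type*} [MetricSpace M] (L : LorentzianPreLength M)

/-- What the transport argument needs from the causal structure: the time separation is finite and
continuous, the causal relation is closed, and causal diamonds of compact sets are compact. -/
structure IsTame : Prop where
  continuous_τ : Continuous fun z : M × M => L.τ z.1 z.2
  τ_ne_top : ∀ x y, L.τ x y ≠ ⊤
  isClosed_le : IsClosed {z : M × M | L.le z.1 z.2}
  isCompact_diamond : ∀ A B : Set M, IsCompact A → IsCompact B → IsCompact (L.diamond A B)

variable {L}

lemma IsCausalCurve.mono {γ : ℝ → M} {a b s t : ℝ} (h : L.IsCausalCurve γ a b) (has : a ≤ s)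
    (hst : s < t) (htb : t ≤ b) : L.IsCausalCurve γ s t := by
  have hsub : Icc s t ⊆ Icc a b := Icc_subset_Icc has htb
  exact ⟨hst, h.2.1.mono hsub, fun u hu v hv huv => h.2.2 u (hsub hu) v (hsub hv) huv⟩

lemma IsCausalCurve.le_of_le {γ : ℝ → M} {a b : ℝ} (h : L.IsCausalCurve γ a b) {s t : ℝ}
    (hs : s ∈ Icc a b) (ht : t ∈ Icc a b) (hst : s ≤ t) : L.le (γ s) (γ t) := by
  rcases hst.eq_or_lt with rfl | hlt
  · exact L.le_refl _
  · exact h.2.2 s hs t ht hlt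

/-- Every partition bounds the `τ`-length from above. -/
lemma len_le_sum (γ : ℝ → M) {a b : ℝ} {n : ℕ} (u : ℕ → ℝ) (h0 : u 0 = a) (hn : u n = b)
    (hu : ∀ i < n, u i < u (i + 1)) :
    L.len γ a b ≤ ∑ i ∈ Finset.range n, L.τ (γ (u i)) (γ (u (i + 1))) :=
  (iInf_le _ n).trans ((iInf_le _ u).trans (iInf_le _ ⟨h0, hn, hu⟩))

lemma len_le_τ (γ : ℝ → M) {a b : ℝ} (hab : a < b) : L.len γ a b ≤ L.τ (γ a) (γ b) := by
  refine (len_le_sum (n := 1) γ (fun i => if i = 0 then a else b) (by simp) (by simp)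
    fun i hi => ?_).trans (by simp)
  obtain rfl : i = 0 := by omega
  simpa using hab

lemma len_le_add (γ : ℝ → M) (a b c : ℝ) :
    L.len γ a c ≤ L.len γ a b + L.len γ b c := by
  conv_rhs => rw [len, len]
  simp only [ENNReal.iInf_add, ENNReal.add_iInf]
  refine le_iInf fun k => le_iInf fun v => le_iInf fun hv => le_iInf fun n => le_iInf fun u =>
    le_iInf fun hu => ?_
  obtain ⟨hu0, hun, hu⟩ := hu
  obtain ⟨hv0, hvk, hv⟩ := hv
  have key : ∀ i, (if n + i ≤ n then u (n + i) else v (n + i - n)) = v i := by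
    intro i
    split_ifs with h
    · obtain rfl : i = 0 := by omega
      simp [hun, hv0]
    · simp
  refine (len_le_sum (n := n + k) γ (fun i => if i ≤ n then u i else v (i - n))
    (by simpa using hu0) ((key k).trans hvk) fun i hi => ?_).trans ?_
  · rcases lt_or_ge i n with h | h
    · simpa [h.le, Nat.succ_le_of_lt h] using hu i h
    · obtain ⟨j, rfl⟩ := Nat.exists_eq_add_of_le h
      simp only [add_assoc, key]
      exact hv j (by omega)
  · rw [Finset.sum_range_add]
    refine add_le_add (Finset.sum_le_sum fun i hi => ?_) (Finset.sum_le_sum fun i _ => ?_)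
    · have h := Finset.mem_range.1 hi
      simp [h.le, Nat.succ_le_of_lt h]
    · simp only [add_assoc, key]
      exact le_rfl

lemma sum_τ_le {u : ℕ → M} {k : ℕ} (h : ∀ i < k, L.le (u i) (u (i + 1))) :
    L.le (u 0) (u k) ∧ ∑ i ∈ Finset.range k, L.τ (u i) (u (i + 1)) ≤ L.τ (u 0) (u k) := by
  induction k with
  | zero => simp [L.le_refl]
  | succ k ih =>
    obtain ⟨h1, h2⟩ := ih fun i hi => h i (by omega)
    have h3 := h k (by omega)
    refine ⟨L.le_trans _ _ _ h1 h3, ?_⟩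
    rw [Finset.sum_range_succ]
    exact (add_le_add_left h2 _).trans (L.reverse_triangle _ _ _ h1 h3)

/-- In a regular localizing neighbourhood, `τ`-lengths of causal curves are bounded by a finite
continuous function `w` of their endpoints, which in turn is bounded by `τ`. -/
lemma IsRegularLocalizing.exists_local_bound {Ω : Set M} (h : L.IsRegularLocalizing Ω) :
    ∃ w : M → M → ℝ≥0∞, ContinuousOn (fun z : M × M => w z.1 z.2) (Ω ×ˢ Ω) ∧
      (∀ p ∈ Ω, ∀ q ∈ Ω, w p q ≠ ⊤) ∧ (∀ p ∈ Ω, ∀ q ∈ Ω, L.le p q → w p q ≤ L.τ p q) ∧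
      (∀ p ∈ Ω, L.τ p p = 0) ∧
      ∀ (γ : ℝ → M) (a b : ℝ), L.IsCausalCurve γ a b → MapsTo γ (Icc a b) Ω →
        L.len γ a b ≤ w (γ a) (γ b) := by
  obtain ⟨-, ω, hle, hll, hcont, hfin, -, hmax⟩ := h
  have hω : ∀ p : Ω, ω.τ p p = 0 := by
    intro p
    by_contra hp
    have h1 := ω.reverse_triangle p p p (ω.le_refl p) (ω.le_refl p)
    have h2 : ω.τ p p + 0 < ω.τ p p + ω.τ p p :=
      ENNReal.add_lt_add_left (hfin p p) (pos_iff_ne_zero.2 hp)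
    rw [add_zero] at h2
    exact absurd h1 (not_le.2 h2)
  have hτ : ∀ p ∈ Ω, L.τ p p = 0 := by
    intro p hp
    by_contra h0
    have h1 : L.ll p p := (L.τ_pos_iff p p).1 (pos_iff_ne_zero.2 h0)
    have h2 := (ω.τ_pos_iff ⟨p, hp⟩ ⟨p, hp⟩).2 ((hll _ _).2 h1)
    exact h2.ne' (hω _)
  classical
  obtain ⟨w, hval⟩ : ∃ w : M → M → ℝ≥0∞, ∀ p (hp : p ∈ Ω) q (hq : q ∈ Ω),
      w p q = ω.τ ⟨p, hp⟩ ⟨q, hq⟩ :=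
    ⟨fun p q => if h : p ∈ Ω ∧ q ∈ Ω then ω.τ ⟨p, h.1⟩ ⟨q, h.2⟩ else 0,
      fun p hp q hq => dif_pos ⟨hp, hq⟩⟩
  refine ⟨w, ?_, ?_, ?_, hτ, ?_⟩
  · rw [continuousOn_iff_continuous_domRestrict]
    have h1 : Continuous fun z : (Ω ×ˢ Ω : Set (M × M)) =>
        ((⟨z.1.1, z.2.1⟩, ⟨z.1.2, z.2.2⟩) : Ω × Ω) := by fun_prop
    refine (hcont.comp h1).congr fun z => ?_
    exact (hval _ z.2.1 _ z.2.2).symm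
  · intro p hp q hq
    rw [hval p hp q hq]
    exact hfin _ _
  · intro p hp q hq hpq
    rw [hval p hp q hq]
    by_cases hne : p = q
    · subst hne
      simp [hω]
    · obtain ⟨γ, a, b, hγ, -, rfl, rfl, hlen, -⟩ :=
        hmax ⟨p, hp⟩ ⟨q, hq⟩ hpq (fun h => hne (congrArg Subtype.val h))
      rw [← hlen]
      exact len_le_τ γ hγ.1
  · intro γ a b hγ hmaps
    have ha : γ a ∈ Ω := hmaps (left_mem_Icc.2 hγ.1.le)
    have hb : γ b ∈ Ω := hmaps (right_mem_Icc.2 hγ.1.le)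
    rw [hval _ ha _ hb]
    by_cases hne : γ a = γ b
    · have := len_le_τ (L := L) γ hγ.1
      rw [← hne, hτ _ ha] at this
      exact this.trans zero_le
    · have hle' : L.le (γ a) (γ b) :=
        hγ.le_of_le (left_mem_Icc.2 hγ.1.le) (right_mem_Icc.2 hγ.1.le) hγ.1.le
      obtain ⟨σ, c, d, -, -, -, -, hlen, hopt, -⟩ :=
        hmax ⟨γ a, ha⟩ ⟨γ b, hb⟩ hle' (fun h => hne (congrArg Subtype.val h))
      rw [← hlen]
      exact hopt γ a b hγ hmaps rfl rfl

/-- A Lipschitz curve of arclength at most `(k + 1) η` splits into `k + 1` pieces of arclength at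
most `η`. -/
lemma exists_partition_eVariationOn_le {γ : ℝ → M} {C : ℝ≥0} {η : ℝ≥0∞} (hη : η ≠ ⊤) (a : ℝ)
    (k : ℕ) : ∀ b : ℝ, a ≤ b → LipschitzOnWith C γ (Icc a b) →
      eVariationOn γ (Icc a b) ≤ (k + 1 : ℕ) * η →
      ∃ t : ℕ → ℝ, t 0 = a ∧ t (k + 1) = b ∧ (∀ i ≤ k, t i ≤ t (i + 1)) ∧
        ∀ i ≤ k, eVariationOn γ (Icc (t i) (t (i + 1))) ≤ η := by
  induction k with
  | zero =>
    intro b hab _ hv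
    refine ⟨fun i => if i = 0 then a else b, by simp, by simp, ?_, ?_⟩
    · intro i hi
      obtain rfl : i = 0 := by omega
      simpa using hab
    · intro i hi
      obtain rfl : i = 0 := by omega
      simpa using hv
  | succ k ih =>
    intro b hab hL hv
    have hadd : ∀ s ∈ Icc a b, ∀ t ∈ Icc a b, s ≤ t →
        eVariationOn γ (Icc a s) + eVariationOn γ (Icc s t) = eVariationOn γ (Icc a t) := by
      intro s hs t ht hst
      simpa using eVariationOn.Icc_add_Icc γ (s := univ) hs.1 hst (mem_univ s)
    have hlip : ∀ s ∈ Icc a b, ∀ t ∈ Icc a b, s ≤ t →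
        eVariationOn γ (Icc s t) ≤ C * ENNReal.ofReal (t - s) := by
      intro s hs t ht hst
      have h1 := (hL.mono (Icc_subset_Icc hs.1 ht.2)).comp_eVariationOn_le
        (g := id) (s := Icc s t) (fun x hx => hx)
      rwa [eVariationOn_id_Icc] at h1
    have hfin : ∀ t ∈ Icc a b, eVariationOn γ (Icc a t) ≠ ⊤ := by
      intro t ht
      refine ne_top_of_le_ne_top ?_ (hlip a (left_mem_Icc.2 hab) t ht ht.1)
      exact ENNReal.mul_ne_top ENNReal.coe_ne_top ENNReal.ofReal_ne_top
    set f : ℝ → ℝ := fun t => (eVariationOn γ (Icc a t)).toReal with hf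
    have hcont : ContinuousOn f (Icc a b) := by
      refine (LipschitzOnWith.of_le_add_mul C (f := f) ?_).continuousOn
      intro x hx y hy
      rcases le_total x y with h | h
      · have h1 : f x ≤ f y := ENNReal.toReal_mono (hfin y hy)
          (eVariationOn.mono _ (Icc_subset_Icc_right h))
        have h2 : 0 ≤ C * dist x y := by positivity
        linarith
      · have h1 := hadd y hy x hx h
        have h2 := hlip y hy x hx h
        have h3 : eVariationOn γ (Icc a x) ≤
            eVariationOn γ (Icc a y) + C * ENNReal.ofReal (x - y) := by
          rw [← h1]; gcongr
        have h4 := ENNReal.toReal_mono (ENNReal.add_ne_top.2 ⟨hfin y hy,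
          ENNReal.mul_ne_top ENNReal.coe_ne_top ENNReal.ofReal_ne_top⟩) h3
        rw [ENNReal.toReal_add (hfin y hy)
          (ENNReal.mul_ne_top ENNReal.coe_ne_top ENNReal.ofReal_ne_top), ENNReal.toReal_mul,
          ENNReal.toReal_ofReal (by linarith)] at h4
        rw [Real.dist_eq, abs_of_nonneg (by linarith)]
        simpa using h4
    by_cases hsmall : eVariationOn γ (Icc a b) ≤ (k + 1 : ℕ) * η
    · obtain ⟨t, h0, h1, hm, hvar⟩ := ih b hab hL hsmall
      refine ⟨fun i => if i ≤ k + 1 then t i else b, by simpa using h0, by simp, ?_, ?_⟩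
      · intro i hi
        rcases hi.eq_or_lt with rfl | h
        · simp [h1]
        · simpa [hi, h, Nat.lt_succ_iff.1 h] using hm i (by omega)
      · intro i hi
        rcases hi.eq_or_lt with rfl | h
        · simp [h1, eVariationOn.subsingleton]
        · simpa [hi, h, Nat.lt_succ_iff.1 h] using hvar i (by omega)
    · have hkη : ((k + 1 : ℕ) * η : ℝ≥0∞) ≠ ⊤ :=
        ENNReal.mul_ne_top (ENNReal.natCast_ne_top _) hη
      have hmem : ((k + 1 : ℕ) * η : ℝ≥0∞).toReal ∈ Icc (f a) (f b) := by
        constructor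
        · simp [hf, eVariationOn.subsingleton]
          positivity
        · exact ENNReal.toReal_mono (hfin b (right_mem_Icc.2 hab)) (not_le.1 hsmall).le
      obtain ⟨s, hs, hfs⟩ := intermediate_value_Icc hab hcont hmem
      have hfs' : eVariationOn γ (Icc a s) = (k + 1 : ℕ) * η :=
        (ENNReal.toReal_eq_toReal_iff' (hfin s hs) hkη).1 hfs
      have hrest : eVariationOn γ (Icc s b) ≤ η := by
        have h1 := hadd s hs b (right_mem_Icc.2 hab) hs.2
        rw [← h1, hfs'] at hv
        refine (ENNReal.add_le_add_iff_left hkη).1 (hv.trans (le_of_eq ?_))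
        push_cast
        ring
      obtain ⟨t, h0, h1, hm, hvar⟩ := ih s hs.1 (hL.mono (Icc_subset_Icc_right hs.2)) hfs'.le
      refine ⟨fun i => if i ≤ k + 1 then t i else b, by simpa using h0, by simp, ?_, ?_⟩
      · intro i hi
        rcases hi.eq_or_lt with rfl | h
        · simp [h1, hs.2]
        · simpa [hi, h, Nat.lt_succ_iff.1 h] using hm i (by omega)
      · intro i hi
        rcases hi.eq_or_lt with rfl | h
        · simpa [h1] using hrest
        · simpa [hi, h, Nat.lt_succ_iff.1 h] using hvar i (by omega)

/-- Pairs `x ≤ y` in compact sets are joined by chains, of a uniform number of steps of size at most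
`η` inside the causal diamond, whose steps carry the time separation of `x` and `y` and are bounded
by any local bound as in `IsRegularLocalizing.exists_local_bound`. -/
lemma exists_chain (hhyp : L.KGloballyHyperbolic) (hgeo : L.IsGeodesicSpace)
    (hdiag : ∀ x, L.τ x x = 0) {A B : Set M} (hA : IsCompact A) (hB : IsCompact B)
    {η : ℝ} (hη : 0 < η) :
    ∃ k : ℕ, ∀ x ∈ A, ∀ y ∈ B, L.le x y → ∃ (u : ℕ → M) (l : ℕ → ℝ≥0∞),
      u 0 = x ∧ u k = y ∧ (∀ i ≤ k, u i ∈ L.diamond A B) ∧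
      L.τ x y ≤ ∑ i ∈ Finset.range k, l i ∧
      ∀ i < k, L.le (u i) (u (i + 1)) ∧ dist (u (i + 1)) (u i) ≤ η ∧
        ∀ (Ω : Set M) (w : M → M → ℝ≥0∞), Metric.closedBall (u i) η ⊆ Ω →
          (∀ (γ : ℝ → M) (a b : ℝ), L.IsCausalCurve γ a b → MapsTo γ (Icc a b) Ω →
            L.len γ a b ≤ w (γ a) (γ b)) → l i ≤ w (u i) (u (i + 1)) := by
  obtain ⟨c, hc⟩ := hhyp.1 _ (hhyp.2 A B hA hB)
  obtain ⟨k, hk⟩ := exists_nat_gt (c / η)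
  refine ⟨k + 1, fun x hx y hy hxy => ?_⟩
  have hmem : ∀ z, L.le x z → L.le z y → z ∈ L.diamond A B :=
    fun z h1 h2 => ⟨⟨x, hx, h1⟩, ⟨y, hy, h2⟩⟩
  by_cases hne : x = y
  · subst hne
    exact ⟨fun _ => x, fun _ => 0, rfl, rfl, fun _ _ => hmem x (L.le_refl x) (L.le_refl x),
      by simp [hdiag], fun i _ => ⟨L.le_refl x, by simpa using hη.le, fun _ _ _ _ => zero_le⟩⟩
  obtain ⟨γ, a, b, hγ, rfl, rfl, hlen⟩ := hgeo x y hxy hne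
  have hab := hγ.1.le
  have hmaps : MapsTo γ (Icc a b) (L.diamond A B) := fun t ht =>
    hmem _ (hγ.le_of_le (left_mem_Icc.2 hab) ht ht.1) (hγ.le_of_le ht (right_mem_Icc.2 hab) ht.2)
  obtain ⟨C, hC⟩ := hγ.2.1.exists_lipschitzOnWith_of_compact isCompact_Icc
  have hvar : eVariationOn γ (Icc a b) ≤ (k + 1 : ℕ) * ENNReal.ofReal η := by
    refine (hc γ a b hγ hmaps).trans ?_
    rw [← ENNReal.ofReal_natCast, ← ENNReal.ofReal_mul (by positivity)]
    refine ENNReal.ofReal_le_ofReal ?_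
    rw [div_lt_iff₀ hη] at hk
    push_cast
    nlinarith
  obtain ⟨t, ht0, htk, hmono, hpiece⟩ :=
    exists_partition_eVariationOn_le ENNReal.ofReal_ne_top a k b hab hC hvar
  have hlow : ∀ i ≤ k + 1, a ≤ t i := by
    intro i
    induction i with
    | zero => intro _; exact ht0.ge
    | succ i ih => intro hi; exact (ih (by omega)).trans (hmono i (by omega))
  have hupp : ∀ j, ∀ i, i + j = k + 1 → t i ≤ b := by
    intro j
    induction j with
    | zero => rintro i rfl; exact htk.le
    | succ j ih => intro i hi; exact (hmono i (by omega)).trans (ih (i + 1) (by omega))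
  have htmem : ∀ i ≤ k + 1, t i ∈ Icc a b := fun i hi =>
    ⟨hlow i hi, hupp (k + 1 - i) i (by omega)⟩
  classical
  have hsum : ∀ i ≤ k + 1, a < t i → L.len γ a (t i) ≤ ∑ j ∈ Finset.range i,
      (if t j < t (j + 1) then L.len γ (t j) (t (j + 1)) else 0) := by
    intro i
    induction i with
    | zero => intro _ h; exact absurd h (by simp [ht0])
    | succ i ih =>
      intro hi hlt
      rw [Finset.sum_range_succ]
      rcases (hmono i (by omega)).eq_or_lt with heq | hlt'
      · rw [heq, if_neg (lt_irrefl _), add_zero, ← heq]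
        exact ih (by omega) (by rwa [heq])
      · rw [if_pos hlt']
        rcases (hlow i (by omega)).eq_or_lt with h0 | h0
        · rw [← h0]; exact le_add_self
        · exact (len_le_add γ a (t i) (t (i + 1))).trans
            (add_le_add_left (ih (by omega) h0) _)
  refine ⟨fun i => γ (t i), fun j => if t j < t (j + 1) then L.len γ (t j) (t (j + 1)) else 0,
    congrArg γ ht0, congrArg γ htk, fun i hi => hmaps (htmem i hi), ?_, fun i hi => ?_⟩
  · have := hsum (k + 1) (by omega) (by rw [htk]; exact hγ.1)
    rwa [htk, hlen] at this
  have hi1 := htmem i (by omega)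
  have hi2 := htmem (i + 1) (by omega)
  have hball : ∀ r ∈ Icc (t i) (t (i + 1)), γ r ∈ Metric.closedBall (γ (t i)) η := by
    intro r hr
    have h1 := (eVariationOn.edist_le γ hr (left_mem_Icc.2 (hr.1.trans hr.2))).trans
      (hpiece i (by omega))
    rwa [edist_dist, ENNReal.ofReal_le_ofReal_iff hη.le] at h1
  refine ⟨hγ.le_of_le hi1 hi2 (hmono i (by omega)),
    hball _ (right_mem_Icc.2 (hmono i (by omega))), fun Ω w hΩ hw => ?_⟩
  dsimp only
  split_ifs with hlt
  · exact hw γ _ _ (hγ.mono hi1.1 hlt hi2.2) fun r hr => hΩ (hball r hr)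
  · exact zero_le

/-- Passing to the limit along chains: if `x ≤ y` along an ultrafilter converging to `(x₀, y₀)`,
then `x₀ ≤ y₀`, and bounds of `τ` from below persist. -/
lemma le_and_le_τ_of_ultrafilter [ProperSpace M] (hclosed : L.LocallyCausallyClosed)
    (hhyp : L.KGloballyHyperbolic) (hreg : L.IsRegular) (hgeo : L.IsGeodesicSpace)
    (F : Ultrafilter (M × M)) {x₀ y₀ : M} (hF : (F : Filter (M × M)) ≤ 𝓝 (x₀, y₀))
    (hle : ∀ᶠ z in (F : Filter (M × M)), L.le z.1 z.2) :
    L.le x₀ y₀ ∧ L.τ x₀ y₀ ≠ ⊤ ∧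
      ∀ c, (∀ᶠ z in (F : Filter (M × M)), c ≤ L.τ z.1 z.2) → c ≤ L.τ x₀ y₀ := by
  choose Ω hΩo hΩx hΩ using hreg
  choose w hwc hwfin hwτ hτ0 hw using fun x => (hΩ x).exists_local_bound
  choose U hUo hUx hU using hclosed
  have hdiag : ∀ x, L.τ x x = 0 := fun x => hτ0 x x (hΩx x)
  have hA := isCompact_closedBall x₀ (1 : ℝ)
  have hB := isCompact_closedBall y₀ (1 : ℝ)
  have hC := hhyp.2 _ _ hA hB
  obtain ⟨δ, hδ, hcov⟩ := lebesgue_number_lemma_of_metric hC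
    (c := fun x => Ω x ∩ U x) (fun x => (hΩo x).inter (hUo x))
    (fun x _ => mem_iUnion.2 ⟨x, hΩx x, hUx x⟩)
  obtain ⟨k, hk⟩ := exists_chain hhyp hgeo hdiag hA hB (η := δ / 3) (by positivity)
  have hnear : ∀ᶠ z in (F : Filter (M × M)),
      z.1 ∈ Metric.closedBall x₀ 1 ∧ z.2 ∈ Metric.closedBall y₀ 1 ∧ L.le z.1 z.2 := by
    have h1 : ∀ᶠ z in 𝓝 (x₀, y₀), z.1 ∈ Metric.closedBall x₀ 1 ∧ z.2 ∈ Metric.closedBall y₀ 1 := by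
      filter_upwards [prod_mem_nhds (Metric.closedBall_mem_nhds x₀ one_pos)
        (Metric.closedBall_mem_nhds y₀ one_pos)] with z hz using hz
    filter_upwards [hF h1, hle] with z hz hz' using ⟨hz.1, hz.2, hz'⟩
  have hex : ∀ z : M × M, ∃ (u : ℕ → M) (l : ℕ → ℝ≥0∞),
      (z.1 ∈ Metric.closedBall x₀ 1 ∧ z.2 ∈ Metric.closedBall y₀ 1 ∧ L.le z.1 z.2) →
      u 0 = z.1 ∧ u k = z.2 ∧
      (∀ i ≤ k, u i ∈ L.diamond (Metric.closedBall x₀ 1) (Metric.closedBall y₀ 1)) ∧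
      L.τ z.1 z.2 ≤ ∑ i ∈ Finset.range k, l i ∧
      ∀ i < k, L.le (u i) (u (i + 1)) ∧ dist (u (i + 1)) (u i) ≤ δ / 3 ∧
        ∀ (Ω : Set M) (w : M → M → ℝ≥0∞), Metric.closedBall (u i) (δ / 3) ⊆ Ω →
          (∀ (γ : ℝ → M) (a b : ℝ), L.IsCausalCurve γ a b → MapsTo γ (Icc a b) Ω →
            L.len γ a b ≤ w (γ a) (γ b)) → l i ≤ w (u i) (u (i + 1)) := by
    intro z
    by_cases hz : z.1 ∈ Metric.closedBall x₀ 1 ∧ z.2 ∈ Metric.closedBall y₀ 1 ∧ L.le z.1 z.2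
    · obtain ⟨u, l, h⟩ := hk z.1 hz.1 z.2 hz.2.1 hz.2.2
      exact ⟨u, l, fun _ => h⟩
    · exact ⟨fun _ => x₀, fun _ => 0, fun h => absurd h hz⟩
  choose u l hul using hex
  -- limits of the chain points
  have hlim : ∀ i, ∃ v : M, i ≤ k →
      v ∈ L.diamond (Metric.closedBall x₀ 1) (Metric.closedBall y₀ 1) ∧
        Tendsto (fun z => u z i) F (𝓝 v) := by
    intro i
    by_cases hi : i ≤ k
    · obtain ⟨v, hv, hv'⟩ := hC.ultrafilter_le_nhds (F.map fun z => u z i)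
        (le_principal_iff.2 (by
          change ∀ᶠ z in (F : Filter (M × M)), u z i ∈ _
          filter_upwards [hnear] with z hz using (hul z hz).2.2.1 i hi))
      exact ⟨v, fun _ => ⟨hv, hv'⟩⟩
    · exact ⟨x₀, fun h => absurd h hi⟩
  choose v hv using hlim
  have hv0 : v 0 = x₀ := by
    refine tendsto_nhds_unique (hv 0 (by omega)).2 ?_
    refine (tendsto_congr' ?_).1 ((continuous_fst.tendsto (x₀, y₀)).mono_left hF)
    filter_upwards [hnear] with z hz using (hul z hz).1.symm
  have hvk : v k = y₀ := by
    refine tendsto_nhds_unique (hv k le_rfl).2 ?_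
    refine (tendsto_congr' ?_).1 ((continuous_snd.tendsto (x₀, y₀)).mono_left hF)
    filter_upwards [hnear] with z hz using (hul z hz).2.1.symm
  -- consecutive limit points lie in a common neighbourhood
  have hstep : ∀ i, ∃ q : M, i < k → L.le (v i) (v (i + 1)) ∧ v i ∈ Ω q ∧ v (i + 1) ∈ Ω q ∧
      ∀ᶠ z in (F : Filter (M × M)), l z i ≤ w q (u z i) (u z (i + 1)) := by
    intro i
    by_cases hi : i < k
    swap
    · exact ⟨x₀, fun h => absurd h hi⟩
    obtain ⟨hvi, hti⟩ := hv i hi.le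
    obtain ⟨-, hti'⟩ := hv (i + 1) hi
    obtain ⟨q, hq⟩ := hcov (v i) hvi
    have hclose : ∀ᶠ z in (F : Filter (M × M)), dist (u z i) (v i) < δ / 3 :=
      hti.eventually (Metric.ball_mem_nhds _ (by positivity))
    have hdist : dist (v (i + 1)) (v i) ≤ δ / 3 := by
      refine le_of_tendsto (hti'.dist hti) ?_
      filter_upwards [hnear] with z hz using ((hul z hz).2.2.2.2 i hi).2.1
    have hvi1 : v (i + 1) ∈ Metric.ball (v i) δ := Metric.mem_ball.2 (by linarith)
    refine ⟨q, fun _ => ⟨?_, (hq (Metric.mem_ball_self hδ)).1, (hq hvi1).1, ?_⟩⟩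
    · refine ((hU q).mem_of_tendsto (hti.prodMk_nhds hti') ?_).2.2
      filter_upwards [hnear, hclose] with z hz hz'
      have h1 := (hul z hz).2.2.2.2 i hi
      refine ⟨subset_closure (hq (Metric.mem_ball.2 (by linarith))).2,
        subset_closure (hq (Metric.mem_ball.2 ?_)).2, h1.1⟩
      linarith [dist_triangle (u z (i + 1)) (u z i) (v i), h1.2.1]
    · filter_upwards [hnear, hclose] with z hz hz'
      refine ((hul z hz).2.2.2.2 i hi).2.2 (Ω q) (w q) (fun p hp => ?_) (hw q)
      refine (hq (Metric.mem_ball.2 ?_)).1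
      linarith [dist_triangle p (u z i) (v i), Metric.mem_closedBall.1 hp]
  choose q hq using hstep
  have hchain := sum_τ_le (L := L) (u := v) (k := k) fun i hi => (hq i hi).1
  rw [hv0, hvk] at hchain
  have htend : Tendsto (fun z => ∑ i ∈ Finset.range k, w (q i) (u z i) (u z (i + 1))) F
      (𝓝 (∑ i ∈ Finset.range k, w (q i) (v i) (v (i + 1)))) := by
    refine tendsto_finsetSum _ fun i hi => ?_
    have hi := Finset.mem_range.1 hi
    obtain ⟨-, h1, h2, -⟩ := hq i hi
    have h3 : ContinuousAt (fun z : M × M => w (q i) z.1 z.2) (v i, v (i + 1)) :=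
      (hwc (q i)).continuousAt (((hΩo (q i)).prod (hΩo (q i))).mem_nhds ⟨h1, h2⟩)
    exact h3.tendsto.comp ((hv i hi.le).2.prodMk_nhds (hv (i + 1) hi).2)
  have hbound : ∀ᶠ z in (F : Filter (M × M)),
      L.τ z.1 z.2 ≤ ∑ i ∈ Finset.range k, w (q i) (u z i) (u z (i + 1)) := by
    have h1 : ∀ᶠ z in (F : Filter (M × M)), ∀ i ∈ Finset.range k,
        l z i ≤ w (q i) (u z i) (u z (i + 1)) :=
      (Filter.eventually_all_finset _).2 fun i hi => (hq i (Finset.mem_range.1 hi)).2.2.2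
    filter_upwards [hnear, h1] with z hz hz'
    exact (hul z hz).2.2.2.1.trans (Finset.sum_le_sum hz')
  have hwle : ∑ i ∈ Finset.range k, w (q i) (v i) (v (i + 1)) ≤ L.τ x₀ y₀ := by
    refine (Finset.sum_le_sum fun i hi => ?_).trans hchain.2
    obtain ⟨h0, h1, h2, -⟩ := hq i (Finset.mem_range.1 hi)
    exact hwτ (q i) _ h1 _ h2 h0
  refine ⟨hchain.1, ?_, fun c hc => ?_⟩
  · -- finiteness is not visible in the limit; it comes from a chain joining `x₀` to `y₀`
    obtain ⟨u', l', h0, hk', hmem, hsum, hl⟩ := hk x₀ (Metric.mem_closedBall_self zero_le_one) y₀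
      (Metric.mem_closedBall_self zero_le_one) hchain.1
    refine ne_top_of_le_ne_top (ENNReal.sum_ne_top.2 fun i hi => ?_) hsum
    have hi := Finset.mem_range.1 hi
    obtain ⟨q', hq'⟩ := hcov (u' i) (hmem i hi.le)
    have hsub : Metric.closedBall (u' i) (δ / 3) ⊆ Ω q' := fun p hp =>
      (hq' (Metric.mem_ball.2 ((Metric.mem_closedBall.1 hp).trans_lt (by linarith)))).1
    exact ne_top_of_le_ne_top (hwfin q' _ (hsub (Metric.mem_closedBall_self (by positivity))) _
      (hsub (hl i hi).2.1)) ((hl i hi).2.2 (Ω q') (w q') hsub (hw q'))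
  · refine (ge_of_tendsto htend ?_).trans hwle
    filter_upwards [hc, hbound] with z h1 h2 using h1.trans h2

/-- Regular, globally hyperbolic, locally causally closed geodesic spaces are tame. -/
lemma isTame [ProperSpace M] (hclosed : L.LocallyCausallyClosed)
    (hhyp : L.KGloballyHyperbolic) (hreg : L.IsRegular) (hgeo : L.IsGeodesicSpace) :
    L.IsTame where
  isCompact_diamond := hhyp.2
  isClosed_le := by
    refine isClosed_iff_ultrafilter.2 fun z F hF hmem => ?_
    exact (le_and_le_τ_of_ultrafilter hclosed hhyp hreg hgeo F hF hmem).1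
  τ_ne_top := by
    intro x y
    by_cases hxy : L.le x y
    · exact (le_and_le_τ_of_ultrafilter hclosed hhyp hreg hgeo (pure (x, y))
        (pure_le_nhds (x, y)) hxy).2.1
    · simp [L.τ_eq_zero x y hxy]
  continuous_τ := by
    refine continuous_iff_lower_upperSemicontinuous.2 ⟨L.lowerSemicontinuous_τ, fun z c hc => ?_⟩
    by_contra hcon
    have hfreq : ∃ᶠ z' in 𝓝 z, c ≤ L.τ z'.1 z'.2 := by
      simpa only [not_eventually, not_lt] using hcon
    have hne := Filter.frequently_iff_neBot.1 hfreq
    obtain ⟨F, hF⟩ := Ultrafilter.exists_le (𝓝 z ⊓ 𝓟 {z' | c ≤ L.τ z'.1 z'.2})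
    obtain ⟨hF, hF'⟩ := le_inf_iff.1 hF
    have hge : ∀ᶠ z' in (F : Filter (M × M)), c ≤ L.τ z'.1 z'.2 := hF' (mem_principal_self _)
    have hpos : 0 < c := zero_le.trans_lt hc
    have hle : ∀ᶠ z' in (F : Filter (M × M)), L.le z'.1 z'.2 := by
      filter_upwards [hge] with z' hz'
      exact L.le_of_ll _ _ ((L.τ_pos_iff _ _).1 (hpos.trans_le hz'))
    exact absurd ((le_and_le_τ_of_ultrafilter hclosed hhyp hreg hgeo F hF hle).2.2 c hge)
      (not_le.2 hc)

end Causality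

end LorentzianPreLength

/-! ### Weak convergence of compactly supported probability measures -/

namespace MeasureTheory.ProbabilityMeasure

variable {Y : Type*} [MetricSpace Y] [MeasurableSpace Y] [BorelSpace Y]

lemma isClosed_setOf_ae_mem {F : Set Y} (hF : IsClosed F) :
    IsClosed {π : ProbabilityMeasure Y | ∀ᵐ y ∂(π : Measure Y), y ∈ F} := by
  refine isClosed_iff_ultrafilter.2 fun π u hu hmem => ?_
  have h1 := le_liminf_measure_open_of_tendsto (μs := fun σ => σ) hu hF.isOpen_compl
  have h2 : ∀ᶠ σ : ProbabilityMeasure Y in u, (σ : Measure Y) Fᶜ = 0 := hmem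
  rw [Filter.liminf_congr (v := fun _ => 0) h2] at h1
  have h3 : (π : Measure Y) Fᶜ = 0 := by simpa using h1
  exact h3

lemma isCompact_setOf_ae_mem {K : Set Y} (hK : IsCompact K) :
    IsCompact {π : ProbabilityMeasure Y | ∀ᵐ y ∂(π : Measure Y), y ∈ K} := by
  have h := isCompact_setOfPred_probabilityMeasure_mass_eq_compl_isCompact_le (E := Y)
    (u := fun _ => 0) (K := fun _ => K) tendsto_const_nhds (fun _ => hK) (Or.inl inferInstance)
  convert h using 2
  ext π
  simp only [forall_const, nonpos_iff_eq_zero]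
  exact (null_iff_toMeasure_null π Kᶜ).symm

/-- Integration of a continuous function is weakly continuous along measures concentrated on a
fixed compact set. -/
lemma continuousOn_lintegral {f : Y → ℝ≥0} (hf : Continuous f) {K : Set Y} (hK : IsCompact K) :
    ContinuousOn (fun π : ProbabilityMeasure Y => ∫⁻ y, f y ∂(π : Measure Y))
      {π | ∀ᵐ y ∂(π : Measure Y), y ∈ K} := by
  obtain ⟨B, hB⟩ := (hK.image hf).bddAbove
  let g : Y →ᵇ ℝ≥0 := .mkOfBound ⟨fun y => min (f y) B, hf.min continuous_const⟩ B
    fun x y => by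
      rw [NNReal.dist_eq, abs_sub_le_iff]
      have h1 : ((min (f x) B : ℝ≥0) : ℝ) ≤ B := NNReal.coe_le_coe.2 (min_le_right _ _)
      have h2 : ((min (f y) B : ℝ≥0) : ℝ) ≤ B := NNReal.coe_le_coe.2 (min_le_right _ _)
      constructor <;> dsimp only [ContinuousMap.coe_mk] <;>
        linarith [(min (f x) B).coe_nonneg, (min (f y) B).coe_nonneg]
  refine (continuous_lintegral_boundedContinuousFunction g).continuousOn.congr fun π hπ => ?_
  refine lintegral_congr_ae ?_
  filter_upwards [hπ] with y hy
  have : min (f y) B = f y := min_eq_left (hB (mem_image_of_mem f hy))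
  simp [g, this]

/-- Upper bounds `π ≤ κ` by a fixed finite measure are weakly closed. -/
lemma isClosed_setOf_le (κ : Measure Y) [IsFiniteMeasure κ] :
    IsClosed {π : ProbabilityMeasure Y | (π : Measure Y) ≤ κ} := by
  have hset : {π : ProbabilityMeasure Y | (π : Measure Y) ≤ κ} =
      ⋂ f : Y →ᵇ ℝ≥0, {π : ProbabilityMeasure Y | ∫⁻ y, f y ∂(π : Measure Y) ≤ ∫⁻ y, f y ∂κ} := by
    ext π
    simp only [mem_ofPred_eq, mem_iInter]
    refine ⟨fun h f => lintegral_mono' h le_rfl, fun h => ?_⟩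
    have hclosed : ∀ F : Set Y, IsClosed F → (π : Measure Y) F ≤ κ F := fun F hF =>
      le_of_tendsto_of_tendsto' (HasOuterApproxClosed.tendsto_lintegral_apprSeq hF _)
        (HasOuterApproxClosed.tendsto_lintegral_apprSeq hF κ) fun n => h _
    refine Measure.le_iff.2 fun s hs => ?_
    refine le_of_forall_lt fun r hr => ?_
    obtain ⟨F, hFs, hF, hr⟩ := hs.exists_lt_isClosed_of_ne_top (measure_ne_top _ s) hr
    exact hr.trans_le ((hclosed F hF).trans (measure_mono hFs))
  rw [hset]
  exact isClosed_iInter fun f => isClosed_le (continuous_lintegral_boundedContinuousFunction f)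
    continuous_const

end MeasureTheory.ProbabilityMeasure

/-! ### Concavity of the power `r ↦ r ^ p` -/

section Concavity

lemma Real.two_rpow_mul_add_rpow_le {p a b : ℝ} (hp₀ : 0 < p) (hp₁ : p < 1) (ha : 0 ≤ a)
    (hb : 0 ≤ b) : 2 ^ (p - 1) * (a ^ p + b ^ p) ≤ (a + b) ^ p := by
  have h := (Real.concaveOn_rpow hp₀.le hp₁.le).2 (mem_Ici.2 ha) (mem_Ici.2 hb)
    (show (0 : ℝ) ≤ 1 / 2 by norm_num) (show (0 : ℝ) ≤ 1 / 2 by norm_num) (by norm_num)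
  simp only [smul_eq_mul] at h
  have h2 : (1 / 2 * a + 1 / 2 * b) ^ p = (1 / 2 : ℝ) ^ p * (a + b) ^ p := by
    rw [← Real.mul_rpow (by norm_num) (by positivity)]; ring_nf
  rw [h2, one_div, Real.inv_rpow (by norm_num)] at h
  have h3 : (0 : ℝ) < 2 ^ p := by positivity
  rw [Real.rpow_sub_one (by norm_num)]
  have h4 := mul_le_mul_of_nonneg_left h h3.le
  rw [← mul_assoc, mul_inv_cancel₀ h3.ne', one_mul] at h4
  linarith

lemma Real.eq_of_rpow_le_two_rpow_mul {p a b c : ℝ} (hp₀ : 0 < p) (hp₁ : p < 1) (ha : 0 ≤ a)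
    (hb : 0 ≤ b) (hc : a + b ≤ c) (h : c ^ p ≤ 2 ^ (p - 1) * (a ^ p + b ^ p)) :
    a = b ∧ c = 2 * a := by
  have h1 : (a + b) ^ p ≤ c ^ p := Real.rpow_le_rpow (by positivity) hc hp₀.le
  have h2 := Real.two_rpow_mul_add_rpow_le hp₀ hp₁ ha hb
  have hab : a = b := by
    by_contra hne
    have h3 := (Real.strictConcaveOn_rpow hp₀ hp₁).2 (mem_Ici.2 ha) (mem_Ici.2 hb) hne
      (show (0 : ℝ) < 1 / 2 by norm_num) (show (0 : ℝ) < 1 / 2 by norm_num) (by norm_num)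
    simp only [smul_eq_mul] at h3
    have h4 : (1 / 2 * a + 1 / 2 * b) ^ p = (1 / 2 : ℝ) ^ p * (a + b) ^ p := by
      rw [← Real.mul_rpow (by norm_num) (by positivity)]; ring_nf
    rw [h4, one_div, Real.inv_rpow (by norm_num)] at h3
    have h5 : (0 : ℝ) < 2 ^ p := by positivity
    rw [Real.rpow_sub_one (by norm_num)] at h
    have h6 := mul_lt_mul_of_pos_left h3 h5
    rw [← mul_assoc, mul_inv_cancel₀ h5.ne', one_mul] at h6
    linarith
  refine ⟨hab, ?_⟩
  have h3 : (a + b) ^ p = c ^ p := le_antisymm h1 (h.trans h2)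
  have h4 := (Real.rpow_left_inj (by positivity) (by linarith) hp₀.ne').1 h3
  linarith

lemma ENNReal.two_rpow_mul_add_rpow_le {p : ℝ} (hp₀ : 0 < p) (hp₁ : p < 1) (a b : ℝ≥0∞) :
    2 ^ (p - 1) * (a ^ p + b ^ p) ≤ (a + b) ^ p := by
  induction a with
  | top => simp [hp₀]
  | coe a =>
    induction b with
    | top => simp [hp₀]
    | coe b =>
      have h := Real.two_rpow_mul_add_rpow_le hp₀ hp₁ a.coe_nonneg b.coe_nonneg
      have h2 : (2 : ℝ≥0∞) ^ (p - 1) = ((2 : ℝ≥0) ^ (p - 1) : ℝ≥0) := by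
        rw [ENNReal.coe_rpow_of_ne_zero two_ne_zero]; rfl
      rw [h2, ← ENNReal.coe_add, ← ENNReal.coe_rpow_of_nonneg _ hp₀.le,
        ← ENNReal.coe_rpow_of_nonneg _ hp₀.le, ← ENNReal.coe_rpow_of_nonneg _ hp₀.le]
      exact_mod_cast h

lemma ENNReal.eq_of_rpow_le_two_rpow_mul {p : ℝ} {a b c : ℝ≥0∞} (hp₀ : 0 < p) (hp₁ : p < 1)
    (htop : c ≠ ⊤) (hc : a + b ≤ c) (h : c ^ p ≤ 2 ^ (p - 1) * (a ^ p + b ^ p)) :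
    a = b ∧ c = 2 * a := by
  have hab := ne_top_of_le_ne_top htop hc
  rw [ENNReal.add_ne_top] at hab
  lift a to ℝ≥0 using hab.1
  lift b to ℝ≥0 using hab.2
  lift c to ℝ≥0 using htop
  have h2 : (2 : ℝ≥0∞) ^ (p - 1) = ((2 : ℝ≥0) ^ (p - 1) : ℝ≥0) := by
    rw [ENNReal.coe_rpow_of_ne_zero two_ne_zero]; rfl
  rw [h2, ← ENNReal.coe_rpow_of_nonneg _ hp₀.le, ← ENNReal.coe_rpow_of_nonneg _ hp₀.le,
    ← ENNReal.coe_rpow_of_nonneg _ hp₀.le] at h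
  norm_cast at h hc ⊢
  have := Real.eq_of_rpow_le_two_rpow_mul hp₀ hp₁ a.coe_nonneg b.coe_nonneg
    (c := c) (by exact_mod_cast hc) (by exact_mod_cast h)
  exact ⟨by exact_mod_cast this.1, by exact_mod_cast this.2⟩

lemma ENNReal.two_rpow_mul_two_mul {p : ℝ} (v : ℝ≥0∞) :
    (2 : ℝ≥0∞) ^ (p - 1) * (v + v) = 2 ^ p * v := by
  rw [← two_mul, ← mul_assoc]
  congr 1
  rw [ENNReal.rpow_sub _ _ two_ne_zero ENNReal.ofNat_ne_top, ENNReal.rpow_one,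
    ENNReal.div_mul_cancel two_ne_zero ENNReal.ofNat_ne_top]

lemma ENNReal.two_rpow_ne_top (r : ℝ) : (2 : ℝ≥0∞) ^ r ≠ ⊤ := by
  rw [ne_eq, ENNReal.rpow_eq_top_iff]
  simp

lemma ENNReal.le_of_two_rpow_mul_add_le {p : ℝ} {v a : ℝ≥0∞} (hv : v ≠ ⊤)
    (h : 2 ^ (p - 1) * (a + v) ≤ 2 ^ p * v) : a ≤ v := by
  rw [← ENNReal.two_rpow_mul_two_mul (p := p) v] at h
  have h2 : (2 : ℝ≥0∞) ^ (p - 1) ≠ 0 := by simp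
  rw [ENNReal.mul_le_mul_iff_right h2 (ENNReal.two_rpow_ne_top _)] at h
  exact (ENNReal.add_le_add_iff_right hv).1 h

end Concavity

/-! ### Gluing -/

/-- The gluing lemma: two couplings with a common marginal are the marginals of a joint law. -/
lemma MeasureTheory.Measure.exists_glue {X Y Z : Type*} [MeasurableSpace X] [MeasurableSpace Y]
    [MeasurableSpace Z] [StandardBorelSpace Z] [Nonempty Z] (π : Measure (X × Y))
    (σ : Measure (Y × Z)) [IsFiniteMeasure π] [IsFiniteMeasure σ] (h : π.snd = σ.fst) :
    ∃ Ξ : Measure (X × Y × Z), Ξ.map (fun w => (w.1, w.2.1)) = π ∧ Ξ.map Prod.snd = σ := by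
  set κ : ProbabilityTheory.Kernel (X × Y) Z := σ.condKernel.comap Prod.snd measurable_snd
  refine ⟨(π ⊗ₘ κ).map fun w => (w.1.1, w.1.2, w.2), ?_, ?_⟩
  · rw [Measure.map_map (by fun_prop) (by fun_prop)]
    exact Measure.fst_compProd π κ
  · rw [Measure.map_map (by fun_prop) (by fun_prop)]
    conv_rhs => rw [← σ.disintegrate σ.condKernel, ← h]
    ext s hs
    rw [Measure.map_apply (by fun_prop) hs, Measure.compProd_apply (by measurability),
      Measure.compProd_apply hs, Measure.snd,
      lintegral_map (ProbabilityTheory.Kernel.measurable_kernel_prodMk_left hs) measurable_snd]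
    rfl

namespace LorentzianPreLength

/-! ### Optimal couplings -/

section Coupling

variable {M : Type*} [MeasurableSpace M]

lemma IsCoupling.isProbabilityMeasure {π : Measure (M × M)} {μ ν : ProbabilityMeasure M}
    (h : IsCoupling π μ ν) : IsProbabilityMeasure π :=
  ⟨by rw [← Measure.fst_univ, h.1]; exact measure_univ⟩

lemma IsCoupling.ae_fst {π : Measure (M × M)} {μ ν : ProbabilityMeasure M}
    (h : IsCoupling π μ ν) {P : M → Prop} (hP : ∀ᵐ x ∂(μ : Measure M), P x) :
    ∀ᵐ z ∂π, P z.1 := by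
  rw [← h.1, Measure.fst] at hP
  exact ae_of_ae_map measurable_fst.aemeasurable hP

lemma IsCoupling.ae_snd {π : Measure (M × M)} {μ ν : ProbabilityMeasure M}
    (h : IsCoupling π μ ν) {P : M → Prop} (hP : ∀ᵐ x ∂(ν : Measure M), P x) :
    ∀ᵐ z ∂π, P z.2 := by
  rw [← h.2, Measure.snd] at hP
  exact ae_of_ae_map measurable_snd.aemeasurable hP

end Coupling

lemma IsTame.continuous_toNNReal {M : Type*} [MetricSpace M] {L : LorentzianPreLength M}
    (hL : L.IsTame) :
    Continuous fun z : M × M => (L.τ z.1 z.2).toNNReal :=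
  continuous_iff_continuousAt.2 fun z =>
    (ENNReal.tendsto_toNNReal (hL.τ_ne_top _ _)).comp (hL.continuous_τ.tendsto z)

/-- On a compact set the time separation is bounded. -/
lemma IsTame.exists_τ_le {M : Type*} [MetricSpace M] {L : LorentzianPreLength M}
    (hL : L.IsTame) {K : Set M} (hK : IsCompact K) :
    ∃ B : ℝ≥0, ∀ x ∈ K, ∀ y ∈ K, L.τ x y ≤ B := by
  obtain ⟨B, hB⟩ := ((hK.prod hK).image hL.continuous_toNNReal).bddAbove
  refine ⟨B, fun x hx y hy => ?_⟩
  rw [← ENNReal.coe_toNNReal (hL.τ_ne_top x y)]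
  exact_mod_cast hB (mem_image_of_mem _ (show (x, y) ∈ K ×ˢ K from ⟨hx, hy⟩))

section Transport

variable {M : Type*} [MetricSpace M] [MeasurableSpace M]
  {L : LorentzianPreLength M} {p : ℝ}

variable (L p) in
/-- The integral `∫ τ ^ p dπ`, the `p`-th power of `tauNorm`. -/
def profit (π : Measure (M × M)) : ℝ≥0∞ := ∫⁻ z, L.τ z.1 z.2 ^ p ∂π

lemma tauNorm_eq (π : Measure (M × M)) : L.tauNorm p π = L.profit p π ^ (1 / p) := rfl

lemma tauNorm_le_tauNorm_iff (hp : 0 < p) {π σ : Measure (M × M)} :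
    L.tauNorm p π ≤ L.tauNorm p σ ↔ L.profit p π ≤ L.profit p σ := by
  rw [tauNorm_eq, tauNorm_eq, ENNReal.rpow_le_rpow_iff (by positivity)]

lemma isOptimalCoupling_iff (hp : 0 < p) {π : Measure (M × M)} {μ ν : ProbabilityMeasure M} :
    L.IsOptimalCoupling p π μ ν ↔ L.IsCausalCoupling π μ ν ∧
      ∀ σ, L.IsCausalCoupling σ μ ν → L.profit p σ ≤ L.profit p π := by
  refine and_congr_right fun hπ => ⟨fun h σ hσ => ?_, fun h => ?_⟩
  · rw [← tauNorm_le_tauNorm_iff hp, ← EReal.coe_ennreal_le_coe_ennreal_iff, ← h]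
    exact le_iSup₂ (f := fun σ (_ : L.IsCausalCoupling σ μ ν) => (L.tauNorm p σ : EReal)) σ hσ
  · refine le_antisymm (iSup₂_le fun σ hσ => ?_)
      (le_iSup₂ (f := fun σ (_ : L.IsCausalCoupling σ μ ν) => (L.tauNorm p σ : EReal)) π hπ)
    rw [EReal.coe_ennreal_le_coe_ennreal_iff, tauNorm_le_tauNorm_iff hp]
    exact h σ hσ

lemma IsCausalCoupling.isProbabilityMeasure {π : Measure (M × M)} {μ ν : ProbabilityMeasure M}
    (h : L.IsCausalCoupling π μ ν) : IsProbabilityMeasure π := h.1.isProbabilityMeasure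

lemma IsTame.profit_ne_top (hL : L.IsTame) (hp : 0 ≤ p) {K : Set M} (hK : IsCompact K)
    {π : Measure (M × M)} [IsFiniteMeasure π] (hπ : ∀ᵐ z ∂π, z.1 ∈ K ∧ z.2 ∈ K) :
    L.profit p π ≠ ⊤ := by
  obtain ⟨B, hB⟩ := hL.exists_τ_le hK
  have h1 : L.profit p π ≤ ∫⁻ _, (B : ℝ≥0∞) ^ p ∂π := by
    refine lintegral_mono_ae ?_
    filter_upwards [hπ] with z hz
    exact ENNReal.rpow_le_rpow (hB _ hz.1 _ hz.2) hp
  refine ne_top_of_le_ne_top ?_ h1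
  rw [lintegral_const]
  exact ENNReal.mul_ne_top (ENNReal.rpow_ne_top_of_nonneg hp ENNReal.coe_ne_top)
    (measure_ne_top _ _)

/-- The diagonal coupling. -/
lemma isCausalCoupling_diag [BorelSpace M] [SecondCountableTopology M] (μ : ProbabilityMeasure M) :
    L.IsCausalCoupling ((μ : Measure M).map fun x => (x, x)) μ μ := by
  refine ⟨⟨?_, ?_⟩, ?_⟩
  · rw [Measure.fst, Measure.map_map measurable_fst (by fun_prop)]
    exact Measure.map_id
  · rw [Measure.snd, Measure.map_map measurable_snd (by fun_prop)]
    exact Measure.map_id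
  · have hd : MeasurableSet (Set.diagonal M) := isClosed_diagonal.measurableSet
    have h1 : ∀ᵐ z ∂((μ : Measure M).map fun x => (x, x)), z ∈ Set.diagonal M :=
      (ae_map_iff (by fun_prop) hd).2 (ae_of_all _ fun x => rfl)
    filter_upwards [h1] with z hz
    rw [mem_diagonal_iff.1 hz]
    exact L.le_refl _

variable [ProperSpace M] [BorelSpace M]

lemma IsTame.measurable_τ (hL : L.IsTame) : Measurable fun z : M × M => L.τ z.1 z.2 :=
  hL.continuous_τ.measurable

lemma IsTame.measurableSet_le (hL : L.IsTame) : MeasurableSet {z : M × M | L.le z.1 z.2} :=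
  hL.isClosed_le.measurableSet

/-- `profit` is weakly continuous along couplings on a fixed compact set. -/
lemma IsTame.continuousOn_profit (hL : L.IsTame) (hp : 0 ≤ p) {K : Set (M × M)}
    (hK : IsCompact K) : ContinuousOn (fun π : ProbabilityMeasure (M × M) => L.profit p π)
      {π | ∀ᵐ z ∂(π : Measure (M × M)), z ∈ K} := by
  have h1 : Continuous fun z : M × M => (L.τ z.1 z.2).toNNReal ^ p :=
    (NNReal.continuous_rpow_const hp).comp hL.continuous_toNNReal
  refine (ProbabilityMeasure.continuousOn_lintegral h1 hK).congr fun π _ => ?_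
  refine lintegral_congr fun z => ?_
  rw [ENNReal.coe_rpow_of_nonneg _ hp, ENNReal.coe_toNNReal (hL.τ_ne_top _ _)]

/-- The causal couplings of two compactly supported measures form a compact set. -/
lemma IsTame.isCompact_couplings (hL : L.IsTame) {K : Set M} (hK : IsCompact K)
    {μ ν : ProbabilityMeasure M} (hμ : ∀ᵐ x ∂(μ : Measure M), x ∈ K)
    (hν : ∀ᵐ x ∂(ν : Measure M), x ∈ K) :
    IsCompact {π : ProbabilityMeasure (M × M) | L.IsCausalCoupling π μ ν} := by
  have h1 := ProbabilityMeasure.isCompact_setOf_ae_mem (hK.prod hK)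
  refine h1.of_isClosed_subset ?_ fun π hπ => ?_
  · have heq : {π : ProbabilityMeasure (M × M) | L.IsCausalCoupling π μ ν} =
        ({π : ProbabilityMeasure (M × M) | π.map measurable_fst.aemeasurable = μ} ∩
          {π : ProbabilityMeasure (M × M) | π.map measurable_snd.aemeasurable = ν}) ∩
        {π : ProbabilityMeasure (M × M) |
          ∀ᵐ z ∂(π : Measure (M × M)), z ∈ {z : M × M | L.le z.1 z.2}} := by
      ext π
      simp only [mem_ofPred_eq, mem_inter_iff, IsCausalCoupling, IsCoupling]
      refine and_congr_left fun _ => and_congr ?_ ?_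
      · exact ⟨fun h => Subtype.ext h, fun h => congrArg Subtype.val h⟩
      · exact ⟨fun h => Subtype.ext h, fun h => congrArg Subtype.val h⟩
    rw [heq]
    exact ((isClosed_eq (ProbabilityMeasure.continuous_map continuous_fst) continuous_const).inter
      (isClosed_eq (ProbabilityMeasure.continuous_map continuous_snd) continuous_const)).inter
      (ProbabilityMeasure.isClosed_setOf_ae_mem hL.isClosed_le)
  · filter_upwards [hπ.1.ae_fst hμ, hπ.1.ae_snd hν] with z h2 h3 using ⟨h2, h3⟩

lemma IsTame.exists_isOptimalCoupling (hL : L.IsTame) (hp : 0 < p) {K : Set M} (hK : IsCompact K)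
    {μ ν : ProbabilityMeasure M} (hμ : ∀ᵐ x ∂(μ : Measure M), x ∈ K)
    (hν : ∀ᵐ x ∂(ν : Measure M), x ∈ K) {σ : Measure (M × M)} (hσ : L.IsCausalCoupling σ μ ν) :
    ∃ π, L.IsOptimalCoupling p π μ ν := by
  have hσ' := hσ.isProbabilityMeasure
  obtain ⟨π, hπ, hmax⟩ := (hL.isCompact_couplings hK hμ hν).exists_isMaxOn
    ⟨⟨σ, hσ'⟩, hσ⟩ ((hL.continuousOn_profit hp.le (hK.prod hK)).mono fun π hπ => by
      filter_upwards [hπ.1.ae_fst hμ, hπ.1.ae_snd hν] with z h2 h3 using ⟨h2, h3⟩)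
  refine ⟨π, (isOptimalCoupling_iff hp).2 ⟨hπ, fun σ hσ => ?_⟩⟩
  have := hσ.isProbabilityMeasure
  exact hmax (a := ⟨σ, this⟩) hσ

end Transport

/-! ### Midpoint plans -/

section Midpoints

variable {M : Type*} [MetricSpace M] {L : LorentzianPreLength M} {p : ℝ}

variable (L) in
/-- The triples `(x, z, y)` for which `z` is a `τ`-midpoint of `x ≤ y`. -/
def midSet : Set (M × M × M) :=
  {w | L.le w.1 w.2.1 ∧ L.le w.2.1 w.2.2 ∧ L.τ w.1 w.2.1 = L.τ w.2.1 w.2.2 ∧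
    L.τ w.1 w.2.2 = 2 * L.τ w.1 w.2.1}

lemma IsTame.isClosed_midSet (hL : L.IsTame) : IsClosed L.midSet := by
  have h1 : Continuous fun w : M × M × M => L.τ w.1 w.2.1 :=
    hL.continuous_τ.comp (f := fun w : M × M × M => (w.1, w.2.1)) (by fun_prop)
  have h2 : Continuous fun w : M × M × M => L.τ w.2.1 w.2.2 :=
    hL.continuous_τ.comp (f := fun w : M × M × M => w.2) (by fun_prop)
  have h3 : Continuous fun w : M × M × M => L.τ w.1 w.2.2 :=
    hL.continuous_τ.comp (f := fun w : M × M × M => (w.1, w.2.2)) (by fun_prop)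
  have h4 : Continuous fun w : M × M × M => 2 * L.τ w.1 w.2.1 :=
    ENNReal.continuous_const_mul ENNReal.ofNat_ne_top |>.comp h1
  exact (hL.isClosed_le.preimage (f := fun w : M × M × M => (w.1, w.2.1)) (by fun_prop)).inter
    ((hL.isClosed_le.preimage (f := fun w : M × M × M => w.2) (by fun_prop)).inter
      ((isClosed_eq h1 h2).inter (isClosed_eq h3 h4)))

variable [MeasurableSpace M]

variable (L p) in
/-- A law `Ξ` of triples `(x, z, y)` whose `(x, y)`-marginal is an `ℓ_p`-optimal coupling of `μ`
and `ν`, and for which `z` is almost surely a midpoint of `x` and `y`. -/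
def IsMidPlan (Ξ : Measure (M × M × M)) (μ ν : ProbabilityMeasure M) : Prop :=
  L.IsOptimalCoupling p (Ξ.map fun w => (w.1, w.2.2)) μ ν ∧ ∀ᵐ w ∂Ξ, w ∈ L.midSet

variable (L p) in
/-- `ρ` is an `ℓ_p`-midpoint of `μ` and `ν`, as witnessed by a midpoint plan. -/
def IsMidpoint (ρ μ ν : ProbabilityMeasure M) : Prop :=
  ∃ Ξ : Measure (M × M × M), L.IsMidPlan p Ξ μ ν ∧ Ξ.map (fun w => w.2.1) = ρ

variable [ProperSpace M] [BorelSpace M]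

lemma IsTame.profit_map (hL : L.IsTame) {Y : Type*} [MeasurableSpace Y] {Ξ : Measure Y}
    {g : Y → M × M} (hg : Measurable g) :
    L.profit p (Ξ.map g) = ∫⁻ w, L.τ (g w).1 (g w).2 ^ p ∂Ξ := by
  rw [profit, lintegral_map (hL.measurable_τ.pow_const p) hg]

/-- Gluing two causal couplings gives a causal law of triples. -/
lemma IsTame.exists_causal_glue (hL : L.IsTame) {μ ρ ν : ProbabilityMeasure M}
    {π σ : Measure (M × M)} (hπ : L.IsCausalCoupling π μ ρ) (hσ : L.IsCausalCoupling σ ρ ν) :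
    ∃ Ξ : Measure (M × M × M), Ξ.map (fun w => (w.1, w.2.1)) = π ∧ Ξ.map Prod.snd = σ ∧
      Ξ.map (fun w => w.2.1) = ρ ∧ L.IsCausalCoupling (Ξ.map fun w => (w.1, w.2.2)) μ ν ∧
      (∀ᵐ w ∂Ξ, L.le w.1 w.2.1) ∧ ∀ᵐ w ∂Ξ, L.le w.2.1 w.2.2 := by
  have := hπ.isProbabilityMeasure
  have := hσ.isProbabilityMeasure
  have : Nonempty M := μ.nonempty
  obtain ⟨Ξ, h1, h2⟩ := Measure.exists_glue π σ (by rw [hπ.1.2, hσ.1.1])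
  have h3 : ∀ᵐ w ∂Ξ, L.le w.1 w.2.1 :=
    ae_of_ae_map (f := fun w : M × M × M => (w.1, w.2.1)) (by fun_prop) (h1 ▸ hπ.2)
  have h4 : ∀ᵐ w ∂Ξ, L.le w.2.1 w.2.2 :=
    ae_of_ae_map (f := fun w : M × M × M => w.2) (by fun_prop) (h2 ▸ hσ.2)
  refine ⟨Ξ, h1, h2, ?_, ⟨⟨?_, ?_⟩, ?_⟩, h3, h4⟩
  · rw [← hσ.1.1, ← h2, Measure.fst, Measure.map_map (by fun_prop) (by fun_prop)]; rfl
  · rw [← hπ.1.1, ← h1, Measure.fst, Measure.fst, Measure.map_map (by fun_prop) (by fun_prop),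
      Measure.map_map (by fun_prop) (by fun_prop)]; rfl
  · rw [← hσ.1.2, ← h2, Measure.snd, Measure.snd, Measure.map_map (by fun_prop) (by fun_prop),
      Measure.map_map (by fun_prop) (by fun_prop)]; rfl
  · refine (ae_map_iff (by fun_prop) hL.measurableSet_le).2 ?_
    filter_upwards [h3, h4] with w h h' using L.le_trans _ _ _ h h'

/-- If `ρ` splits the optimal cost of `μ` and `ν` evenly, then gluing the two halves gives a
midpoint plan: by strict concavity of `r ↦ r ^ p`, the reverse triangle inequality is saturated with equal
halves almost everywhere. -/
lemma IsTame.exists_isMidPlan (hL : L.IsTame) (hp₀ : 0 < p) (hp₁ : p < 1)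
    {μ ρ ν : ProbabilityMeasure M} {π σ : Measure (M × M)} (hπ : L.IsCausalCoupling π μ ρ)
    (hσ : L.IsCausalCoupling σ ρ ν) (heq : L.profit p π = L.profit p σ)
    (hfin : L.profit p π ≠ ⊤)
    (hopt : ∀ χ, L.IsCausalCoupling χ μ ν → L.profit p χ ≤ 2 ^ p * L.profit p π) :
    ∃ Ξ : Measure (M × M × M), L.IsMidPlan p Ξ μ ν ∧ Ξ.map (fun w => (w.1, w.2.1)) = π ∧
      Ξ.map Prod.snd = σ ∧ Ξ.map (fun w => w.2.1) = ρ := by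
  obtain ⟨Ξ, h1, h2, h3, h4, h5, h6⟩ := hL.exists_causal_glue hπ hσ
  have hm1 : Measurable fun w : M × M × M => L.τ w.1 w.2.1 ^ p :=
    (hL.measurable_τ.comp (g := fun z : M × M => L.τ z.1 z.2)
      (f := fun w : M × M × M => (w.1, w.2.1)) (by fun_prop)).pow_const p
  have hm2 : Measurable fun w : M × M × M => L.τ w.2.1 w.2.2 ^ p :=
    (hL.measurable_τ.comp (g := fun z : M × M => L.τ z.1 z.2)
      (f := fun w : M × M × M => w.2) (by fun_prop)).pow_const p
  have hm3 : Measurable fun w : M × M × M => L.τ w.1 w.2.2 ^ p :=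
    (hL.measurable_τ.comp (g := fun z : M × M => L.τ z.1 z.2)
      (f := fun w : M × M × M => (w.1, w.2.2)) (by fun_prop)).pow_const p
  have hv1 : ∫⁻ w, L.τ w.1 w.2.1 ^ p ∂Ξ = L.profit p π := by
    rw [← h1, hL.profit_map (by fun_prop)]
  have hv2 : ∫⁻ w, L.τ w.2.1 w.2.2 ^ p ∂Ξ = L.profit p π := by
    rw [heq, ← h2, hL.profit_map (by fun_prop)]
  have hint : ∫⁻ w, 2 ^ (p - 1) * (L.τ w.1 w.2.1 ^ p + L.τ w.2.1 w.2.2 ^ p) ∂Ξ =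
      2 ^ p * L.profit p π := by
    rw [lintegral_const_mul' _ _ (ENNReal.two_rpow_ne_top _), lintegral_add_left hm1, hv1, hv2,
      ENNReal.two_rpow_mul_two_mul]
  have h2p : (2 : ℝ≥0∞) ^ p * L.profit p π ≠ ⊤ :=
    ENNReal.mul_ne_top (ENNReal.two_rpow_ne_top _) hfin
  have hle : (fun w : M × M × M => 2 ^ (p - 1) * (L.τ w.1 w.2.1 ^ p + L.τ w.2.1 w.2.2 ^ p)) ≤ᵐ[Ξ]
      fun w => L.τ w.1 w.2.2 ^ p := by
    filter_upwards [h5, h6] with w h h'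
    exact (ENNReal.two_rpow_mul_add_rpow_le hp₀ hp₁ _ _).trans
      (ENNReal.rpow_le_rpow (L.reverse_triangle _ _ _ h h') hp₀.le)
  have hprofit : L.profit p (Ξ.map fun w => (w.1, w.2.2)) = ∫⁻ w, L.τ w.1 w.2.2 ^ p ∂Ξ :=
    hL.profit_map (by fun_prop)
  -- the concavity inequality is saturated in the mean, hence almost everywhere
  have hae := ae_eq_of_ae_le_of_lintegral_le hle (by rwa [hint]) hm3.aemeasurable
    (by rw [hint, ← hprofit]; exact hopt _ h4)
  refine ⟨Ξ, ⟨(isOptimalCoupling_iff hp₀).2 ⟨h4, fun χ hχ => ?_⟩, ?_⟩, h1, h2, h3⟩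
  · rw [hprofit, ← lintegral_congr_ae hae, hint]
    exact hopt χ hχ
  · filter_upwards [hae, h5, h6] with w hw h h'
    obtain ⟨ha, hb⟩ := ENNReal.eq_of_rpow_le_two_rpow_mul hp₀ hp₁ (hL.τ_ne_top _ _)
      (L.reverse_triangle _ _ _ h h') hw.ge
    exact ⟨h, h', ha, hb⟩

/-- The two halves of a midpoint plan are causal couplings carrying equal parts of the cost. -/
lemma IsMidPlan.halves (hL : L.IsTame) (hp₀ : 0 < p) {μ ρ ν : ProbabilityMeasure M}
    {Ξ : Measure (M × M × M)} (h : L.IsMidPlan p Ξ μ ν) (hρ : Ξ.map (fun w => w.2.1) = ρ) :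
    L.IsCausalCoupling (Ξ.map fun w => (w.1, w.2.1)) μ ρ ∧
    L.IsCausalCoupling (Ξ.map Prod.snd) ρ ν ∧
    L.profit p (Ξ.map Prod.snd) = L.profit p (Ξ.map fun w => (w.1, w.2.1)) ∧
    L.profit p (Ξ.map fun w => (w.1, w.2.2)) =
      2 ^ p * L.profit p (Ξ.map fun w => (w.1, w.2.1)) := by
  obtain ⟨⟨⟨⟨h1, h2⟩, -⟩, -⟩, hmid⟩ := h
  refine ⟨⟨⟨?_, ?_⟩, ?_⟩, ⟨⟨?_, ?_⟩, ?_⟩, ?_, ?_⟩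
  · rw [← h1, Measure.fst, Measure.fst, Measure.map_map (by fun_prop) (by fun_prop),
      Measure.map_map (by fun_prop) (by fun_prop)]; rfl
  · rw [← hρ, Measure.snd, Measure.map_map (by fun_prop) (by fun_prop)]; rfl
  · refine (ae_map_iff (by fun_prop) hL.measurableSet_le).2 ?_
    filter_upwards [hmid] with w hw using hw.1
  · rw [← hρ, Measure.fst, Measure.map_map (by fun_prop) (by fun_prop)]; rfl
  · rw [← h2, Measure.snd, Measure.snd, Measure.map_map (by fun_prop) (by fun_prop),
      Measure.map_map (by fun_prop) (by fun_prop)]; rfl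
  · refine (ae_map_iff (by fun_prop) hL.measurableSet_le).2 ?_
    filter_upwards [hmid] with w hw using hw.2.1
  · rw [hL.profit_map (by fun_prop), hL.profit_map (by fun_prop)]
    refine lintegral_congr_ae ?_
    filter_upwards [hmid] with w hw
    rw [hw.2.2.1]
  · rw [hL.profit_map (by fun_prop), hL.profit_map (by fun_prop),
      ← lintegral_const_mul' _ _ (ENNReal.two_rpow_ne_top _)]
    refine lintegral_congr_ae ?_
    filter_upwards [hmid] with w hw
    rw [hw.2.2.2, ENNReal.mul_rpow_of_nonneg _ _ hp₀.le]

/-- A causal coupling of `μ` and `ν` obtained by gluing beats the mean of its two parts. -/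
lemma IsTame.exists_two_rpow_mul_le (hL : L.IsTame) (hp₀ : 0 < p) (hp₁ : p < 1)
    {μ ρ ν : ProbabilityMeasure M} {π σ : Measure (M × M)} (hπ : L.IsCausalCoupling π μ ρ)
    (hσ : L.IsCausalCoupling σ ρ ν) : ∃ χ, L.IsCausalCoupling χ μ ν ∧
      2 ^ (p - 1) * (L.profit p π + L.profit p σ) ≤ L.profit p χ := by
  obtain ⟨Ξ, h1, h2, h3, h4, h5, h6⟩ := hL.exists_causal_glue hπ hσ
  refine ⟨_, h4, ?_⟩
  have hm1 : Measurable fun w : M × M × M => L.τ w.1 w.2.1 ^ p :=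
    (hL.measurable_τ.comp (g := fun z : M × M => L.τ z.1 z.2)
      (f := fun w : M × M × M => (w.1, w.2.1)) (by fun_prop)).pow_const p
  rw [← h1, ← h2, hL.profit_map (by fun_prop), hL.profit_map (by fun_prop),
    hL.profit_map (by fun_prop), ← lintegral_add_left hm1,
    ← lintegral_const_mul' _ _ (ENNReal.two_rpow_ne_top _)]
  refine lintegral_mono_ae ?_
  filter_upwards [h5, h6] with w h h'
  exact (ENNReal.two_rpow_mul_add_rpow_le hp₀ hp₁ _ _).trans
    (ENNReal.rpow_le_rpow (L.reverse_triangle _ _ _ h h') hp₀.le)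

/-- The first half of a midpoint plan is optimal. -/
lemma IsMidPlan.left_optimal (hL : L.IsTame) (hp₀ : 0 < p) (hp₁ : p < 1)
    {μ ρ ν : ProbabilityMeasure M} {Ξ : Measure (M × M × M)} (h : L.IsMidPlan p Ξ μ ν)
    (hρ : Ξ.map (fun w => w.2.1) = ρ)
    (hfin : L.profit p (Ξ.map fun w => (w.1, w.2.1)) ≠ ⊤) :
    L.IsOptimalCoupling p (Ξ.map fun w => (w.1, w.2.1)) μ ρ := by
  obtain ⟨h1, h2, h3, h4⟩ := h.halves hL hp₀ hρ
  refine (isOptimalCoupling_iff hp₀).2 ⟨h1, fun σ hσ => ?_⟩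
  obtain ⟨χ, hχ, hle⟩ := hL.exists_two_rpow_mul_le hp₀ hp₁ hσ h2
  refine ENNReal.le_of_two_rpow_mul_add_le (p := p) hfin ?_
  rw [← h4]
  conv_lhs => rw [← h3]
  exact hle.trans (((isOptimalCoupling_iff hp₀).1 h.1).2 χ hχ)

/-- The second half of a midpoint plan is optimal. -/
lemma IsMidPlan.right_optimal (hL : L.IsTame) (hp₀ : 0 < p) (hp₁ : p < 1)
    {μ ρ ν : ProbabilityMeasure M} {Ξ : Measure (M × M × M)} (h : L.IsMidPlan p Ξ μ ν)
    (hρ : Ξ.map (fun w => w.2.1) = ρ)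
    (hfin : L.profit p (Ξ.map fun w => (w.1, w.2.1)) ≠ ⊤) :
    L.IsOptimalCoupling p (Ξ.map Prod.snd) ρ ν := by
  obtain ⟨h1, h2, h3, h4⟩ := h.halves hL hp₀ hρ
  refine (isOptimalCoupling_iff hp₀).2 ⟨h2, fun σ hσ => ?_⟩
  obtain ⟨χ, hχ, hle⟩ := hL.exists_two_rpow_mul_le hp₀ hp₁ h1 hσ
  rw [h3]
  refine ENNReal.le_of_two_rpow_mul_add_le (p := p) hfin ?_
  rw [← h4, add_comm]
  exact hle.trans (((isOptimalCoupling_iff hp₀).1 h.1).2 χ hχ)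

/-- Every optimal coupling of `μ` with a midpoint `ρ` is the first half of a midpoint plan. -/
lemma IsMidPlan.exists_of_left (hL : L.IsTame) (hp₀ : 0 < p) (hp₁ : p < 1)
    {μ ρ ν : ProbabilityMeasure M} {Ξ : Measure (M × M × M)} (h : L.IsMidPlan p Ξ μ ν)
    (hρ : Ξ.map (fun w => w.2.1) = ρ)
    (hfin : L.profit p (Ξ.map fun w => (w.1, w.2.1)) ≠ ⊤) {σ : Measure (M × M)}
    (hσ : L.IsOptimalCoupling p σ μ ρ) :
    ∃ Ξ' : Measure (M × M × M), L.IsMidPlan p Ξ' μ ν ∧ Ξ'.map (fun w => (w.1, w.2.1)) = σ ∧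
      Ξ'.map Prod.snd = Ξ.map Prod.snd ∧ Ξ'.map (fun w => w.2.1) = ρ := by
  obtain ⟨h1, h2, h3, h4⟩ := h.halves hL hp₀ hρ
  have h5 := (isOptimalCoupling_iff hp₀).1 (h.left_optimal hL hp₀ hp₁ hρ hfin)
  have h6 := (isOptimalCoupling_iff hp₀).1 hσ
  have h7 : L.profit p σ = L.profit p (Ξ.map fun w => (w.1, w.2.1)) :=
    le_antisymm (h5.2 _ h6.1) (h6.2 _ h5.1)
  refine hL.exists_isMidPlan hp₀ hp₁ h6.1 h2 (h7.trans h3.symm) (by rwa [h7]) fun χ hχ => ?_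
  rw [h7, ← h4]
  exact ((isOptimalCoupling_iff hp₀).1 h.1).2 χ hχ

/-- Every optimal coupling of a midpoint `ρ` with `ν` is the second half of a midpoint plan. -/
lemma IsMidPlan.exists_of_right (hL : L.IsTame) (hp₀ : 0 < p) (hp₁ : p < 1)
    {μ ρ ν : ProbabilityMeasure M} {Ξ : Measure (M × M × M)} (h : L.IsMidPlan p Ξ μ ν)
    (hρ : Ξ.map (fun w => w.2.1) = ρ)
    (hfin : L.profit p (Ξ.map fun w => (w.1, w.2.1)) ≠ ⊤) {σ : Measure (M × M)}
    (hσ : L.IsOptimalCoupling p σ ρ ν) :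
    ∃ Ξ' : Measure (M × M × M), L.IsMidPlan p Ξ' μ ν ∧
      Ξ'.map (fun w => (w.1, w.2.1)) = Ξ.map (fun w => (w.1, w.2.1)) ∧
      Ξ'.map Prod.snd = σ ∧ Ξ'.map (fun w => w.2.1) = ρ := by
  obtain ⟨h1, h2, h3, h4⟩ := h.halves hL hp₀ hρ
  have h5 := (isOptimalCoupling_iff hp₀).1 (h.right_optimal hL hp₀ hp₁ hρ hfin)
  have h6 := (isOptimalCoupling_iff hp₀).1 hσ
  have h7 : L.profit p σ = L.profit p (Ξ.map fun w => (w.1, w.2.1)) :=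
    (le_antisymm (h5.2 _ h6.1) (h6.2 _ h5.1)).trans h3
  refine hL.exists_isMidPlan hp₀ hp₁ h1 h6.1 h7.symm hfin fun χ hχ => ?_
  rw [← h4]
  exact ((isOptimalCoupling_iff hp₀).1 h.1).2 χ hχ

end Midpoints

end LorentzianPreLength

lemma EReal.coe_ennreal_sum {ι : Type*} (s : Finset ι) (f : ι → ℝ≥0∞) :
    ((∑ i ∈ s, f i : ℝ≥0∞) : EReal) = ∑ i ∈ s, (f i : EReal) := by
  classical
  induction s using Finset.induction_on with
  | empty => simp
  | insert a s ha ih => rw [Finset.sum_insert ha, Finset.sum_insert ha, EReal.coe_ennreal_add, ih]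

namespace LorentzianPreLength

/-! ### Strong dualizability -/

section CyclicalMonotonicity

variable {M : Type*} [MetricSpace M] {L : LorentzianPreLength M} {p : ℝ}

/-- Cyclical monotonicity only has to be tested on cycles with finite cost. -/
lemma cyclicallyMonotone_iff {Γ : Set (M × M)} (hΓ : ∀ z ∈ Γ, L.le z.1 z.2) :
    L.CyclicallyMonotone p Γ ↔ ∀ (n : ℕ) (z : Fin (n + 1) → M × M), (∀ i, z i ∈ Γ) →
      (∀ i, L.le (z (i + 1)).1 (z i).2) →
      ∑ i, L.τ (z (i + 1)).1 (z i).2 ^ p ≤ ∑ i, L.τ (z i).1 (z i).2 ^ p := by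
  have hval : ∀ x y, L.le x y → L.lPow p x y = ((L.τ x y ^ p : ℝ≥0∞) : EReal) :=
    fun x y h => if_pos h
  refine ⟨fun h n z hz hle => ?_, fun h n z hz => ?_⟩
  · have := h n z hz
    rw [Finset.sum_congr rfl fun i _ => hval _ _ (hle i),
      Finset.sum_congr rfl fun i _ => hval _ _ (hΓ _ (hz i)), ← EReal.coe_ennreal_sum,
      ← EReal.coe_ennreal_sum, EReal.coe_ennreal_le_coe_ennreal_iff] at this
    exact this
  · by_cases hle : ∀ i, L.le (z (i + 1)).1 (z i).2
    · rw [Finset.sum_congr rfl fun i _ => hval _ _ (hle i),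
        Finset.sum_congr rfl fun i _ => hval _ _ (hΓ _ (hz i)), ← EReal.coe_ennreal_sum,
        ← EReal.coe_ennreal_sum, EReal.coe_ennreal_le_coe_ennreal_iff]
      exact h n z hz hle
    · obtain ⟨j, hj⟩ := not_forall.1 hle
      have hbot : L.lPow p (z (j + 1)).1 (z j).2 = ⊥ := if_neg hj
      rw [← Finset.add_sum_erase _ _ (Finset.mem_univ j), hbot, EReal.bot_add]
      exact bot_le

variable (L) in
/-- The chronological part of the closure of `Γ`. It is `σ`-compact, and still cyclically monotone
with respect to chronological cycles. -/
def chronClosure (Γ : Set (M × M)) : Set (M × M) := closure Γ ∩ {z | 0 < L.τ z.1 z.2}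

lemma subset_chronClosure {Γ : Set (M × M)} (hΓ : ∀ z ∈ Γ, L.ll z.1 z.2) :
    Γ ⊆ L.chronClosure Γ :=
  fun z hz => ⟨subset_closure hz, (L.τ_pos_iff _ _).2 (hΓ z hz)⟩

/-- Violations of cyclical monotonicity along chronological cycles are open conditions, hence would be
visible on `Γ`. -/
lemma CyclicallyMonotone.chronClosure (hL : L.IsTame) {Γ : Set (M × M)}
    (hΓ : ∀ z ∈ Γ, L.ll z.1 z.2) (h : L.CyclicallyMonotone p Γ) {n : ℕ}
    {z : Fin (n + 1) → M × M} (hz : ∀ i, z i ∈ L.chronClosure Γ)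
    (hll : ∀ i, 0 < L.τ (z (i + 1)).1 (z i).2) :
    ∑ i, L.τ (z (i + 1)).1 (z i).2 ^ p ≤ ∑ i, L.τ (z i).1 (z i).2 ^ p := by
  by_contra! hcon
  have hc : ∀ f : (Fin (n + 1) → M × M) → M × M, Continuous f →
      Continuous fun z => L.τ (f z).1 (f z).2 := fun f hf => hL.continuous_τ.comp hf
  have hopen : IsOpen {z : Fin (n + 1) → M × M | (∀ i, 0 < L.τ (z (i + 1)).1 (z i).2) ∧
      ∑ i, L.τ (z i).1 (z i).2 ^ p < ∑ i, L.τ (z (i + 1)).1 (z i).2 ^ p} := by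
    refine IsOpen.inter ?_ ?_
    · have : {z : Fin (n + 1) → M × M | ∀ i, 0 < L.τ (z (i + 1)).1 (z i).2} =
          ⋂ i, {z | 0 < L.τ (z (i + 1)).1 (z i).2} := by ext; simp
      change IsOpen {z : Fin (n + 1) → M × M | ∀ i, 0 < L.τ (z (i + 1)).1 (z i).2}
      rw [this]
      exact isOpen_iInter_of_finite fun i => isOpen_lt continuous_const
        (hc (fun z => ((z (i + 1)).1, (z i).2)) (by fun_prop))
    · exact isOpen_lt
        (continuous_finsetSum _ fun i _ => ENNReal.continuous_rpow_const.comp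
          (hc (fun z => z i) (by fun_prop)))
        (continuous_finsetSum _ fun i _ => ENNReal.continuous_rpow_const.comp
          (hc (fun z => ((z (i + 1)).1, (z i).2)) (by fun_prop)))
  have hmem : z ∈ closure (pi univ fun _ : Fin (n + 1) => Γ) := by
    rw [closure_pi_set]
    exact fun i _ => (hz i).1
  obtain ⟨z', ⟨hpos, hlt⟩, hz'⟩ := mem_closure_iff.1 hmem _ hopen ⟨hll, hcon⟩
  refine absurd ((cyclicallyMonotone_iff fun z hz => L.le_of_ll _ _ (hΓ z hz)).1 h n z'
    (fun i => hz' i (mem_univ i))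
    fun i => L.le_of_ll _ _ ((L.τ_pos_iff _ _).1 (hpos i))) (not_le.2 hlt)

variable (L) in
/-- The midpoint triples over the chronological closure of `Γ`. -/
def midTriples (Γ : Set (M × M)) : Set (M × M × M) :=
  L.midSet ∩ {w | (w.1, w.2.2) ∈ L.chronClosure Γ}

/-- This makes projections of `midTriples Γ` Borel sets. -/
lemma IsTame.isSigmaCompact_midTriples [ProperSpace M] (hL : L.IsTame) (Γ : Set (M × M)) :
    IsSigmaCompact (L.midTriples Γ) := by
  have h1 : L.midTriples Γ = ⋃ n : ℕ, L.midSet ∩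
      {w | (w.1, w.2.2) ∈ closure Γ ∧ ((n : ℝ≥0∞) + 1)⁻¹ ≤ L.τ w.1 w.2.2} := by
    ext w
    simp only [midTriples, LorentzianPreLength.chronClosure, mem_inter_iff, mem_ofPred_eq,
      mem_iUnion]
    constructor
    · rintro ⟨h1, h2, h3⟩
      obtain ⟨n, hn⟩ := ENNReal.exists_inv_nat_lt h3.ne'
      refine ⟨n, h1, h2, ?_⟩
      refine (ENNReal.inv_le_inv.2 ?_).trans hn.le
      exact le_self_add
    · rintro ⟨n, h1, h2, h3⟩
      refine ⟨h1, h2, lt_of_lt_of_le ?_ h3⟩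
      simp
  rw [h1]
  refine isSigmaCompact_iUnion _ fun n => ?_
  refine isSigmaCompact_univ.of_isClosed_subset ?_ (subset_univ _)
  have hc : Continuous fun w : M × M × M => (w.1, w.2.2) := by fun_prop
  exact hL.isClosed_midSet.inter ((isClosed_closure.preimage hc).inter
    (_root_.isClosed_le continuous_const (hL.continuous_τ.comp hc)))

lemma IsSigmaCompact.measurableSet {Y : Type*} [TopologicalSpace Y] [T2Space Y]
    [MeasurableSpace Y] [BorelSpace Y] {s : Set Y} (hs : IsSigmaCompact s) : MeasurableSet s := by
  obtain ⟨K, hK, rfl⟩ := hs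
  exact MeasurableSet.iUnion fun n => (hK n).measurableSet

lemma midTriples_pos {Γ : Set (M × M)} {w : M × M × M} (hw : w ∈ L.midTriples Γ) :
    0 < L.τ w.1 w.2.1 ∧ 0 < L.τ w.2.1 w.2.2 := by
  obtain ⟨⟨-, -, h1, h2⟩, -, h3⟩ := hw
  have h4 : 0 < L.τ w.1 w.2.1 := by
    refine pos_iff_ne_zero.2 fun h0 => ?_
    rw [h0, mul_zero] at h2
    exact h3.ne' h2
  exact ⟨h4, h1 ▸ h4⟩

/-- First halves of midpoint triples inherit cyclical monotonicity: a cycle of first halves is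
prolonged by the second halves to a cycle over `Γ`, and `r ↦ r ^ p` is concave. -/
lemma CyclicallyMonotone.left (hL : L.IsTame) (hp₀ : 0 < p) (hp₁ : p < 1) {Γ : Set (M × M)}
    (hΓ : ∀ z ∈ Γ, L.ll z.1 z.2) (h : L.CyclicallyMonotone p Γ) :
    L.CyclicallyMonotone p ((fun w : M × M × M => (w.1, w.2.1)) '' L.midTriples Γ) := by
  refine (cyclicallyMonotone_iff ?_).2 fun n z hz hle => ?_
  · rintro _ ⟨w, hw, rfl⟩
    exact hw.1.1
  choose w hw hwz using hz
  obtain rfl : z = fun i => ((w i).1, (w i).2.1) := funext fun i => (hwz i).symm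
  dsimp only at hle ⊢
  have hrev : ∀ i, L.τ (w (i + 1)).1 (w i).2.1 + L.τ (w i).1 (w i).2.1 ≤
      L.τ (w (i + 1)).1 (w i).2.2 := fun i => by
    rw [(hw i).1.2.2.1]
    exact L.reverse_triangle _ _ _ (hle i) (hw i).1.2.1
  have hcm := h.chronClosure hL hΓ (z := fun i => ((w i).1, (w i).2.2)) (fun i => (hw i).2)
    fun i => ((midTriples_pos (hw i)).1.trans_le le_add_self).trans_le (hrev i)
  refine ENNReal.le_of_two_rpow_mul_add_le (p := p) (ENNReal.sum_ne_top.2 fun i _ =>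
    ENNReal.rpow_ne_top_of_nonneg hp₀.le (hL.τ_ne_top _ _)) ?_
  calc _ = ∑ i, 2 ^ (p - 1) * (L.τ (w (i + 1)).1 (w i).2.1 ^ p + L.τ (w i).1 (w i).2.1 ^ p) := by
        rw [← Finset.sum_add_distrib, Finset.mul_sum]
    _ ≤ ∑ i, L.τ (w (i + 1)).1 (w i).2.2 ^ p := Finset.sum_le_sum fun i _ =>
        (ENNReal.two_rpow_mul_add_rpow_le hp₀ hp₁ _ _).trans
          (ENNReal.rpow_le_rpow (hrev i) hp₀.le)
    _ ≤ _ := hcm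
    _ = _ := by
        rw [Finset.mul_sum]
        refine Finset.sum_congr rfl fun i _ => ?_
        rw [(hw i).1.2.2.2, ENNReal.mul_rpow_of_nonneg _ _ hp₀.le]

/-- Second halves of midpoint triples inherit cyclical monotonicity. -/
lemma CyclicallyMonotone.right (hL : L.IsTame) (hp₀ : 0 < p) (hp₁ : p < 1) {Γ : Set (M × M)}
    (hΓ : ∀ z ∈ Γ, L.ll z.1 z.2) (h : L.CyclicallyMonotone p Γ) :
    L.CyclicallyMonotone p (Prod.snd '' L.midTriples Γ) := by
  refine (cyclicallyMonotone_iff ?_).2 fun n z hz hle => ?_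
  · rintro _ ⟨w, hw, rfl⟩
    exact hw.1.2.1
  choose w hw hwz using hz
  obtain rfl : z = fun i => (w i).2 := funext fun i => (hwz i).symm
  dsimp only at hle ⊢
  have hrev : ∀ i, L.τ (w (i + 1)).2.1 (w i).2.2 + L.τ (w (i + 1)).2.1 (w (i + 1)).2.2 ≤
      L.τ (w (i + 1)).1 (w i).2.2 := fun i => by
    rw [← (hw (i + 1)).1.2.2.1, add_comm]
    exact L.reverse_triangle _ _ _ (hw (i + 1)).1.1 (hle i)
  have hcm := h.chronClosure hL hΓ (z := fun i => ((w i).1, (w i).2.2)) (fun i => (hw i).2)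
    fun i => ((midTriples_pos (hw (i + 1))).2.trans_le le_add_self).trans_le (hrev i)
  refine ENNReal.le_of_two_rpow_mul_add_le (p := p) (ENNReal.sum_ne_top.2 fun i _ =>
    ENNReal.rpow_ne_top_of_nonneg hp₀.le (hL.τ_ne_top _ _)) ?_
  calc _ = ∑ i, 2 ^ (p - 1) * (L.τ (w (i + 1)).2.1 (w i).2.2 ^ p +
          L.τ (w (i + 1)).2.1 (w (i + 1)).2.2 ^ p) := by
        rw [← Finset.mul_sum, Finset.sum_add_distrib]
        congr 2
        exact (Equiv.sum_comp (Equiv.addRight (1 : Fin (n + 1)))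
          fun i => L.τ (w i).2.1 (w i).2.2 ^ p).symm
    _ ≤ ∑ i, L.τ (w (i + 1)).1 (w i).2.2 ^ p := Finset.sum_le_sum fun i _ =>
        (ENNReal.two_rpow_mul_add_rpow_le hp₀ hp₁ _ _).trans
          (ENNReal.rpow_le_rpow (hrev i) hp₀.le)
    _ ≤ _ := hcm
    _ = _ := by
        rw [Finset.mul_sum]
        refine Finset.sum_congr rfl fun i _ => ?_
        rw [(hw i).1.2.2.2, (hw i).1.2.2.1, ENNReal.mul_rpow_of_nonneg _ _ hp₀.le]

/-- Two midpoint triples over the same middle point `z` have the same `τ`-size: exchanging their end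
points gains by strict concavity of `r ↦ r ^ p`, unless the sizes agree. -/
lemma CyclicallyMonotone.τ_eq (hL : L.IsTame) (hp₀ : 0 < p) (hp₁ : p < 1) {Γ : Set (M × M)}
    (hΓ : ∀ z ∈ Γ, L.ll z.1 z.2) (h : L.CyclicallyMonotone p Γ) {x z y : M}
    (h1 : (x, z) ∈ (fun w : M × M × M => (w.1, w.2.1)) '' L.midTriples Γ)
    (h2 : (z, y) ∈ Prod.snd '' L.midTriples Γ) : L.τ x z = L.τ z y := by
  obtain ⟨⟨x, z, y'⟩, hw, hweq⟩ := h1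
  obtain ⟨⟨x', z', y⟩, hw', hweq'⟩ := h2
  cases hweq
  cases hweq'
  have hpos := midTriples_pos hw
  have hpos' := midTriples_pos hw'
  obtain ⟨⟨e1, e2, e3, e4⟩, e5⟩ := hw
  obtain ⟨⟨f1, f2, f3, f4⟩, f5⟩ := hw'
  have hr1 := L.reverse_triangle _ _ _ e1 f2
  have hr2 := L.reverse_triangle _ _ _ f1 e2
  rw [f3, ← e3, add_comm] at hr2
  have hcm : L.τ x' y' ^ p + L.τ x y ^ p ≤ L.τ x y' ^ p + L.τ x' y ^ p := by
    have := h.chronClosure hL hΓ (n := 1) (z := ![(x, y'), (x', y)])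
      (fun i => by fin_cases i <;> assumption) (fun i => by
        fin_cases i
        · exact (hpos.1.trans_le le_self_add).trans_le hr2
        · exact (hpos.1.trans_le le_self_add).trans_le hr1)
    rwa [Fin.sum_univ_two, Fin.sum_univ_two] at this
  rw [e4, f4, f3, ENNReal.mul_rpow_of_nonneg _ _ hp₀.le, ENNReal.mul_rpow_of_nonneg _ _ hp₀.le,
    ← mul_add, ← ENNReal.two_rpow_mul_two_mul, ← two_mul, mul_left_comm] at hcm
  have h3 : 2 * (L.τ x z + L.τ z y) ^ p ≤
      2 * (2 ^ (p - 1) * (L.τ x z ^ p + L.τ z y ^ p)) := by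
    refine LE.le.trans ?_ hcm
    rw [two_mul]
    exact add_le_add (ENNReal.rpow_le_rpow hr2 hp₀.le) (ENNReal.rpow_le_rpow hr1 hp₀.le)
  exact (ENNReal.eq_of_rpow_le_two_rpow_mul hp₀ hp₁
    (ENNReal.add_ne_top.2 ⟨hL.τ_ne_top _ _, hL.τ_ne_top _ _⟩) le_rfl
    ((ENNReal.mul_le_mul_iff_right two_ne_zero ENNReal.ofNat_ne_top).1 h3)).1

end CyclicalMonotonicity

section Dualizability

variable {M : Type*} [MetricSpace M] [MeasurableSpace M] {L : LorentzianPreLength M} {p : ℝ}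

variable (L p) in
/-- A cyclically monotone chronological set `Γ` which characterizes the optimal couplings of `μ`
and `ν`, as the ones that are concentrated on it. For compactly supported measures that admit an
optimal coupling, its existence amounts to strong dualizability. -/
structure IsDualSet (Γ : Set (M × M)) (μ ν : ProbabilityMeasure M) : Prop where
  measurableSet : MeasurableSet Γ
  cyclicallyMonotone : L.CyclicallyMonotone p Γ
  ll : ∀ z ∈ Γ, L.ll z.1 z.2
  iff_ae_mem : ∀ σ, L.IsCausalCoupling σ μ ν → (L.IsOptimalCoupling p σ μ ν ↔ ∀ᵐ z ∂σ, z ∈ Γ)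

lemma StronglyTimelikeDualizable.exists_isDualSet {μ ν : ProbabilityMeasure M}
    (h : L.StronglyTimelikeDualizable p μ ν) : ∃ Γ, L.IsDualSet p Γ μ ν := by
  obtain ⟨-, Γ, hΓ, hcm, hll, hiff⟩ := h
  refine ⟨Γ, hΓ, hcm, fun z hz => (hll z hz).1, fun σ hσ => ?_⟩
  have := hσ.isProbabilityMeasure
  rw [hiff σ hσ]
  exact (mem_ae_iff_prob_eq_one hΓ).symm

lemma StronglyTimelikeDualizable.exists_isOptimalCoupling {μ ν : ProbabilityMeasure M}
    (h : L.StronglyTimelikeDualizable p μ ν) : ∃ π, L.IsOptimalCoupling p π μ ν := by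
  obtain ⟨⟨π, -, hπ, -⟩, -⟩ := h
  exact ⟨π, hπ⟩

lemma IsDualSet.ae_ll {Γ : Set (M × M)} {μ ν : ProbabilityMeasure M} (h : L.IsDualSet p Γ μ ν)
    {π : Measure (M × M)} (hπ : L.IsOptimalCoupling p π μ ν) : ∀ᵐ z ∂π, L.ll z.1 z.2 := by
  filter_upwards [(h.iff_ae_mem π hπ.1).1 hπ] with z hz using h.ll z hz

lemma IsDualSet.profit_pos (hp : 0 < p) {Γ : Set (M × M)} {μ ν : ProbabilityMeasure M}
    (h : L.IsDualSet p Γ μ ν) (hm : Measurable fun z : M × M => L.τ z.1 z.2)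
    {π : Measure (M × M)} (hπ : L.IsOptimalCoupling p π μ ν) : 0 < L.profit p π := by
  have := hπ.1.isProbabilityMeasure
  refine pos_iff_ne_zero.2 fun h0 => ?_
  have h1 := (lintegral_eq_zero_iff (hm.pow_const p)).1 h0
  have h2 : ∀ᵐ z ∂π, False := by
    filter_upwards [h1, h.ae_ll hπ] with z hz hll
    have h3 := (L.τ_pos_iff _ _).2 hll
    exact (ENNReal.rpow_pos_of_nonneg h3 hp.le).ne' hz
  obtain ⟨z, hz⟩ := h2.exists
  exact hz

lemma ae_mem_support [SecondCountableTopology M] (μ : Measure M) :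
    ∀ᵐ x ∂μ, x ∈ μ.support := Measure.support_mem_ae

lemma profit_smul_add (w : ℝ≥0∞) (σ χ : Measure (M × M)) :
    L.profit p (w • σ + χ) = w * L.profit p σ + L.profit p χ := by
  simp [profit, lintegral_add_measure, lintegral_smul_measure]

/-- Replacing a part of a causal coupling by another causal coupling with the same marginals. -/
lemma IsCausalCoupling.replace {μ ν μ' ν' : ProbabilityMeasure M} {π' σ χ : Measure (M × M)}
    {w : ℝ≥0∞} (hπ : L.IsCausalCoupling (w • π' + χ) μ ν) (hπ' : IsCoupling π' μ' ν')
    (hσ : L.IsCausalCoupling σ μ' ν') : L.IsCausalCoupling (w • σ + χ) μ ν := by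
  obtain ⟨⟨h1, h2⟩, h3⟩ := hπ
  refine ⟨⟨?_, ?_⟩, ?_⟩
  · rw [← h1, Measure.fst_add, Measure.fst_add, Measure.fst, Measure.map_smul, ← Measure.fst,
      hσ.1.1, ← hπ'.1, Measure.fst, ← Measure.map_smul, ← Measure.fst]
  · rw [← h2, Measure.snd_add, Measure.snd_add, Measure.snd, Measure.map_smul, ← Measure.snd,
      hσ.1.2, ← hπ'.2, Measure.snd, ← Measure.map_smul, ← Measure.snd]
  · rw [ae_add_measure_iff] at h3 ⊢
    exact ⟨Measure.ae_smul_measure hσ.2 w, h3.2⟩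

/-- Parts of optimal couplings are optimal, and parts of dualizable pairs are dualizable. -/
lemma IsDualSet.restrict (hp : 0 < p) {Γ : Set (M × M)}
    {μ ν μ' ν' : ProbabilityMeasure M} {π' χ : Measure (M × M)}
    {w : ℝ≥0∞} (hw : w ≠ 0) (hw' : w ≠ ⊤) (h : L.IsDualSet p Γ μ ν)
    (hπ : L.IsOptimalCoupling p (w • π' + χ) μ ν) (hπ' : IsCoupling π' μ' ν')
    (hfin : L.profit p (w • π' + χ) ≠ ⊤) :
    L.IsDualSet p Γ μ' ν' ∧ L.IsOptimalCoupling p π' μ' ν' ∧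
      ∀ σ, L.IsOptimalCoupling p σ μ' ν' → L.IsOptimalCoupling p (w • σ + χ) μ ν := by
  have hπc : L.IsCausalCoupling π' μ' ν' := by
    refine ⟨hπ', ?_⟩
    have h3 := (ae_add_measure_iff.1 hπ.1.2).1
    exact (Measure.ae_ennreal_smul_measure_iff hw).1 h3
  have hiff := (isOptimalCoupling_iff hp).1 hπ
  have hχ : L.profit p χ ≠ ⊤ := fun h0 => hfin (by rw [profit_smul_add, h0, add_top])
  have hopt : L.IsOptimalCoupling p π' μ' ν' := by
    refine (isOptimalCoupling_iff hp).2 ⟨hπc, fun σ hσ => ?_⟩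
    have h1 := hiff.2 _ (hπ.1.replace hπ' hσ)
    rw [profit_smul_add, profit_smul_add] at h1
    exact (ENNReal.mul_le_mul_iff_right hw hw').1 ((ENNReal.add_le_add_iff_right hχ).1 h1)
  have hrep : ∀ σ, L.IsCausalCoupling σ μ' ν' →
      (L.IsOptimalCoupling p σ μ' ν' ↔ L.IsOptimalCoupling p (w • σ + χ) μ ν) := by
    intro σ hσ
    have hopt' := (isOptimalCoupling_iff hp).1 hopt
    constructor
    · intro h1
      refine (isOptimalCoupling_iff hp).2 ⟨hπ.1.replace hπ' hσ, fun η hη => ?_⟩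
      refine (hiff.2 η hη).trans ?_
      rw [profit_smul_add, profit_smul_add]
      gcongr
      exact ((isOptimalCoupling_iff hp).1 h1).2 _ hπc
    · intro h1
      refine (isOptimalCoupling_iff hp).2 ⟨hσ, fun η hη => ?_⟩
      have h2 := ((isOptimalCoupling_iff hp).1 h1).2 _ hπ.1
      rw [profit_smul_add, profit_smul_add] at h2
      exact (hopt'.2 η hη).trans
        ((ENNReal.mul_le_mul_iff_right hw hw').1 ((ENNReal.add_le_add_iff_right hχ).1 h2))
  refine ⟨⟨h.measurableSet, h.cyclicallyMonotone, h.ll, fun σ hσ => ?_⟩, hopt,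
    fun σ hσ => (hrep σ hσ.1).1 hσ⟩
  rw [hrep σ hσ, h.iff_ae_mem _ (hπ.1.replace hπ' hσ), ae_add_measure_iff,
    Measure.ae_ennreal_smul_measure_iff hw]
  exact and_iff_left (ae_add_measure_iff.1 ((h.iff_ae_mem _ hπ.1).1 hπ)).2

lemma IsMidPlan.ae_mem_midTriples {Γ : Set (M × M)} {μ ν : ProbabilityMeasure M}
    (h : L.IsDualSet p Γ μ ν) {Ξ : Measure (M × M × M)} (hΞ : L.IsMidPlan p Ξ μ ν) :
    ∀ᵐ w ∂Ξ, w ∈ L.midTriples Γ := by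
  have h1 : ∀ᵐ w ∂Ξ, (w.1, w.2.2) ∈ Γ :=
    ae_of_ae_map (f := fun w : M × M × M => (w.1, w.2.2)) (by fun_prop)
      ((h.iff_ae_mem _ hΞ.1.1).1 hΞ.1)
  filter_upwards [h1, hΞ.2] with w h1 h2 using ⟨h2, subset_chronClosure h.ll h1⟩

variable [ProperSpace M] [BorelSpace M]

/-- On compact sets the potentials of a dualizable pair can be taken constant, as `τ` is bounded. -/
lemma IsDualSet.stronglyTimelikeDualizable (hL : L.IsTame) (hp : 0 < p) {K : Set M}
    (hK : IsCompact K) {μ ν : ProbabilityMeasure M} (hμ : ∀ᵐ x ∂(μ : Measure M), x ∈ K)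
    (hν : ∀ᵐ x ∂(ν : Measure M), x ∈ K) {Γ : Set (M × M)} (h : L.IsDualSet p Γ μ ν)
    {π : Measure (M × M)} (hπ : L.IsOptimalCoupling p π μ ν) :
    L.StronglyTimelikeDualizable p μ ν := by
  obtain ⟨B, hB⟩ := hL.exists_τ_le hK
  have hsupp : ∀ κ : ProbabilityMeasure M, (∀ᵐ x ∂(κ : Measure M), x ∈ K) →
      (κ : Measure M).support ⊆ K := fun κ hκ =>
    Measure.support_subset_of_isClosed hK.isClosed hκ
  refine ⟨⟨π, ⟨hπ.1.1, h.ae_ll hπ⟩, hπ, fun _ => ((B ^ p : ℝ≥0) : ℝ), fun _ => 0,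
    measurable_const, measurable_const, integrable_const _, fun x hx y hy => ?_⟩,
    Γ ∩ ((μ : Measure M).support ×ˢ (ν : Measure M).support), ?_, ?_, ?_, ?_⟩
  · unfold lPow
    split_ifs
    · rw [add_zero]
      have h1 : L.τ x y ^ p ≤ ((B ^ p : ℝ≥0) : ℝ≥0∞) := by
        rw [ENNReal.coe_rpow_of_nonneg _ hp.le]
        exact ENNReal.rpow_le_rpow (hB _ (hsupp μ hμ hx) _ (hsupp ν hν hy)) hp.le
      exact (EReal.coe_ennreal_le_coe_ennreal_iff.2 h1).trans_eq rfl
    · exact bot_le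
  · exact h.measurableSet.inter
      (Measure.isClosed_support.measurableSet.prod Measure.isClosed_support.measurableSet)
  · exact fun n z hz => h.cyclicallyMonotone n z fun i => (hz i).1
  · exact fun z hz => ⟨h.ll z hz.1, hz.2.1, hz.2.2⟩
  · intro σ hσ
    have := hσ.isProbabilityMeasure
    rw [h.iff_ae_mem σ hσ, ← mem_ae_iff_prob_eq_one (h.measurableSet.inter
      (Measure.isClosed_support.measurableSet.prod Measure.isClosed_support.measurableSet))]
    constructor
    · intro h1
      filter_upwards [h1, hσ.1.ae_fst (ae_mem_support _), hσ.1.ae_snd (ae_mem_support _)]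
        with z h1 h2 h3 using ⟨h1, h2, h3⟩
    · intro h1
      filter_upwards [h1] with z hz using hz.1

lemma measurableSet_left_midTriples (hL : L.IsTame) (Γ : Set (M × M)) :
    MeasurableSet ((fun w : M × M × M => (w.1, w.2.1)) '' L.midTriples Γ) :=
  IsSigmaCompact.measurableSet
    ((hL.isSigmaCompact_midTriples Γ).image (f := fun w : M × M × M => (w.1, w.2.1))
      (by fun_prop))

lemma measurableSet_right_midTriples (hL : L.IsTame) (Γ : Set (M × M)) :
    MeasurableSet (Prod.snd '' L.midTriples Γ) :=
  IsSigmaCompact.measurableSet ((hL.isSigmaCompact_midTriples Γ).image continuous_snd)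

/-- A midpoint forms a dualizable pair with the starting measure. -/
lemma IsDualSet.left (hL : L.IsTame) (hp₀ : 0 < p) (hp₁ : p < 1) {Γ : Set (M × M)}
    {μ ρ ν : ProbabilityMeasure M} (h : L.IsDualSet p Γ μ ν) {Ξ : Measure (M × M × M)}
    (hΞ : L.IsMidPlan p Ξ μ ν) (hρ : Ξ.map (fun w => w.2.1) = ρ)
    (hfin : L.profit p (Ξ.map fun w => (w.1, w.2.1)) ≠ ⊤) :
    L.IsDualSet p ((fun w : M × M × M => (w.1, w.2.1)) '' L.midTriples Γ) μ ρ := by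
  have hm1 := measurableSet_left_midTriples hL Γ
  have hm2 := measurableSet_right_midTriples hL Γ
  refine ⟨hm1, h.cyclicallyMonotone.left hL hp₀ hp₁ h.ll, ?_, fun σ hσ => ⟨fun hopt => ?_,
    fun hae => ?_⟩⟩
  · rintro _ ⟨w, hw, rfl⟩
    exact (L.τ_pos_iff _ _).1 (midTriples_pos hw).1
  · obtain ⟨Ξ', hΞ', rfl, -, -⟩ := hΞ.exists_of_left hL hp₀ hp₁ hρ hfin hopt
    refine (ae_map_iff (by fun_prop) hm1).2 ?_
    filter_upwards [hΞ'.ae_mem_midTriples h] with w hw using mem_image_of_mem _ hw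
  -- a coupling on the image has the optimal cost: glue it with the other half and compare lengths
  -- over the common middle point
  · obtain ⟨h1, h2, h3, h4⟩ := hΞ.halves hL hp₀ hρ
    obtain ⟨Ξ', e1, e2, -, -, -, -⟩ := hL.exists_causal_glue hσ h2
    have h5 : ∀ᵐ w ∂Ξ', (w.1, w.2.1) ∈ (fun w : M × M × M => (w.1, w.2.1)) '' L.midTriples Γ :=
      ae_of_ae_map (f := fun w : M × M × M => (w.1, w.2.1)) (by fun_prop) (e1 ▸ hae)
    have h6 : ∀ᵐ w ∂Ξ', w.2 ∈ Prod.snd '' L.midTriples Γ := by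
      refine ae_of_ae_map (f := Prod.snd) (by fun_prop) ?_
      rw [e2]
      refine (ae_map_iff (by fun_prop) hm2).2 ?_
      filter_upwards [hΞ.ae_mem_midTriples h] with w hw using mem_image_of_mem _ hw
    have h7 : L.profit p σ = L.profit p (Ξ.map fun w => (w.1, w.2.1)) := by
      rw [← h3, ← e1, ← e2, hL.profit_map (by fun_prop), hL.profit_map (by fun_prop)]
      refine lintegral_congr_ae ?_
      filter_upwards [h5, h6] with w h5 h6
      rw [h.cyclicallyMonotone.τ_eq hL hp₀ hp₁ h.ll h5 h6]
    refine (isOptimalCoupling_iff hp₀).2 ⟨hσ, fun η hη => ?_⟩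
    rw [h7]
    exact ((isOptimalCoupling_iff hp₀).1 (hΞ.left_optimal hL hp₀ hp₁ hρ hfin)).2 η hη

/-- A midpoint forms a dualizable pair with the final measure. -/
lemma IsDualSet.right (hL : L.IsTame) (hp₀ : 0 < p) (hp₁ : p < 1) {Γ : Set (M × M)}
    {μ ρ ν : ProbabilityMeasure M} (h : L.IsDualSet p Γ μ ν) {Ξ : Measure (M × M × M)}
    (hΞ : L.IsMidPlan p Ξ μ ν) (hρ : Ξ.map (fun w => w.2.1) = ρ)
    (hfin : L.profit p (Ξ.map fun w => (w.1, w.2.1)) ≠ ⊤) :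
    L.IsDualSet p (Prod.snd '' L.midTriples Γ) ρ ν := by
  have hm1 := measurableSet_left_midTriples hL Γ
  have hm2 := measurableSet_right_midTriples hL Γ
  refine ⟨hm2, h.cyclicallyMonotone.right hL hp₀ hp₁ h.ll, ?_, fun σ hσ => ⟨fun hopt => ?_,
    fun hae => ?_⟩⟩
  · rintro _ ⟨w, hw, rfl⟩
    exact (L.τ_pos_iff _ _).1 (midTriples_pos hw).2
  · obtain ⟨Ξ', hΞ', -, rfl, -⟩ := hΞ.exists_of_right hL hp₀ hp₁ hρ hfin hopt
    refine (ae_map_iff (by fun_prop) hm2).2 ?_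
    filter_upwards [hΞ'.ae_mem_midTriples h] with w hw using mem_image_of_mem _ hw
  · obtain ⟨h1, h2, h3, h4⟩ := hΞ.halves hL hp₀ hρ
    obtain ⟨Ξ', e1, e2, -, -, -, -⟩ := hL.exists_causal_glue h1 hσ
    have h5 : ∀ᵐ w ∂Ξ', w.2 ∈ Prod.snd '' L.midTriples Γ :=
      ae_of_ae_map (f := Prod.snd) (by fun_prop) (e2 ▸ hae)
    have h6 : ∀ᵐ w ∂Ξ', (w.1, w.2.1) ∈ (fun w : M × M × M => (w.1, w.2.1)) '' L.midTriples Γ := by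
      refine ae_of_ae_map (f := fun w : M × M × M => (w.1, w.2.1)) (by fun_prop) ?_
      rw [e1]
      refine (ae_map_iff (by fun_prop) hm1).2 ?_
      filter_upwards [hΞ.ae_mem_midTriples h] with w hw using mem_image_of_mem _ hw
    have h7 : L.profit p σ = L.profit p (Ξ.map Prod.snd) := by
      rw [h3, ← e1, ← e2, hL.profit_map (by fun_prop), hL.profit_map (by fun_prop)]
      refine lintegral_congr_ae ?_
      filter_upwards [h5, h6] with w h5 h6
      rw [h.cyclicallyMonotone.τ_eq hL hp₀ hp₁ h.ll h6 h5]
    refine (isOptimalCoupling_iff hp₀).2 ⟨hσ, fun η hη => ?_⟩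
    rw [h7]
    exact ((isOptimalCoupling_iff hp₀).1 (hΞ.right_optimal hL hp₀ hp₁ hρ hfin)).2 η hη

end Dualizability

end LorentzianPreLength

lemma EReal.coe_mul_coe_ennreal {r : ℝ} (hr : 0 ≤ r) (T : ℝ≥0∞) :
    (r : EReal) * (T : EReal) = ((ENNReal.ofReal r * T : ℝ≥0∞) : EReal) := by
  rw [EReal.coe_ennreal_mul, EReal.coe_ennreal_ofReal, max_eq_left hr]

namespace LorentzianPreLength

section MidpointSet

variable {M : Type*} [MetricSpace M] [MeasurableSpace M] {L : LorentzianPreLength M} {p : ℝ}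

lemma exists_isCausalCoupling {μ ν : ProbabilityMeasure M} (h : L.cost p μ ν ≠ ⊥) :
    ∃ π, L.IsCausalCoupling π μ ν := by
  by_contra! hcon
  refine h ?_
  rw [cost]
  simp [hcon]

lemma profit_eq_tauNorm_rpow (hp : 0 < p) (π : Measure (M × M)) :
    L.profit p π = L.tauNorm p π ^ p := by
  rw [tauNorm_eq, one_div, ENNReal.rpow_inv_rpow hp.ne']

/-- Midpoint plans for a replaced part of the pair `(μ, ν)`: if the part of a midpoint plan that
runs through `A` is normalized to a plan between `μ'` and `ν'`, then a fraction `ε` of it may be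
replaced by any other midpoint plan between `μ'` and `ν'`. -/
lemma IsMidPlan.exists_replacement (hp : 0 < p) {Γ : Set (M × M)}
    {μ ρ ν : ProbabilityMeasure M} (h : L.IsDualSet p Γ μ ν) {Ξ : Measure (M × M × M)}
    (hΞ : L.IsMidPlan p Ξ μ ν) (hρ : Ξ.map (fun w => w.2.1) = ρ)
    (hfin : L.profit p (Ξ.map fun w => (w.1, w.2.2)) ≠ ⊤) {A : Set M} (hA : MeasurableSet A)
    {a : ℝ≥0∞} (ha : (ρ : Measure M) A = a) (ha0 : a ≠ 0) :
    ∃ μ' ν' : ProbabilityMeasure M, L.IsDualSet p Γ μ' ν' ∧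
      (∃ π', L.IsOptimalCoupling p π' μ' ν') ∧
      a • (μ' : Measure M) ≤ μ ∧ a • (ν' : Measure M) ≤ ν ∧
      (∀ σ, L.IsOptimalCoupling p σ μ' ν' → ∃ χ, L.IsOptimalCoupling p (a • σ + χ) μ ν) ∧
      ∀ ρ', L.IsMidpoint p ρ' μ' ν' → ∀ ε : ℝ≥0∞, ε ≠ 0 → ε ≤ 1 → ∀ ρε : ProbabilityMeasure M,
        (ρε : Measure M) = (ρ : Measure M).restrict Aᶜ + (1 - ε) • (ρ : Measure M).restrict A +
          (ε * a) • (ρ' : Measure M) → L.IsMidpoint p ρε μ ν := by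
  have hat : a ≠ ⊤ := ha ▸ measure_ne_top _ _
  set B : Set (M × M × M) := (fun w => w.2.1) ⁻¹' A with hB
  have hBm : MeasurableSet B := hA.preimage (by fun_prop)
  have hΞB : Ξ B = a := by rw [← ha, ← hρ, Measure.map_apply (by fun_prop) hA]
  set Ξ' : Measure (M × M × M) := a⁻¹ • Ξ.restrict B with hΞ'
  have haΞ' : a • Ξ' = Ξ.restrict B := by
    rw [hΞ', smul_smul, ENNReal.mul_inv_cancel ha0 hat, one_smul]
  have hprob : IsProbabilityMeasure Ξ' := ⟨by
    rw [hΞ', Measure.smul_apply, Measure.restrict_apply_univ, hΞB, smul_eq_mul,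
      ENNReal.inv_mul_cancel ha0 hat]⟩
  have hm : Measurable fun w : M × M × M => (w.1, w.2.2) := by fun_prop
  have hmz : Measurable fun w : M × M × M => w.2.1 := by fun_prop
  let e : M × M × M → M × M := fun w => (w.1, w.2.2)
  let μ' : ProbabilityMeasure M := ⟨Ξ'.map fun w => w.1,
    Measure.isProbabilityMeasure_map (by fun_prop)⟩
  let ν' : ProbabilityMeasure M := ⟨Ξ'.map fun w => w.2.2,
    Measure.isProbabilityMeasure_map (by fun_prop)⟩
  have hcoup : IsCoupling (Ξ'.map e) μ' ν' := by
    constructor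
    · rw [Measure.fst, Measure.map_map (by fun_prop) (by fun_prop)]; rfl
    · rw [Measure.snd, Measure.map_map (by fun_prop) (by fun_prop)]; rfl
  have hsplit : ∀ ε : ℝ≥0∞, ε ≤ 1 → (ε * a) • Ξ'.map e +
      ((Ξ.restrict Bᶜ).map e + (1 - ε) • (Ξ.restrict B).map e) = Ξ.map e := by
    intro ε hε
    rw [mul_smul, ← Measure.map_smul, haΞ', add_left_comm, ← add_smul,
      add_tsub_cancel_of_le hε, one_smul, ← Measure.map_add _ _ hm, add_comm,
      Measure.restrict_add_restrict_compl hBm]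
  have hμ : (μ : Measure M) = Ξ.map fun w => w.1 := by
    rw [← hΞ.1.1.1.1, Measure.fst, Measure.map_map (by fun_prop) (by fun_prop)]; rfl
  have hν : (ν : Measure M) = Ξ.map fun w => w.2.2 := by
    rw [← hΞ.1.1.1.2, Measure.snd, Measure.map_map (by fun_prop) (by fun_prop)]; rfl
  have key : ∀ ε : ℝ≥0∞, ε ≠ 0 → ε ≤ 1 → L.IsDualSet p Γ μ' ν' ∧
      L.IsOptimalCoupling p (Ξ'.map e) μ' ν' ∧ ∀ σ, L.IsOptimalCoupling p σ μ' ν' →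
        L.IsOptimalCoupling p ((ε * a) • σ +
          ((Ξ.restrict Bᶜ).map e + (1 - ε) • (Ξ.restrict B).map e)) μ ν := by
    intro ε hε hε1
    have h1 : L.IsOptimalCoupling p (Ξ.map e) μ ν := hΞ.1
    have h2 : L.profit p (Ξ.map e) ≠ ⊤ := hfin
    rw [← hsplit ε hε1] at h1 h2
    exact h.restrict hp (mul_ne_zero hε ha0)
      (ENNReal.mul_ne_top (ne_top_of_le_ne_top ENNReal.one_ne_top hε1) hat) h1 hcoup h2
  obtain ⟨k1, k2, k3⟩ := key 1 one_ne_zero le_rfl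
  refine ⟨μ', ν', k1, ⟨_, k2⟩, ?_, ?_, fun σ hσ => ⟨_, by simpa only [one_mul] using k3 σ hσ⟩, ?_⟩
  · change a • Ξ'.map (fun w => w.1) ≤ (μ : Measure M)
    rw [← Measure.map_smul, haΞ', hμ]
    exact Measure.map_mono Measure.restrict_le_self (by fun_prop)
  · change a • Ξ'.map (fun w => w.2.2) ≤ (ν : Measure M)
    rw [← Measure.map_smul, haΞ', hν]
    exact Measure.map_mono Measure.restrict_le_self (by fun_prop)
  · rintro ρ' ⟨Ξ₂, hΞ₂, hρ'⟩ ε hε hε1 ρε hρε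
    refine ⟨(ε * a) • Ξ₂ + (Ξ.restrict Bᶜ + (1 - ε) • Ξ.restrict B), ⟨?_, ?_⟩, ?_⟩
    · rw [Measure.map_add _ _ hm, Measure.map_add _ _ hm, Measure.map_smul, Measure.map_smul]
      exact (key ε hε hε1).2.2 _ hΞ₂.1
    · rw [ae_add_measure_iff, ae_add_measure_iff]
      exact ⟨Measure.ae_smul_measure hΞ₂.2 _, ae_restrict_of_ae hΞ.2,
        Measure.ae_smul_measure (ae_restrict_of_ae hΞ.2) _⟩
    · have hr : ∀ S : Set M, MeasurableSet S →
          (Ξ.restrict ((fun w : M × M × M => w.2.1) ⁻¹' S)).map (fun w => w.2.1) =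
            (ρ : Measure M).restrict S := fun S hS => by
        rw [← hρ, Measure.restrict_map hmz hS]
      rw [hρε, Measure.map_add _ _ hmz, Measure.map_add _ _ hmz, Measure.map_smul,
        Measure.map_smul, hρ', hr A hA, add_comm]
      congr 2
      exact hr _ hA.compl

lemma IsMidPlan.ae_mem {K : Set M} {μ ν : ProbabilityMeasure M}
    (hμ : ∀ᵐ x ∂(μ : Measure M), x ∈ K)
    (hν : ∀ᵐ x ∂(ν : Measure M), x ∈ K) {Ξ : Measure (M × M × M)} (hΞ : L.IsMidPlan p Ξ μ ν) :
    ∀ᵐ w ∂Ξ, w ∈ K ×ˢ (L.diamond K K ×ˢ K) := by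
  have h1 := ae_of_ae_map (f := fun w : M × M × M => (w.1, w.2.2)) (by fun_prop)
    (hΞ.1.1.1.ae_fst hμ)
  have h2 := ae_of_ae_map (f := fun w : M × M × M => (w.1, w.2.2)) (by fun_prop)
    (hΞ.1.1.1.ae_snd hν)
  filter_upwards [h1, h2, hΞ.2] with w h1 h2 h3
  exact ⟨h1, ⟨⟨_, h1, h3.1⟩, ⟨_, h2, h3.2.1⟩⟩, h2⟩

variable [BorelSpace M]

lemma IsMidpoint.ae_mem (hL : L.IsTame) {K : Set M} (hK : IsCompact K)
    {μ ρ ν : ProbabilityMeasure M} (hμ : ∀ᵐ x ∂(μ : Measure M), x ∈ K)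
    (hν : ∀ᵐ x ∂(ν : Measure M), x ∈ K) (hρ : L.IsMidpoint p ρ μ ν) :
    ∀ᵐ z ∂(ρ : Measure M), z ∈ L.diamond K K := by
  obtain ⟨Ξ, hΞ, hρ⟩ := hρ
  rw [← hρ]
  refine (ae_map_iff (by fun_prop) (hL.isCompact_diamond K K hK hK).measurableSet).2 ?_
  filter_upwards [hΞ.ae_mem hμ hν] with w hw using hw.2.1

variable [ProperSpace M]

/-- The midpoints of two compactly supported measures form a compact set. -/
lemma IsTame.isCompact_midpoints (hL : L.IsTame) (hp : 0 < p) {K : Set M} (hK : IsCompact K)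
    {μ ν : ProbabilityMeasure M} (hμ : ∀ᵐ x ∂(μ : Measure M), x ∈ K)
    (hν : ∀ᵐ x ∂(ν : Measure M), x ∈ K) {π : Measure (M × M)}
    (hπ : L.IsOptimalCoupling p π μ ν) :
    IsCompact {ρ : ProbabilityMeasure M | L.IsMidpoint p ρ μ ν} := by
  have hKc : IsCompact (K ×ˢ (L.diamond K K ×ˢ K)) :=
    hK.prod ((hL.isCompact_diamond K K hK hK).prod hK)
  set S : Set (ProbabilityMeasure (M × M × M)) :=
    {Ξ | ∀ᵐ w ∂(Ξ : Measure (M × M × M)), w ∈ K ×ˢ (L.diamond K K ×ˢ K)} with hS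
  have hSc : IsCompact S := ProbabilityMeasure.isCompact_setOf_ae_mem hKc
  have hm : Measurable fun w : M × M × M => (w.1, w.2.2) := by fun_prop
  have hm1 : Continuous fun w : M × M × M => w.1 := by fun_prop
  have hm2 : Continuous fun w : M × M × M => w.2.1 := by fun_prop
  have hm3 : Continuous fun w : M × M × M => w.2.2 := by fun_prop
  set S₁ : Set (ProbabilityMeasure (M × M × M)) := S ∩
    (({Ξ | Ξ.map hm1.measurable.aemeasurable = μ} ∩ {Ξ | Ξ.map hm3.measurable.aemeasurable = ν}) ∩
      {Ξ | ∀ᵐ w ∂(Ξ : Measure (M × M × M)), w ∈ L.midSet}) with hS₁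
  have hS₁c : IsCompact S₁ := hSc.inter_right
    (((isClosed_eq (ProbabilityMeasure.continuous_map hm1) continuous_const).inter
      (isClosed_eq (ProbabilityMeasure.continuous_map hm3) continuous_const)).inter
      (ProbabilityMeasure.isClosed_setOf_ae_mem hL.isClosed_midSet))
  have hf : ContinuousOn (fun Ξ : ProbabilityMeasure (M × M × M) =>
      L.profit p ((Ξ : Measure (M × M × M)).map fun w => (w.1, w.2.2))) S₁ := by
    have h1 : Continuous fun w : M × M × M => (L.τ w.1 w.2.2).toNNReal ^ p :=
      (NNReal.continuous_rpow_const hp.le).comp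
        (hL.continuous_toNNReal.comp (f := fun w : M × M × M => (w.1, w.2.2)) (by fun_prop))
    refine ((ProbabilityMeasure.continuousOn_lintegral h1 hKc).mono inter_subset_left).congr
      fun Ξ _ => ?_
    rw [hL.profit_map hm]
    refine lintegral_congr fun w => ?_
    rw [ENNReal.coe_rpow_of_nonneg _ hp.le, ENNReal.coe_toNNReal (hL.τ_ne_top _ _)]
  have hS₂c := hS₁c.of_isClosed_subset
    (hf.preimage_isClosed_of_isClosed hS₁c.isClosed (isClosed_Ici (a := L.profit p π)))
    inter_subset_left
  have hopt := (isOptimalCoupling_iff hp).1 hπ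
  convert hS₂c.image (ProbabilityMeasure.continuous_map hm2) using 1
  ext ρ
  constructor
  · rintro ⟨Ξ, hΞ, hρ⟩
    have h1 : IsProbabilityMeasure (Ξ.map fun w : M × M × M => (w.1, w.2.2)) :=
      hΞ.1.1.isProbabilityMeasure
    have h2 : IsProbabilityMeasure Ξ := Measure.isProbabilityMeasure_of_map (fun w : M × M × M => (w.1, w.2.2))
    refine ⟨⟨Ξ, h2⟩, ⟨⟨hΞ.ae_mem hμ hν, ⟨?_, ?_⟩, hΞ.2⟩, ?_⟩, Subtype.ext hρ⟩
    · refine Subtype.ext ?_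
      change Ξ.map (fun w => w.1) = μ
      rw [← hΞ.1.1.1.1, Measure.fst, Measure.map_map (by fun_prop) (by fun_prop)]; rfl
    · refine Subtype.ext ?_
      change Ξ.map (fun w => w.2.2) = ν
      rw [← hΞ.1.1.1.2, Measure.snd, Measure.map_map (by fun_prop) (by fun_prop)]; rfl
    · exact ((isOptimalCoupling_iff hp).1 hΞ.1).2 _ hπ.1
  · rintro ⟨Ξ, ⟨⟨-, ⟨h1, h2⟩, h3⟩, h4⟩, rfl⟩
    replace h1 : (Ξ : Measure (M × M × M)).map (fun w => w.1) = μ := congrArg Subtype.val h1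
    replace h2 : (Ξ : Measure (M × M × M)).map (fun w => w.2.2) = ν := congrArg Subtype.val h2
    refine ⟨Ξ, ⟨(isOptimalCoupling_iff hp).2 ⟨⟨⟨?_, ?_⟩, ?_⟩, fun σ hσ =>
      (hopt.2 σ hσ).trans h4⟩, h3⟩, rfl⟩
    · rw [← h1, Measure.fst, Measure.map_map (by fun_prop) (by fun_prop)]; rfl
    · rw [← h2, Measure.snd, Measure.map_map (by fun_prop) (by fun_prop)]; rfl
    · refine (ae_map_iff (by fun_prop) hL.measurableSet_le).2 ?_
      filter_upwards [h3] with w hw using L.le_trans _ _ _ hw.1 hw.2.1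

/-- The curvature-dimension condition provides midpoints of dualizable pairs along which the
entropy is convex. -/
lemma WTCD.exists_midpoint (hL : L.IsTame) {m : Measure M} {K N : ℝ} (hp₀ : 0 < p)
    (hp₁ : p < 1) (hTCD : L.WTCD m p K N) {C : Set M} (hC : IsCompact C)
    {μ ν : ProbabilityMeasure M} (hμ : ∀ᵐ x ∂(μ : Measure M), x ∈ C)
    (hν : ∀ᵐ x ∂(ν : Measure M), x ∈ C) {Γ : Set (M × M)} (h : L.IsDualSet p Γ μ ν)
    {π₀ : Measure (M × M)} (hπ₀ : L.IsOptimalCoupling p π₀ μ ν)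
    (hμE : μ ∈ finiteDomain (relEntropy m)) (hνE : ν ∈ finiteDomain (relEntropy m)) :
    ∃ (π : Measure (M × M)) (ρ : ProbabilityMeasure M), L.IsOptimalCoupling p π μ ν ∧
      L.IsMidpoint p ρ μ ν ∧
      distortion K N (1 / 2) (L.tauNorm 2 π) *
        (expFunctional (relEntropy m) N μ + expFunctional (relEntropy m) N ν) ≤
        expFunctional (relEntropy m) N ρ := by
  have hsupp : ∀ κ : ProbabilityMeasure M, (∀ᵐ x ∂(κ : Measure M), x ∈ C) →
      IsCompact (κ : Measure M).support := fun κ hκ =>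
    hC.of_isClosed_subset Measure.isClosed_support
      (Measure.support_subset_of_isClosed hC.isClosed hκ)
  have := hπ₀.1.isProbabilityMeasure
  have hfin₀ : L.tauNorm p π₀ ≠ ⊤ := by
    rw [tauNorm_eq]
    refine ENNReal.rpow_ne_top_of_nonneg (by positivity) (hL.profit_ne_top hp₀.le hC ?_)
    filter_upwards [hπ₀.1.1.ae_fst hμ, hπ₀.1.1.ae_snd hν] with z h1 h2 using ⟨h1, h2⟩
  have hcost : L.cost p μ ν = (L.tauNorm p π₀ : EReal) := hπ₀.2
  obtain ⟨π, κ, -, hπ, hκ, rfl, rfl, hconv⟩ := hTCD μ ν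
    ⟨h.stronglyTimelikeDualizable hL hp₀ hC hμ hν hπ₀, hsupp μ hμ, hsupp ν hν⟩ hμE hνE
    (by rw [hcost]; exact Ne.lt_top fun h => hfin₀ (EReal.coe_ennreal_eq_top_iff.1 h))
  set t : unitInterval := ⟨1 / 2, by norm_num, by norm_num⟩ with ht
  have ht0 : (0 : unitInterval) < t := Subtype.coe_lt_coe.1 (by simp [ht])
  have ht1 : t < (1 : unitInterval) := Subtype.coe_lt_coe.1 (by simp [ht]; norm_num)
  have hc1 : L.cost p (κ 0) (κ t) = ((ENNReal.ofReal (1 / 2) * L.tauNorm p π₀ : ℝ≥0∞) : EReal) := by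
    rw [hκ.2.2 0 t ht0, hcost, ← EReal.coe_mul_coe_ennreal (by norm_num)]
    congr 2
    simp [ht]
  have hc2 : L.cost p (κ t) (κ 1) = ((ENNReal.ofReal (1 / 2) * L.tauNorm p π₀ : ℝ≥0∞) : EReal) := by
    rw [hκ.2.2 t 1 ht1, hcost, ← EReal.coe_mul_coe_ennreal (by norm_num)]
    congr 2
    simp [ht]; norm_num
  obtain ⟨σ₁, hσ₁⟩ := exists_isCausalCoupling (L := L) (p := p) (μ := κ 0) (ν := κ t)
    (by rw [hc1]; exact EReal.coe_ennreal_ne_bot _)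
  obtain ⟨σ₂, hσ₂⟩ := exists_isCausalCoupling (L := L) (p := p) (μ := κ t) (ν := κ 1)
    (by rw [hc2]; exact EReal.coe_ennreal_ne_bot _)
  have hJ := hL.isCompact_diamond C C hC hC
  have htJ : ∀ᵐ z ∂(κ t : Measure M), z ∈ C ∪ L.diamond C C := by
    obtain ⟨Ξ, e1, e2, e3, e4, e5, e6⟩ := hL.exists_causal_glue hσ₁ hσ₂
    rw [← e3]
    refine (ae_map_iff (by fun_prop) (hC.union hJ).measurableSet).2 ?_
    have h1 := ae_of_ae_map (f := fun w : M × M × M => (w.1, w.2.2)) (by fun_prop)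
      (e4.1.ae_fst hμ)
    have h2 := ae_of_ae_map (f := fun w : M × M × M => (w.1, w.2.2)) (by fun_prop)
      (e4.1.ae_snd hν)
    filter_upwards [h1, h2, e5, e6] with w h1 h2 h3 h4
    exact Or.inr ⟨⟨_, h1, h3⟩, ⟨_, h2, h4⟩⟩
  obtain ⟨π₁, hπ₁⟩ := hL.exists_isOptimalCoupling hp₀ (hC.union hJ)
    (hμ.mono fun x hx => Or.inl hx) htJ hσ₁
  obtain ⟨π₂, hπ₂⟩ := hL.exists_isOptimalCoupling hp₀ (hC.union hJ) htJ
    (hν.mono fun x hx => Or.inl hx) hσ₂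
  have hT1 : L.tauNorm p π₁ = ENNReal.ofReal (1 / 2) * L.tauNorm p π₀ := by
    have := hπ₁.2
    rw [hc1] at this
    exact (EReal.coe_ennreal_eq_coe_ennreal_iff.1 this).symm
  have hT2 : L.tauNorm p π₂ = ENNReal.ofReal (1 / 2) * L.tauNorm p π₀ := by
    have := hπ₂.2
    rw [hc2] at this
    exact (EReal.coe_ennreal_eq_coe_ennreal_iff.1 this).symm
  have hhalf : ENNReal.ofReal (1 / 2) = 2⁻¹ := by
    rw [one_div, ENNReal.ofReal_inv_of_pos two_pos]; simp
  have hprof : 2 ^ p * L.profit p π₁ = L.profit p π₀ := by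
    rw [profit_eq_tauNorm_rpow hp₀, profit_eq_tauNorm_rpow hp₀, hT1,
      ← ENNReal.mul_rpow_of_nonneg _ _ hp₀.le, ← mul_assoc, hhalf,
      ENNReal.mul_inv_cancel two_ne_zero ENNReal.ofNat_ne_top, one_mul]
  obtain ⟨Ξ, hΞ, -, -, hρ⟩ := hL.exists_isMidPlan hp₀ hp₁ hπ₁.1 hπ₂.1
    (by rw [profit_eq_tauNorm_rpow hp₀, profit_eq_tauNorm_rpow hp₀, hT1, hT2])
    (by
      rw [profit_eq_tauNorm_rpow hp₀, hT1]
      exact ENNReal.rpow_ne_top_of_nonneg hp₀.le (ENNReal.mul_ne_top ENNReal.ofReal_ne_top hfin₀))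
    fun χ hχ => by rw [hprof]; exact ((isOptimalCoupling_iff hp₀).1 hπ₀).2 χ hχ
  refine ⟨π, κ t, hπ, ⟨Ξ, hΞ, hρ⟩, ?_⟩
  have h3 := hconv t
  have h4 : (1 : ℝ) - (t : ℝ) = 1 / 2 := by simp [ht]; norm_num
  rw [h4, ← mul_add] at h3
  exact h3

end MidpointSet

end LorentzianPreLength

/-! ### A variational form of the entropy -/

open Classical in
/-- The minimizer of `w ↦ g * w + f * exp (-w)` over `[0, n]`: it is `log (f / g)`, clamped to
`[0, n]`. -/
def clampLog (n f g : ℝ) : ℝ :=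
  if g ≤ Real.exp (-n) * f then n else if f ≤ g then 0 else Real.log (f / g)

lemma clampLog_nonneg {n f g : ℝ} (hn : 0 ≤ n) (hf : 0 ≤ f) : 0 ≤ clampLog n f g := by
  unfold clampLog
  split_ifs with h1 h2
  · exact hn
  · exact le_rfl
  · have hg : 0 < g := (mul_nonneg (Real.exp_pos _).le hf).trans_lt (not_le.1 h1)
    exact Real.log_nonneg ((one_le_div hg).2 (not_le.1 h2).le)

lemma clampLog_le {n f g : ℝ} (hn : 0 ≤ n) (hf : 0 ≤ f) : clampLog n f g ≤ n := by
  unfold clampLog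
  split_ifs with h1 h2
  · exact le_rfl
  · exact hn
  · have hg : 0 < g := (mul_nonneg (Real.exp_pos _).le hf).trans_lt (not_le.1 h1)
    have hf' : 0 < f := hg.trans (not_le.1 h2)
    rw [Real.log_le_iff_le_exp (by positivity), div_le_iff₀ hg]
    have h3 := mul_le_mul_of_nonneg_left (not_le.1 h1).le (Real.exp_pos n).le
    rwa [← mul_assoc, ← Real.exp_add, add_neg_cancel, Real.exp_zero, one_mul] at h3

lemma clampLog_min {n f g w : ℝ} (hf : 0 ≤ f) (hw : 0 ≤ w) (hwn : w ≤ n) :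
    g * clampLog n f g + f * Real.exp (-clampLog n f g) ≤ g * w + f * Real.exp (-w) := by
  unfold clampLog
  split_ifs with h1 h2
  · have h3 : Real.exp (-w) ≥ Real.exp (-n) * (n - w + 1) := by
      have := mul_le_mul_of_nonneg_left (Real.add_one_le_exp (n - w)) (Real.exp_pos (-n)).le
      rwa [← Real.exp_add, show -n + (n - w) = -w by ring] at this
    have h4 := mul_le_mul_of_nonneg_right h1 (sub_nonneg.2 hwn)
    have h5 := mul_le_mul_of_nonneg_left h3 hf
    nlinarith
  · have h3 := Real.add_one_le_exp (-w)
    simp only [mul_zero, neg_zero, Real.exp_zero, mul_one, zero_add]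
    have h4 := mul_le_mul_of_nonneg_left h3 hf
    have h5 := mul_le_mul_of_nonneg_right h2 hw
    nlinarith
  · have hg : 0 < g := (mul_nonneg (Real.exp_pos _).le hf).trans_lt (not_le.1 h1)
    have hf' : 0 < f := hg.trans (not_le.1 h2)
    have h3 := Real.add_one_le_exp (Real.log (f / g) - w)
    rw [sub_eq_add_neg, Real.exp_add, Real.exp_log (by positivity)] at h3
    rw [Real.exp_neg, Real.exp_log (by positivity), inv_div, mul_div_cancel₀ _ hf'.ne']
    have h4 := mul_le_mul_of_nonneg_left h3 hg.le
    have h5 : g * (f / g * Real.exp (-w)) = f * Real.exp (-w) := by field_simp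
    nlinarith

lemma measurable_clampLog {X : Type*} [MeasurableSpace X] (n : ℝ) {f g : X → ℝ}
    (hf : Measurable f) (hg : Measurable g) : Measurable fun x => clampLog n (f x) (g x) := by
  classical
  refine Measurable.ite (measurableSet_le hg (hf.const_mul _)) measurable_const ?_
  exact Measurable.ite (measurableSet_le hf hg) measurable_const (hf.div hg).log

/-- Where `f ≤ g`, decreasing `g` by a factor of at least `1 - ε` raises the clamped logarithm to at
most `-log (1 - ε)`. -/
lemma mul_clampLog_le {n f g g' ε : ℝ} (hf : 0 ≤ f) (hg : 0 ≤ g) (hε : 0 < ε) (hε1 : ε < 1)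
    (hfg : f ≤ g) (h : (1 - ε) * g ≤ g') : g * clampLog n f g' ≤ g * -Real.log (1 - ε) := by
  have hε' : 0 < 1 - ε := by linarith
  have hlog : Real.log (1 - ε) ≤ 0 := Real.log_nonpos hε'.le (by linarith)
  rcases hg.eq_or_lt with rfl | hg0
  · simp
  refine mul_le_mul_of_nonneg_left ?_ hg
  have hg'0 : 0 < g' := (mul_pos hε' hg0).trans_le h
  unfold clampLog
  split_ifs with h1 h2
  · have hf0 : 0 < f := by
      rcases hf.eq_or_lt with rfl | h0
      · rw [mul_zero] at h1; linarith
      · exact h0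
    have h2 : 1 - ε ≤ Real.exp (-n) := by
      refine le_of_mul_le_mul_right ?_ hf0
      exact (mul_le_mul_of_nonneg_left hfg hε'.le).trans (h.trans h1)
    have h3 := Real.log_le_log hε' h2
    rw [Real.log_exp] at h3
    linarith
  · linarith
  · have hf0 : 0 < f := hg'0.trans (not_le.1 h2)
    rw [← Real.log_inv]
    refine Real.log_le_log (by positivity) ?_
    rw [div_le_iff₀ hg'0, inv_mul_eq_div, le_div_iff₀ hε', mul_comm]
    exact (mul_le_mul_of_nonneg_left hfg hε'.le).trans h

lemma le_clampLog {n f g η : ℝ} (hf : 0 < f) (hη : 0 < η) (hηn : η ≤ n)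
    (h : g ≤ Real.exp (-η) * f) : η ≤ clampLog n f g := by
  unfold clampLog
  split_ifs with h1 h2
  · exact hηn
  · have h3 : Real.exp (-η) < 1 := by
      rw [← Real.exp_zero]; exact Real.exp_lt_exp.2 (by linarith)
    nlinarith
  · have hg : 0 < g := (mul_pos (Real.exp_pos _) hf).trans (not_le.1 h1)
    rw [Real.le_log_iff_exp_le (by positivity), le_div_iff₀ hg]
    have h3 := mul_le_mul_of_nonneg_left h (Real.exp_pos η).le
    rwa [← mul_assoc, ← Real.exp_add, add_neg_cancel, Real.exp_zero, one_mul] at h3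

lemma exists_nnreal_density {X : Type*} [MeasurableSpace X] {κ lam : Measure X}
    [IsFiniteMeasure κ] [IsFiniteMeasure lam]
    (h : κ ≪ lam) : ∃ f : X → ℝ≥0, Measurable f ∧ κ = lam.withDensity fun x => f x := by
  refine ⟨fun x => (κ.rnDeriv lam x).toNNReal,
    (Measure.measurable_rnDeriv _ _).ennreal_toNNReal, ?_⟩
  conv_lhs => rw [← Measure.withDensity_rnDeriv_eq κ lam h]
  refine withDensity_congr_ae ?_
  filter_upwards [Measure.rnDeriv_lt_top κ lam] with x hx
  exact (ENNReal.coe_toNNReal hx.ne).symm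

lemma lintegral_withDensity_ofReal {X : Type*} [MeasurableSpace X] {lam : Measure X}
    {f : X → ℝ≥0} (hf : Measurable f) {w : X → ℝ}
    (hw : Measurable w) : ∫⁻ x, ENNReal.ofReal (w x) ∂lam.withDensity (fun x => (f x : ℝ≥0∞)) =
      ∫⁻ x, ENNReal.ofReal (f x * w x) ∂lam := by
  rw [lintegral_withDensity_eq_lintegral_mul _ hf.coe_nnreal_ennreal hw.ennreal_ofReal]
  refine lintegral_congr fun x => ?_
  rw [ENNReal.ofReal_mul (NNReal.coe_nonneg _), ENNReal.ofReal_coe_nnreal, Pi.mul_apply]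

section DualEntropy

variable {X : Type*} [MetricSpace X] [MeasurableSpace X]

/-- The concave functional `ν ↦ inf_w (∫ w dν + ∫ exp (-w) dκ)`, the infimum being over bounded
continuous `w ≥ 0`. For a probability measure `ν ≤ κ` it equals `1 - Ent(ν | κ)`; densities above
`1` are not penalized. As an infimum of weakly continuous functions of `ν` it is upper
semicontinuous. -/
def dualEntropy (κ ν : Measure X) : ℝ≥0∞ :=
  ⨅ w : X →ᵇ ℝ≥0, ∫⁻ x, w x ∂ν + ∫⁻ x, ENNReal.ofReal (Real.exp (-(w x : ℝ))) ∂κ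

variable [BorelSpace X]

lemma upperSemicontinuous_dualEntropy (κ : Measure X) :
    UpperSemicontinuous fun ν : ProbabilityMeasure X => dualEntropy κ ν := by
  refine upperSemicontinuous_iInf fun w => Continuous.upperSemicontinuous ?_
  exact (ProbabilityMeasure.continuous_lintegral_boundedContinuousFunction w).add continuous_const

/-- Bounded measurable functions may be used as test functions. -/
lemma dualEntropy_le (κ ν : Measure X) [IsFiniteMeasure κ] [IsFiniteMeasure ν] {w : X → ℝ}
    (hw : Measurable w) {n : ℝ} (hw0 : ∀ x, 0 ≤ w x) (hwn : ∀ x, w x ≤ n) :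
    dualEntropy κ ν ≤
      ∫⁻ x, ENNReal.ofReal (w x) ∂ν + ∫⁻ x, ENNReal.ofReal (Real.exp (-w x)) ∂κ := by
  refine ENNReal.le_of_forall_pos_le_add fun δ hδ _ => ?_
  have hint : Integrable w (κ + ν) :=
    Integrable.of_bound hw.aestronglyMeasurable n (ae_of_all _ fun x => by
      rw [Real.norm_of_nonneg (hw0 x)]; exact hwn x)
  obtain ⟨v, hv, -⟩ := hint.exists_boundedContinuous_lintegral_sub_le
    (ε := δ) (by simpa using hδ.ne')
  rw [lintegral_add_measure, add_comm] at hv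
  refine (iInf_le _ v.nnrealPart).trans ?_
  have hm : Measurable fun x => ‖w x - v x‖ₑ := (hw.sub v.continuous.measurable).enorm
  have h1 : ∀ x, ((v.nnrealPart x : ℝ≥0) : ℝ) ≤ w x + |w x - v x| ∧
      w x ≤ ((v.nnrealPart x : ℝ≥0) : ℝ) + |w x - v x| := fun x => by
    have : ((v.nnrealPart x : ℝ≥0) : ℝ) = max (v x) 0 := rfl
    rw [this]
    refine ⟨?_, ?_⟩
    · refine max_le ?_ (add_nonneg (hw0 x) (abs_nonneg _))
      linarith [neg_abs_le (w x - v x)]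
    · linarith [le_abs_self (w x - v x), le_max_left (v x) 0]
  have h2 : ∫⁻ x, (v.nnrealPart x : ℝ≥0∞) ∂ν ≤
      ∫⁻ x, ENNReal.ofReal (w x) ∂ν + ∫⁻ x, ‖w x - v x‖ₑ ∂ν := by
    rw [← lintegral_add_right _ hm]
    refine lintegral_mono fun x => ?_
    rw [Real.enorm_eq_ofReal_abs, ← ENNReal.ofReal_add (hw0 x) (abs_nonneg _),
      ← ENNReal.ofReal_coe_nnreal]
    exact ENNReal.ofReal_le_ofReal (h1 x).1
  have h3 : ∫⁻ x, ENNReal.ofReal (Real.exp (-(v.nnrealPart x : ℝ))) ∂κ ≤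
      ∫⁻ x, ENNReal.ofReal (Real.exp (-w x)) ∂κ + ∫⁻ x, ‖w x - v x‖ₑ ∂κ := by
    rw [← lintegral_add_right _ hm]
    refine lintegral_mono fun x => ?_
    rw [Real.enorm_eq_ofReal_abs, ← ENNReal.ofReal_add (Real.exp_pos _).le (abs_nonneg _)]
    refine ENNReal.ofReal_le_ofReal ?_
    set V : ℝ := ((v.nnrealPart x : ℝ≥0) : ℝ) with hV
    have hV0 : 0 ≤ V := NNReal.coe_nonneg _
    have h4 := (h1 x).2
    have h5 : Real.exp (-V) ≤ 1 := Real.exp_le_one_iff.2 (by linarith)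
    have h6 : Real.exp (-w x) ≥ Real.exp (-V) * (V - w x + 1) := by
      have := mul_le_mul_of_nonneg_left (Real.add_one_le_exp (V - w x)) (Real.exp_pos (-V)).le
      rwa [← Real.exp_add, show -V + (V - w x) = -w x by ring] at this
    have h7 := Real.exp_pos (-V)
    have h8 := abs_nonneg (w x - v x)
    nlinarith
  calc _ ≤ (∫⁻ x, ENNReal.ofReal (w x) ∂ν + ∫⁻ x, ‖w x - v x‖ₑ ∂ν) +
        (∫⁻ x, ENNReal.ofReal (Real.exp (-w x)) ∂κ + ∫⁻ x, ‖w x - v x‖ₑ ∂κ) := add_le_add h2 h3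
    _ = (∫⁻ x, ENNReal.ofReal (w x) ∂ν + ∫⁻ x, ENNReal.ofReal (Real.exp (-w x)) ∂κ) +
        (∫⁻ x, ‖w x - v x‖ₑ ∂ν + ∫⁻ x, ‖w x - v x‖ₑ ∂κ) := by ring
    _ ≤ _ := add_le_add le_rfl hv

/-- Where the density of `ν` with respect to `κ` is at least `1`, mass may be removed at second
order cost. Moving a small fraction of that mass along `ν'` to the complement, where it is rewarded
at first order, increases the dual entropy. -/
lemma exists_dualEntropy_lt {lam : Measure X} [IsFiniteMeasure lam] {f g : X → ℝ≥0}
    (hf : Measurable f) (hg : Measurable g) (ν ν' : ProbabilityMeasure X) {κ : Measure X}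
    [IsFiniteMeasure κ] (hκ : κ = lam.withDensity fun x => f x)
    (hν : (ν : Measure X) = lam.withDensity fun x => g x) (hν' : (ν' : Measure X) ≪ lam)
    (hA0 : (ν : Measure X) {x | f x ≤ g x} ≠ 0)
    (hA : (ν' : Measure X) {x | f x ≤ g x}ᶜ ≠ 0) :
    ∃ ε : ℝ≥0∞, ε ≠ 0 ∧ ε ≤ 1 ∧ ∃ νε : ProbabilityMeasure X, (νε : Measure X) =
      (ν : Measure X).restrict {x | f x ≤ g x}ᶜ +
        (1 - ε) • (ν : Measure X).restrict {x | f x ≤ g x} +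
        (ε * (ν : Measure X) {x | f x ≤ g x}) • (ν' : Measure X) ∧
      dualEntropy κ ν < dualEntropy κ νε := by
  obtain ⟨k, hk, hνk⟩ := exists_nnreal_density hν'
  set A : Set X := {x | f x ≤ g x} with hAdef
  have hAm : MeasurableSet A := measurableSet_le hf hg
  set a : ℝ≥0∞ := (ν : Measure X) A with ha
  have ha1 : a ≤ 1 := prob_le_one
  have hat : a ≠ ⊤ := ne_top_of_le_ne_top ENNReal.one_ne_top ha1
  -- a set of positive `ν'`-measure on which the density ratio stays away from `1`
  let E : ℕ → Set X := fun j => {x | f x ≤ g x}ᶜ ∩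
    {x | (g x : ℝ) ≤ Real.exp (-(2 / (j + 1 : ℝ))) * f x ∧ (k x : ℝ) ≤ j * f x}
  have hEm : ∀ j, MeasurableSet (E j) := fun j => hAm.compl.inter
    ((measurableSet_le hg.coe_nnreal_real (hf.coe_nnreal_real.const_mul _)).inter
      (measurableSet_le hk.coe_nnreal_real (hf.coe_nnreal_real.const_mul _)))
  have hE : Aᶜ ⊆ ⋃ j, E j := by
    intro x hx
    have hlt : (g x : ℝ) < f x := by simpa [hAdef] using hx
    have hf0 : 0 < (f x : ℝ) := (NNReal.coe_nonneg _).trans_lt hlt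
    have h1 : Tendsto (fun j : ℕ => Real.exp (-(2 / (j + 1 : ℝ))) * f x) atTop (𝓝 (f x)) := by
      have h2 : Tendsto (fun j : ℕ => 2 / (j + 1 : ℝ)) atTop (𝓝 0) :=
        tendsto_const_div_atTop_nhds_zero_nat 2 |>.comp (tendsto_add_atTop_nat 1) |>.congr
          fun j => by simp
      have h3 := ((Real.continuous_exp.tendsto _).comp h2.neg).mul_const (f x : ℝ)
      simpa using h3
    have h2 : ∀ᶠ j : ℕ in atTop, (k x : ℝ) ≤ j * f x := by
      filter_upwards [eventually_ge_atTop ⌈(k x : ℝ) / f x⌉₊] with j hj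
      have := (Nat.le_ceil _).trans (Nat.cast_le (α := ℝ).2 hj)
      exact (div_le_iff₀ hf0).1 this
    obtain ⟨j, hj1, hj2⟩ := ((h1.eventually_const_lt hlt).and h2).exists
    exact mem_iUnion.2 ⟨j, hx, hj1.le, hj2⟩
  obtain ⟨j, hj⟩ : ∃ j, (ν' : Measure X) (E j) ≠ 0 := by
    by_contra! hcon
    exact hA (measure_mono_null hE (measure_iUnion_null hcon))
  set η : ℝ := 1 / (j + 1 : ℝ) with hη
  have hη0 : 0 < η := by positivity
  have h2η : 2 / (j + 1 : ℝ) = 2 * η := by rw [hη]; ring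
  set b : ℝ := ((ν' : Measure X) (E j)).toReal with hb
  have hbt : (ν' : Measure X) (E j) ≠ ⊤ := measure_ne_top _ _
  have hb0 : 0 < b := ENNReal.toReal_pos hj hbt
  have hexp : Real.exp (-(2 * η)) < Real.exp (-η) := Real.exp_lt_exp.2 (by linarith)
  -- the size of the perturbation
  obtain ⟨ε, hε0, hε1, hε2, hε3⟩ : ∃ ε : ℝ, 0 < ε ∧ ε < 1 ∧
      ε * j ≤ Real.exp (-η) - Real.exp (-(2 * η)) ∧ -Real.log (1 - ε) < η * b := by
    have h1 : Tendsto (fun ε : ℝ => ε * j) (𝓝[>] 0) (𝓝 0) := by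
      have : Tendsto (fun ε : ℝ => ε * j) (𝓝 0) (𝓝 (0 * j)) := tendsto_id.mul_const _
      rw [zero_mul] at this
      exact this.mono_left nhdsWithin_le_nhds
    have h2 : Tendsto (fun ε : ℝ => -Real.log (1 - ε)) (𝓝[>] 0) (𝓝 0) := by
      have h3 : ContinuousAt (fun ε : ℝ => -Real.log (1 - ε)) 0 :=
        ((continuousAt_const.sub continuousAt_id).log (by simp)).neg
      have h4 := h3.tendsto
      simp only [sub_zero, Real.log_one, neg_zero] at h4
      exact h4.mono_left nhdsWithin_le_nhds
    have h3 : ∀ᶠ ε : ℝ in 𝓝[>] 0, ε ∈ Ioo (0 : ℝ) 1 := Ioo_mem_nhdsGT one_pos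
    obtain ⟨ε, e1, e2, e3⟩ := (h3.and ((h1.eventually_le_const (sub_pos.2 hexp)).and
      (h2.eventually_lt_const (mul_pos hη0 hb0)))).exists
    exact ⟨ε, e1.1, e1.2, e2, e3⟩
  set e : ℝ≥0 := ⟨ε, hε0.le⟩ with he
  have he1 : (e : ℝ≥0∞) ≤ 1 := by exact_mod_cast (show e ≤ 1 from hε1.le)
  have hadd : (1 - (e : ℝ≥0∞)) + e = 1 := tsub_add_cancel_of_le he1
  set a' : ℝ≥0 := a.toNNReal with ha'
  have haa : (a' : ℝ≥0∞) = a := ENNReal.coe_toNNReal hat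
  have ha'1 : (a' : ℝ) ≤ 1 := by
    have : a' ≤ 1 := by exact_mod_cast haa.trans_le ha1
    exact_mod_cast this
  set νε : Measure X := (ν : Measure X).restrict Aᶜ +
    (1 - (e : ℝ≥0∞)) • (ν : Measure X).restrict A + ((e : ℝ≥0∞) * a) • (ν' : Measure X) with hνε
  have hbal : νε + (e : ℝ≥0∞) • (ν : Measure X).restrict A =
      (ν : Measure X) + ((e : ℝ≥0∞) * a) • (ν' : Measure X) := by
    calc _ = ((ν : Measure X).restrict Aᶜ + ((1 - (e : ℝ≥0∞)) • (ν : Measure X).restrict A +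
          (e : ℝ≥0∞) • (ν : Measure X).restrict A)) + ((e : ℝ≥0∞) * a) • (ν' : Measure X) := by
          rw [hνε]; abel
      _ = _ := by
          rw [← add_smul, hadd, one_smul, add_comm (Measure.restrict _ _),
            Measure.restrict_add_restrict_compl hAm]
  have hprob : IsProbabilityMeasure νε := ⟨by
    have h1 := congrArg (fun κ : Measure X => κ univ) hbal
    simp only [Measure.add_apply, Measure.smul_apply, Measure.restrict_apply_univ, measure_univ,
      smul_eq_mul, mul_one, ← ha] at h1
    exact (ENNReal.add_left_inj (ENNReal.mul_ne_top ENNReal.coe_ne_top hat)).1 h1⟩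
  refine ⟨e, by exact_mod_cast (show e ≠ 0 from fun h => hε0.ne' (congrArg NNReal.toReal h)), he1,
    ⟨νε, hprob⟩, rfl, ?_⟩
  -- the density of the perturbation
  let gε : X → ℝ≥0 := fun x => Aᶜ.indicator g x + (1 - e) * A.indicator g x + e * a' * k x
  have hgε : Measurable gε :=
    ((hg.indicator hAm.compl).add ((hg.indicator hAm).const_mul _)).add (hk.const_mul _)
  have hνεd : νε = lam.withDensity fun x => gε x := by
    have h1 : ∀ S : Set X, MeasurableSet S → (ν : Measure X).restrict S =
        lam.withDensity fun x => ((S.indicator g x : ℝ≥0) : ℝ≥0∞) := fun S hS => by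
      rw [hν, restrict_withDensity hS, ← withDensity_indicator hS]
      congr 1
      ext x
      by_cases hx : x ∈ S <;> simp [hx]
    rw [hνε, h1 _ hAm.compl, h1 _ hAm, hνk, ← haa,
      ← withDensity_smul _ (hg.indicator hAm).coe_nnreal_ennreal,
      ← withDensity_smul _ hk.coe_nnreal_ennreal,
      ← withDensity_add_left (hg.indicator hAm.compl).coe_nnreal_ennreal,
      ← withDensity_add_left]
    · congr 1
    · exact (hg.indicator hAm.compl).coe_nnreal_ennreal.add
        ((hg.indicator hAm).coe_nnreal_ennreal.const_smul _)
  have hcoe : (e : ℝ) = ε := rfl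
  have hcoe1 : ((1 - e : ℝ≥0) : ℝ) = 1 - ε := by
    rw [NNReal.coe_sub (show e ≤ 1 from hε1.le)]; rfl
  have hgεA : ∀ x ∈ A, (1 - ε) * (g x : ℝ) ≤ gε x := fun x hx => by
    have h1 : (gε x : ℝ) = (1 - ε) * g x + e * a' * k x := by
      simp [gε, hx, hcoe1]
    rw [h1]
    have : (0 : ℝ) ≤ e * a' * k x := by positivity
    linarith
  have hgεE : ∀ x ∈ E j, 0 < (f x : ℝ) ∧ (gε x : ℝ) ≤ Real.exp (-η) * f x := fun x hx => by
    obtain ⟨hx1, hx2, hx3⟩ := hx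
    have hxA : x ∉ A := hx1
    have hlt : (g x : ℝ) < f x := by simpa [hAdef] using hxA
    have hf0 : 0 < (f x : ℝ) := (NNReal.coe_nonneg _).trans_lt hlt
    have h1 : (gε x : ℝ) = g x + ε * a' * k x := by
      simp [gε, hxA, hcoe]
    refine ⟨hf0, ?_⟩
    rw [h1]
    rw [h2η] at hx2
    have h3 : ε * a' * k x ≤ ε * (j * f x) := by
      calc ε * a' * k x ≤ ε * 1 * k x := by gcongr
        _ ≤ _ := by rw [mul_one]; gcongr
    have h4 := mul_le_mul_of_nonneg_right hε2 hf0.le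
    nlinarith
  -- comparison of the test functions
  have hL0 : 0 ≤ -Real.log (1 - ε) := by
    linarith [Real.log_nonpos (show (0 : ℝ) ≤ 1 - ε by linarith) (by linarith)]
  -- replace a test function for the perturbation by the optimal one, and use that one for `ν`
  have key : ∀ w : X →ᵇ ℝ≥0, dualEntropy κ ν + (e : ℝ≥0∞) * a * ENNReal.ofReal (η * b) ≤
      (∫⁻ x, w x ∂νε + ∫⁻ x, ENNReal.ofReal (Real.exp (-(w x : ℝ))) ∂κ) +
        (e : ℝ≥0∞) * a * ENNReal.ofReal (-Real.log (1 - ε)) := by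
    intro w
    obtain ⟨n, hηn, hwn⟩ : ∃ n : ℝ, η ≤ n ∧ ∀ x, (w x : ℝ) ≤ n := by
      obtain ⟨B, hB⟩ := w.isBounded_range.bddAbove
      exact ⟨max η B, le_max_left _ _, fun x => le_max_of_le_right
        (by exact_mod_cast hB (mem_range_self x))⟩
    have hn0 : 0 ≤ n := hη0.le.trans hηn
    let v : X → ℝ := fun x => clampLog n (f x) (gε x)
    have hv : Measurable v := measurable_clampLog n hf.coe_nnreal_real hgε.coe_nnreal_real
    have hv0 : ∀ x, 0 ≤ v x := fun x => clampLog_nonneg hn0 (NNReal.coe_nonneg _)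
    have hvn : ∀ x, v x ≤ n := fun x => clampLog_le hn0 (NNReal.coe_nonneg _)
    have hstep1 : ∫⁻ x, ENNReal.ofReal (v x) ∂νε + ∫⁻ x, ENNReal.ofReal (Real.exp (-v x)) ∂κ ≤
        ∫⁻ x, w x ∂νε + ∫⁻ x, ENNReal.ofReal (Real.exp (-(w x : ℝ))) ∂κ := by
      have hwm : Measurable fun x => (w x : ℝ) := w.continuous.measurable.coe_nnreal_real
      have hgv : Measurable fun x => (gε x : ℝ) * v x := hgε.coe_nnreal_real.mul hv
      have hgw : Measurable fun x => (gε x : ℝ) * (w x : ℝ) := hgε.coe_nnreal_real.mul hwm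
      have hve : Measurable fun x => Real.exp (-v x) := hv.neg.exp
      have hwe : Measurable fun x => Real.exp (-(w x : ℝ)) := hwm.neg.exp
      have h1 : ∫⁻ x, (w x : ℝ≥0∞) ∂νε = ∫⁻ x, ENNReal.ofReal (w x : ℝ) ∂νε := by simp
      rw [h1, hνεd, hκ, lintegral_withDensity_ofReal hgε hv, lintegral_withDensity_ofReal hgε hwm,
        lintegral_withDensity_ofReal hf hve, lintegral_withDensity_ofReal hf hwe,
        ← lintegral_add_left hgv.ennreal_ofReal, ← lintegral_add_left hgw.ennreal_ofReal]
      refine lintegral_mono fun x => ?_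
      have hv0x := hv0 x
      rw [← ENNReal.ofReal_add (by positivity) (by positivity),
        ← ENNReal.ofReal_add (by positivity) (by positivity)]
      exact ENNReal.ofReal_le_ofReal
        (clampLog_min (NNReal.coe_nonneg _) (NNReal.coe_nonneg _) (hwn x))
    have hstep2 : dualEntropy κ ν ≤
        ∫⁻ x, ENNReal.ofReal (v x) ∂(ν : Measure X) + ∫⁻ x, ENNReal.ofReal (Real.exp (-v x)) ∂κ :=
      dualEntropy_le κ ν hv hv0 hvn
    have hstep3 : ∫⁻ x, ENNReal.ofReal (v x) ∂νε +
        (e : ℝ≥0∞) * ∫⁻ x in A, ENNReal.ofReal (v x) ∂(ν : Measure X) =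
        ∫⁻ x, ENNReal.ofReal (v x) ∂(ν : Measure X) +
          (e : ℝ≥0∞) * a * ∫⁻ x, ENNReal.ofReal (v x) ∂(ν' : Measure X) := by
      have h1 := congrArg (fun χ : Measure X => ∫⁻ x, ENNReal.ofReal (v x) ∂χ) hbal
      simpa only [lintegral_add_measure, lintegral_smul_measure, smul_eq_mul] using h1
    have hstep4 : ∫⁻ x in A, ENNReal.ofReal (v x) ∂(ν : Measure X) ≤
        a * ENNReal.ofReal (-Real.log (1 - ε)) := by
      have h1 : a * ENNReal.ofReal (-Real.log (1 - ε)) =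
          ∫⁻ _ in A, ENNReal.ofReal (-Real.log (1 - ε)) ∂(ν : Measure X) := by
        rw [setLIntegral_const, mul_comm]
      rw [h1, hν, restrict_withDensity hAm, lintegral_withDensity_ofReal hg hv,
        lintegral_withDensity_ofReal hg measurable_const]
      refine setLIntegral_mono' hAm fun x hx => ENNReal.ofReal_le_ofReal ?_
      exact mul_clampLog_le (NNReal.coe_nonneg _) (NNReal.coe_nonneg _) hε0 hε1
        (NNReal.coe_le_coe.2 hx) (hgεA x hx)
    have hstep5 : ENNReal.ofReal (η * b) ≤ ∫⁻ x, ENNReal.ofReal (v x) ∂(ν' : Measure X) := by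
      calc ENNReal.ofReal (η * b) = ∫⁻ _ in E j, ENNReal.ofReal η ∂(ν' : Measure X) := by
            rw [setLIntegral_const, ENNReal.ofReal_mul hη0.le, hb, ENNReal.ofReal_toReal hbt]
        _ ≤ ∫⁻ x in E j, ENNReal.ofReal (v x) ∂(ν' : Measure X) :=
            setLIntegral_mono' (hEm j) fun x hx => ENNReal.ofReal_le_ofReal
              (le_clampLog (hgεE x hx).1 hη0 hηn (hgεE x hx).2)
        _ ≤ _ := setLIntegral_le_lintegral _ _
    calc _ ≤ (∫⁻ x, ENNReal.ofReal (v x) ∂(ν : Measure X) +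
          ∫⁻ x, ENNReal.ofReal (Real.exp (-v x)) ∂κ) +
          (e : ℝ≥0∞) * a * ∫⁻ x, ENNReal.ofReal (v x) ∂(ν' : Measure X) := by gcongr
      _ = (∫⁻ x, ENNReal.ofReal (v x) ∂νε + ∫⁻ x, ENNReal.ofReal (Real.exp (-v x)) ∂κ) +
          (e : ℝ≥0∞) * ∫⁻ x in A, ENNReal.ofReal (v x) ∂(ν : Measure X) := by
          rw [add_right_comm, ← hstep3, add_right_comm]
      _ ≤ _ := by
          rw [mul_assoc]
          gcongr
  have hfin : dualEntropy κ νε ≠ ⊤ := by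
    refine ne_top_of_le_ne_top ?_ (iInf_le _ (0 : X →ᵇ ℝ≥0))
    simp
  have hfinal : dualEntropy κ ν + (e : ℝ≥0∞) * a * ENNReal.ofReal (η * b) ≤
      dualEntropy κ νε + (e : ℝ≥0∞) * a * ENNReal.ofReal (-Real.log (1 - ε)) := by
    conv_rhs => rw [dualEntropy, ENNReal.iInf_add]
    exact le_iInf key
  have hea : (e : ℝ≥0∞) * a ≠ 0 := mul_ne_zero
    (by exact_mod_cast (show e ≠ 0 from fun h => hε0.ne' (congrArg NNReal.toReal h))) hA0
  have heat : (e : ℝ≥0∞) * a ≠ ⊤ := ENNReal.mul_ne_top ENNReal.coe_ne_top hat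
  have hstrict : (e : ℝ≥0∞) * a * ENNReal.ofReal (-Real.log (1 - ε)) <
      (e : ℝ≥0∞) * a * ENNReal.ofReal (η * b) := by
    refine (ENNReal.mul_lt_mul_iff_right hea heat).2 ?_
    exact (ENNReal.ofReal_lt_ofReal_iff (by positivity)).2 hε3
  by_contra! hcon
  have h1 := hfinal.trans (add_le_add_left hcon _)
  have hfinν : dualEntropy κ ν ≠ ⊤ := by
    refine ne_top_of_le_ne_top ?_ (iInf_le _ (0 : X →ᵇ ℝ≥0))
    simp
  exact absurd ((ENNReal.add_le_add_iff_left hfinν).1 h1) (not_le.2 hstrict)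

end DualEntropy

/-! ### Entropy of measures on sets of finite reference measure -/

lemma Real.sub_one_le_mul_log {r : ℝ} (hr : 0 ≤ r) : r - 1 ≤ r * Real.log r := by
  rcases hr.eq_or_lt with rfl | h0
  · simp
  have h1 := Real.one_sub_inv_le_log_of_pos h0
  have h2 := mul_le_mul_of_nonneg_left h1 h0.le
  rwa [mul_sub, mul_one, mul_inv_cancel₀ h0.ne'] at h2

section RelEntropy

variable {X : Type*} [MeasurableSpace X] {m : Measure X} {ν : ProbabilityMeasure X} {J : Set X}

variable (m ν) in
/-- The density of `ν` with respect to `m`, as a real function. -/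
def realDensity (x : X) : ℝ := ((ν : Measure X).rnDeriv m x).toReal

lemma realDensity_nonneg (x : X) : 0 ≤ realDensity m ν x := ENNReal.toReal_nonneg

lemma measurable_realDensity : Measurable (realDensity m ν) :=
  (Measure.measurable_rnDeriv _ _).ennreal_toReal

lemma measurable_realDensity_mul_log :
    Measurable fun x => realDensity m ν x * Real.log (realDensity m ν x) :=
  measurable_realDensity.mul measurable_realDensity.log

lemma relEntropy_eq_integral (h : (ν : Measure X) ≪ m)
    (hint : Integrable (fun x => realDensity m ν x * Real.log (realDensity m ν x)) m) :
    relEntropy m ν =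
      ((∫ x, realDensity m ν x * Real.log (realDensity m ν x) ∂m : ℝ) : EReal) := by
  have h1 : ∫⁻ x, ENNReal.ofReal (realDensity m ν x * Real.log (realDensity m ν x)) ∂m ≠ ⊤ :=
    hint.lintegral_lt_top.ne
  have h2 : ∫⁻ x, ENNReal.ofReal (-(realDensity m ν x * Real.log (realDensity m ν x))) ∂m ≠ ⊤ :=
    hint.neg.lintegral_lt_top.ne
  rw [integral_eq_lintegral_pos_part_sub_lintegral_neg_part hint, EReal.coe_sub,
    EReal.coe_ennreal_toReal h1, EReal.coe_ennreal_toReal h2]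
  exact if_pos ⟨h, h1.lt_top⟩

lemma ae_realDensity_eq_zero (hJ : MeasurableSet J) (hνJ : (ν : Measure X) Jᶜ = 0) :
    ∀ᵐ x ∂m, x ∉ J → realDensity m ν x = 0 := by
  have h1 : ∫⁻ x in Jᶜ, (ν : Measure X).rnDeriv m x ∂m = 0 :=
    le_antisymm ((Measure.setLIntegral_rnDeriv_le _).trans hνJ.le) zero_le
  rw [lintegral_eq_zero_iff (Measure.measurable_rnDeriv _ _)] at h1
  have h2 := (ae_restrict_iff' hJ.compl).1 h1
  filter_upwards [h2] with x hx hxJ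
  rw [realDensity, hx hxJ]
  rfl

lemma integrable_realDensity : Integrable (realDensity m ν) m :=
  Measure.integrable_toReal_rnDeriv

lemma absolutelyContinuous_of_relEntropy_ne_top (h : relEntropy m ν ≠ ⊤) : (ν : Measure X) ≪ m := by
  by_contra hcon
  exact h (if_neg fun h' => hcon h'.1)

/-- On a set of finite reference measure, `r log r ≥ -1` makes the negative part of the entropy
harmless. -/
lemma integrable_of_relEntropy_ne_top (hJ : MeasurableSet J) (hmJ : m J ≠ ⊤)
    (hνJ : (ν : Measure X) Jᶜ = 0) (h : relEntropy m ν ≠ ⊤) :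
    Integrable (fun x => realDensity m ν x * Real.log (realDensity m ν x)) m := by
  have hpos : ∫⁻ x, ENNReal.ofReal (realDensity m ν x * Real.log (realDensity m ν x)) ∂m < ⊤ := by
    by_contra hcon
    exact h (if_neg fun h' => hcon h'.2)
  have hneg : ∫⁻ x, ENNReal.ofReal (-(realDensity m ν x * Real.log (realDensity m ν x))) ∂m ≤
      m J := by
    rw [← lintegral_indicator_one hJ]
    refine lintegral_mono_ae ?_
    filter_upwards [ae_realDensity_eq_zero hJ hνJ] with x hx
    by_cases hxJ : x ∈ J
    · simp only [hxJ, indicator_of_mem, Pi.one_apply, ENNReal.ofReal_le_one]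
      linarith [Real.sub_one_le_mul_log (realDensity_nonneg (m := m) (ν := ν) x),
        realDensity_nonneg (m := m) (ν := ν) x]
    · simp [hx hxJ]
  refine ⟨measurable_realDensity_mul_log.aestronglyMeasurable, ?_⟩
  rw [hasFiniteIntegral_iff_enorm]
  have hle : ∀ t : ℝ, ‖t‖ₑ ≤ ENNReal.ofReal t + ENNReal.ofReal (-t) := fun t => by
    rw [Real.enorm_eq_ofReal_abs]
    rcases le_total 0 t with ht | ht
    · rw [abs_of_nonneg ht]; exact le_self_add
    · rw [abs_of_nonpos ht]; exact le_add_self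
  refine (lintegral_mono fun x => hle _).trans_lt ?_
  rw [lintegral_add_left measurable_realDensity_mul_log.ennreal_ofReal]
  exact ENNReal.add_lt_top.2 ⟨hpos, hneg.trans_lt hmJ.lt_top⟩

variable [SigmaFinite m]

lemma integral_realDensity (h : (ν : Measure X) ≪ m) : ∫ x, realDensity m ν x ∂m = 1 := by
  have := Measure.integral_toReal_rnDeriv h
  simpa [realDensity] using this

lemma ae_realDensity_le {C : ℝ} (hC : 0 ≤ C) (h : (ν : Measure X) ≤ ENNReal.ofReal C • m) :
    ∀ᵐ x ∂m, realDensity m ν x ≤ C := by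
  have h1 : (ν : Measure X).rnDeriv m ≤ᵐ[m] fun _ => ENNReal.ofReal C := by
    refine ae_le_of_forall_setLIntegral_le_of_sigmaFinite (Measure.measurable_rnDeriv _ _)
      fun s hs _ => ?_
    rw [setLIntegral_const]
    exact (Measure.setLIntegral_rnDeriv_le s).trans (h s)
  filter_upwards [h1] with x hx
  exact ENNReal.toReal_le_of_le_ofReal hC hx

lemma integrable_of_le (hJ : MeasurableSet J) (hmJ : m J ≠ ⊤)
    (hνJ : (ν : Measure X) Jᶜ = 0) {C : ℝ} (hC : 0 ≤ C)
    (h : (ν : Measure X) ≤ ENNReal.ofReal C • m) :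
    Integrable (fun x => realDensity m ν x * Real.log (realDensity m ν x)) m := by
  have hbd : Integrable (J.indicator fun _ => C ^ 2 + 1) m :=
    (integrable_indicator_iff hJ).2 (integrableOn_const hmJ)
  refine hbd.mono' measurable_realDensity_mul_log.aestronglyMeasurable ?_
  filter_upwards [ae_realDensity_eq_zero hJ hνJ, ae_realDensity_le hC h] with x hx hx'
  by_cases hxJ : x ∈ J
  · rw [indicator_of_mem hxJ, Real.norm_eq_abs, abs_le]
    have h0 := realDensity_nonneg (m := m) (ν := ν) x
    have h1 := Real.sub_one_le_mul_log h0
    have h2 := mul_le_mul_of_nonneg_left (Real.log_le_self h0) h0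
    constructor <;> nlinarith
  · simp [hx hxJ, indicator_of_notMem hxJ]

variable {C : ℝ}

lemma mul_add_mul_exp_ge {r w : ℝ} (hr : 0 ≤ r) (hC : 0 < C) :
    r * (1 + Real.log C) - r * Real.log r ≤ r * w + C * Real.exp (-w) := by
  rcases hr.eq_or_lt with rfl | h0
  · simp only [zero_mul, sub_zero, zero_add]
    positivity
  have h3 := Real.add_one_le_exp (Real.log (C / r) - w)
  rw [sub_eq_add_neg, Real.exp_add, Real.exp_log (by positivity),
    Real.log_div hC.ne' h0.ne'] at h3
  have h4 := mul_le_mul_of_nonneg_left h3 h0.le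
  have h5 : r * (C / r * Real.exp (-w)) = C * Real.exp (-w) := by field_simp
  nlinarith

lemma lintegral_ofReal_eq (h : (ν : Measure X) ≪ m) (hJ : MeasurableSet J)
    (hνJ : (ν : Measure X) Jᶜ = 0) {w : X → ℝ} (hw : Measurable w) :
    ∫⁻ x, ENNReal.ofReal (w x) ∂(ν : Measure X) =
      ∫⁻ x in J, ENNReal.ofReal (realDensity m ν x * w x) ∂m := by
  rw [← Measure.restrict_eq_self_of_ae_mem (s := J) (μ := (ν : Measure X))
    (mem_ae_iff.2 hνJ), ← setLIntegral_rnDeriv_mul h hw.ennreal_ofReal.aemeasurable hJ]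
  refine lintegral_congr_ae (ae_restrict_of_ae ?_)
  filter_upwards [Measure.rnDeriv_lt_top (ν : Measure X) m] with x hx
  rw [ENNReal.ofReal_mul (realDensity_nonneg x), realDensity, ENNReal.ofReal_toReal hx.ne]

lemma setIntegral_eq (h : (ν : Measure X) ≪ m) (hJ : MeasurableSet J)
    (hνJ : (ν : Measure X) Jᶜ = 0)
    (hint : Integrable (fun x => realDensity m ν x * Real.log (realDensity m ν x)) m) :
    ∫ x in J, (realDensity m ν x * (1 + Real.log C) -
        realDensity m ν x * Real.log (realDensity m ν x)) ∂m =
      1 + Real.log C - ∫ x, realDensity m ν x * Real.log (realDensity m ν x) ∂m := by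
  rw [setIntegral_eq_integral_of_ae_compl_eq_zero, integral_sub
    (integrable_realDensity.mul_const _) hint, integral_mul_const, integral_realDensity h, one_mul]
  filter_upwards [ae_realDensity_eq_zero hJ hνJ] with x hx hxJ
  simp [hx hxJ]

end RelEntropy

section RelEntropyDual

variable {X : Type*} [MetricSpace X] [MeasurableSpace X] {m : Measure X} {ν : ProbabilityMeasure X}
  {J : Set X} [SigmaFinite m] {C : ℝ}

/-- The entropy controls the dual entropy from below. -/
lemma ofReal_le_dualEntropy [BorelSpace X] (hJ : MeasurableSet J) (hνJ : (ν : Measure X) Jᶜ = 0)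
    (hC : 0 < C) (h : (ν : Measure X) ≪ m)
    (hint : Integrable (fun x => realDensity m ν x * Real.log (realDensity m ν x)) m) :
    ENNReal.ofReal (1 + Real.log C -
      ∫ x, realDensity m ν x * Real.log (realDensity m ν x) ∂m) ≤
      dualEntropy (ENNReal.ofReal C • m.restrict J) ν := by
  refine le_iInf fun w => ?_
  have hwm : Measurable fun x => (w x : ℝ) := w.continuous.measurable.coe_nnreal_real
  have hrw : Measurable fun x => realDensity m ν x * (w x : ℝ) := measurable_realDensity.mul hwm
  have h1 : ∫⁻ x, (w x : ℝ≥0∞) ∂(ν : Measure X) =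
      ∫⁻ x, ENNReal.ofReal (w x : ℝ) ∂(ν : Measure X) := by simp
  have hI : IntegrableOn (fun x => realDensity m ν x * (1 + Real.log C) -
      realDensity m ν x * Real.log (realDensity m ν x)) J m :=
    ((integrable_realDensity.mul_const _).sub hint).integrableOn
  rw [h1, lintegral_ofReal_eq h hJ hνJ hwm, lintegral_smul_measure, smul_eq_mul,
    ← lintegral_const_mul' _ _ ENNReal.ofReal_ne_top, ← lintegral_add_left hrw.ennreal_ofReal,
    ← setIntegral_eq h hJ hνJ hint]
  calc _ ≤ ENNReal.ofReal (∫ x in J, max (realDensity m ν x * (1 + Real.log C) -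
          realDensity m ν x * Real.log (realDensity m ν x)) 0 ∂m) :=
        ENNReal.ofReal_le_ofReal (integral_mono hI hI.pos_part fun x => le_max_left _ _)
    _ = ∫⁻ x in J, ENNReal.ofReal (max (realDensity m ν x * (1 + Real.log C) -
          realDensity m ν x * Real.log (realDensity m ν x)) 0) ∂m :=
        ofReal_integral_eq_lintegral_ofReal hI.pos_part (ae_of_all _ fun x => le_max_right _ _)
    _ ≤ _ := by
        refine lintegral_mono fun x => ?_
        have h2 : 0 ≤ realDensity m ν x * (w x : ℝ) :=
          mul_nonneg (realDensity_nonneg x) (NNReal.coe_nonneg _)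
        rw [← ENNReal.ofReal_mul hC.le, ← ENNReal.ofReal_add h2 (by positivity)]
        refine ENNReal.ofReal_le_ofReal (max_le (mul_add_mul_exp_ge (realDensity_nonneg x) hC) ?_)
        positivity

/-- For densities below `C`, the entropy is determined by the dual entropy. -/
lemma dualEntropy_le_ofReal [BorelSpace X] (hJ : MeasurableSet J) (hmJ : m J ≠ ⊤)
    (hνJ : (ν : Measure X) Jᶜ = 0) (hC : 0 < C) (h : (ν : Measure X) ≤ ENNReal.ofReal C • m) :
    0 ≤ 1 + Real.log C - ∫ x, realDensity m ν x * Real.log (realDensity m ν x) ∂m ∧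
    dualEntropy (ENNReal.ofReal C • m.restrict J) ν ≤ ENNReal.ofReal (1 + Real.log C -
      ∫ x, realDensity m ν x * Real.log (realDensity m ν x) ∂m) := by
  have hac : (ν : Measure X) ≪ m :=
    (Measure.absolutelyContinuous_of_le h).trans (Measure.smul_absolutelyContinuous)
  have hint := integrable_of_le hJ hmJ hνJ hC.le h
  have hI : IntegrableOn (fun x => realDensity m ν x * (1 + Real.log C) -
      realDensity m ν x * Real.log (realDensity m ν x)) J m :=
    ((integrable_realDensity.mul_const _).sub hint).integrableOn
  have hnn : ∀ᵐ x ∂m, 0 ≤ realDensity m ν x * (1 + Real.log C) -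
      realDensity m ν x * Real.log (realDensity m ν x) := by
    filter_upwards [ae_realDensity_le hC.le h] with x hx
    have h0 := realDensity_nonneg (m := m) (ν := ν) x
    rcases h0.eq_or_lt with h1 | h1
    · rw [← h1]; simp
    · have h2 := mul_le_mul_of_nonneg_left (Real.log_le_log h1 hx) h0
      nlinarith
  have hfin : IsFiniteMeasure (m.restrict J) := ⟨by
    rw [Measure.restrict_apply_univ]; exact hmJ.lt_top⟩
  have hfin' : IsFiniteMeasure (ENNReal.ofReal C • m.restrict J) :=
    Measure.smul_finite _ ENNReal.ofReal_ne_top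
  rw [← setIntegral_eq hac hJ hνJ hint]
  refine ⟨integral_nonneg_of_ae (ae_restrict_of_ae hnn), ?_⟩
  rw [ofReal_integral_eq_lintegral_ofReal hI (ae_restrict_of_ae hnn)]
  have hlim : Tendsto (fun n : ℕ => ∫⁻ x in J, ENNReal.ofReal (realDensity m ν x *
      (1 + Real.log C) - realDensity m ν x * Real.log (realDensity m ν x)) ∂m +
      ENNReal.ofReal (C * Real.exp (-(n : ℝ))) * m J) atTop
      (𝓝 (∫⁻ x in J, ENNReal.ofReal (realDensity m ν x *
      (1 + Real.log C) - realDensity m ν x * Real.log (realDensity m ν x)) ∂m + 0)) := by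
    refine tendsto_const_nhds.add ?_
    have h1 : Tendsto (fun n : ℕ => C * Real.exp (-(n : ℝ))) atTop (𝓝 (C * 0)) :=
      (Real.tendsto_exp_neg_atTop_nhds_zero.comp tendsto_natCast_atTop_atTop).const_mul C
    have h2 := ENNReal.Tendsto.mul_const (ENNReal.tendsto_ofReal h1) (Or.inr hmJ)
    simpa using h2
  rw [add_zero] at hlim
  refine ge_of_tendsto' hlim fun n => ?_
  let v : X → ℝ := fun x => clampLog n C (realDensity m ν x)
  have hv : Measurable v := measurable_clampLog n measurable_const measurable_realDensity
  have hv0 : ∀ x, 0 ≤ v x := fun x => clampLog_nonneg n.cast_nonneg hC.le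
  refine (dualEntropy_le _ _ hv hv0 fun x => clampLog_le n.cast_nonneg hC.le).trans ?_
  have hrv : Measurable fun x => realDensity m ν x * v x := measurable_realDensity.mul hv
  rw [lintegral_ofReal_eq hac hJ hνJ hv, lintegral_smul_measure, smul_eq_mul,
    ← lintegral_const_mul' _ _ ENNReal.ofReal_ne_top, ← lintegral_add_left hrv.ennreal_ofReal,
    ← setLIntegral_const, ← lintegral_add_right _ measurable_const]
  refine lintegral_mono_ae (ae_restrict_of_ae ?_)
  filter_upwards [ae_realDensity_le hC.le h, hnn] with x hx hnnx
  have h0 := realDensity_nonneg (m := m) (ν := ν) x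
  have hv0x := hv0 x
  rw [← ENNReal.ofReal_mul hC.le, ← ENNReal.ofReal_add (mul_nonneg h0 hv0x) (by positivity),
    ← ENNReal.ofReal_add hnnx (by positivity)]
  refine ENNReal.ofReal_le_ofReal ?_
  set r := realDensity m ν x
  have he : 0 < C * Real.exp (-(n : ℝ)) := by positivity
  change r * clampLog n C r + C * Real.exp (-clampLog n C r) ≤ _
  unfold clampLog
  split_ifs with h1 h2
  · rcases h0.eq_or_lt with h3 | h3
    · rw [← h3]; simp
    · have h4 := Real.log_le_log h3 h1
      rw [Real.log_mul (Real.exp_pos _).ne' hC.ne', Real.log_exp] at h4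
      have h5 := mul_le_mul_of_nonneg_left h4 h0
      nlinarith
  · have h3 : r = C := le_antisymm hx h2
    rw [h3]
    simp only [mul_zero, neg_zero, Real.exp_zero, mul_one, zero_add]
    nlinarith
  · have hr : 0 < r := (mul_nonneg (Real.exp_pos _).le hC.le).trans_lt (not_le.1 h1)
    rw [Real.exp_neg, Real.exp_log (by positivity), inv_div, mul_div_cancel₀ _ hC.ne',
      Real.log_div hC.ne' hr.ne']
    nlinarith

end RelEntropyDual

section ExpFunctional

variable {X : Type*} [MeasurableSpace X] {m : Measure X} {ν : ProbabilityMeasure X} {J : Set X}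
  {N : ℝ}

lemma expFunctional_eq {E : ProbabilityMeasure X → EReal} {e : ℝ} (h : E ν = e) :
    expFunctional E N ν = ENNReal.ofReal (Real.exp (-e / N)) := by
  rw [expFunctional, h, ← EReal.coe_neg, ← EReal.coe_div, EReal.exp_coe]

lemma ne_top_of_expFunctional_ne_zero {E : ProbabilityMeasure X → EReal} (hN : 0 < N)
    (h : expFunctional E N ν ≠ 0) : E ν ≠ ⊤ := by
  intro htop
  refine h ?_
  rw [expFunctional, htop, EReal.neg_top, EReal.bot_div_of_pos_ne_top (by exact_mod_cast hN)
    (EReal.coe_ne_top _), EReal.exp_bot]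

lemma rpow_neg_inv_eq {B : ℝ} (hB : 0 < B) : B ^ (-1 / N) = Real.exp (-Real.log B / N) := by
  rw [Real.rpow_def_of_pos hB]
  ring_nf

lemma absolutelyContinuous_of_le_smul {C : ℝ≥0∞} (h : (ν : Measure X) ≤ C • m) :
    (ν : Measure X) ≪ m :=
  (Measure.absolutelyContinuous_of_le h).trans Measure.smul_absolutelyContinuous

variable [SigmaFinite m]

/-- A density bound bounds the entropy. -/
lemma ofReal_rpow_le_expFunctional (hN : 0 < N) (hJ : MeasurableSet J) (hmJ : m J ≠ ⊤)
    (hνJ : (ν : Measure X) Jᶜ = 0) {B : ℝ} (hB : 0 < B)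
    (h : (ν : Measure X) ≤ ENNReal.ofReal B • m) :
    ENNReal.ofReal (B ^ (-1 / N)) ≤ expFunctional (relEntropy m) N ν := by
  have hac := absolutelyContinuous_of_le_smul h
  have hint := integrable_of_le hJ hmJ hνJ hB.le h
  rw [expFunctional_eq (relEntropy_eq_integral hac hint), rpow_neg_inv_eq hB]
  refine ENNReal.ofReal_le_ofReal (Real.exp_le_exp.2 (div_le_div_of_nonneg_right ?_ hN.le))
  rw [neg_le_neg_iff]
  calc ∫ x, realDensity m ν x * Real.log (realDensity m ν x) ∂m
      ≤ ∫ x, realDensity m ν x * Real.log B ∂m := by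
        refine integral_mono_ae hint (integrable_realDensity.mul_const _) ?_
        filter_upwards [ae_realDensity_le hB.le h] with x hx
        have h0 := realDensity_nonneg (m := m) (ν := ν) x
        rcases h0.eq_or_lt with h1 | h1
        · simp [← h1]
        · exact mul_le_mul_of_nonneg_left (Real.log_le_log h1 hx) h0
    _ = Real.log B := by rw [integral_mul_const, integral_realDensity hac, one_mul]

lemma le_log_of_rpow_le_expFunctional {E : ProbabilityMeasure X → EReal} (hN : 0 < N) {B e : ℝ}
    (hB : 0 < B) (he : E ν = e) (h : ENNReal.ofReal (B ^ (-1 / N)) ≤ expFunctional E N ν) :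
    e ≤ Real.log B := by
  rw [expFunctional_eq he, rpow_neg_inv_eq hB,
    ENNReal.ofReal_le_ofReal_iff (Real.exp_pos _).le, Real.exp_le_exp,
    div_le_div_iff_of_pos_right hN] at h
  linarith

lemma densityBound_le_iff (h : (ν : Measure X) ≪ m) {C : ℝ≥0∞} :
    densityBound m ν ≤ C ↔ (ν : Measure X) ≤ C • m := by
  constructor
  · intro h1
    refine Measure.le_iff.2 fun s hs => ?_
    rw [← Measure.setLIntegral_rnDeriv h, Measure.smul_apply, smul_eq_mul, ← setLIntegral_const]
    refine lintegral_mono_ae (ae_restrict_of_ae ?_)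
    filter_upwards [ae_le_essSup (f := (ν : Measure X).rnDeriv m) (μ := m)] with x hx
      using hx.trans h1
  · intro h1
    refine essSup_le_of_ae_le _ ?_
    refine ae_le_of_forall_setLIntegral_le_of_sigmaFinite (Measure.measurable_rnDeriv _ _)
      fun s hs _ => ?_
    rw [setLIntegral_const]
    exact (Measure.setLIntegral_rnDeriv_le s).trans (h1 s)

end ExpFunctional

lemma MeasureTheory.Measure.le_ofReal_div_smul {X : Type*} [MeasurableSpace X] {μ ν m : Measure X}
    {a : ℝ≥0∞} (ha : a ≠ 0) (hat : a ≠ ⊤) {B : ℝ} (h : a • μ ≤ ν) (hν : ν ≤ ENNReal.ofReal B • m) :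
    μ ≤ ENNReal.ofReal (B / a.toReal) • m := by
  have hpos : 0 < a.toReal := ENNReal.toReal_pos ha hat
  refine Measure.le_iff.2 fun s _ => ?_
  have h1 := (h s).trans (hν s)
  simp only [Measure.smul_apply, smul_eq_mul] at h1 ⊢
  rw [ENNReal.ofReal_div_of_pos hpos, ENNReal.ofReal_toReal hat, div_eq_mul_inv, mul_right_comm,
    ← div_eq_mul_inv, ENNReal.le_div_iff_mul_le (Or.inl ha) (Or.inl hat), mul_comm]
  exact h1

/-- If `ν` has density `g` and `κ` has density `f`, and `ν ≤ κ` fails, then `ν` has more mass than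
`κ` where `f ≤ g`. -/
lemma MeasureTheory.measure_setOf_density_le_lt {X : Type*} [MeasurableSpace X]
    {lam κ ν : Measure X} [IsFiniteMeasure κ] {f g : X → ℝ≥0} (hf : Measurable f)
    (hg : Measurable g) (hκ : κ = lam.withDensity fun x => f x)
    (hν : ν = lam.withDensity fun x => g x) (h : ¬ ν ≤ κ) :
    κ {x | f x ≤ g x} < ν {x | f x ≤ g x} := by
  have hAm : MeasurableSet {x | f x ≤ g x} := measurableSet_le hf hg
  by_contra! hle
  refine h ?_
  have h1 : (fun x => (f x : ℝ≥0∞)) =ᵐ[lam.restrict {x | f x ≤ g x}] fun x => (g x : ℝ≥0∞) := by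
    refine ae_eq_of_ae_le_of_lintegral_le ?_ ?_ hg.coe_nnreal_ennreal.aemeasurable ?_
    · filter_upwards [ae_restrict_mem hAm] with x hx
      exact ENNReal.coe_le_coe.2 hx
    · rw [← withDensity_apply _ hAm, ← hκ]
      exact measure_ne_top _ _
    · rwa [← withDensity_apply _ hAm, ← withDensity_apply _ hAm, ← hκ, ← hν]
  rw [hκ, hν]
  refine withDensity_mono ?_
  filter_upwards [(ae_restrict_iff' hAm).1 h1] with x hx
  by_cases hxA : f x ≤ g x
  · exact (hx hxA).ge
  · exact ENNReal.coe_le_coe.2 (le_of_not_ge hxA)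

namespace LorentzianPreLength

/-! ### Midpoints with bounded density -/

section BoundedMidpoint

lemma subset_diamond {M : Type*} [MetricSpace M] {L : LorentzianPreLength M} (K : Set M) :
    K ⊆ L.diamond K K := fun x hx => ⟨⟨x, hx, L.le_refl x⟩, ⟨x, hx, L.le_refl x⟩⟩

variable {M : Type*} [MetricSpace M] [MeasurableSpace M] {L : LorentzianPreLength M} {p : ℝ}

lemma tauNorm_two_le {π : Measure (M × M)} [IsProbabilityMeasure π] {θ : ℝ≥0∞}
    (h : ∀ᵐ z ∂π, L.τ z.1 z.2 ≤ θ) : L.tauNorm 2 π ≤ θ := by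
  have h1 : ∫⁻ z, L.τ z.1 z.2 ^ (2 : ℝ) ∂π ≤ ∫⁻ _, θ ^ (2 : ℝ) ∂π := by
    refine lintegral_mono_ae ?_
    filter_upwards [h] with z hz
    exact ENNReal.rpow_le_rpow hz (by norm_num)
  rw [lintegral_const, measure_univ, mul_one] at h1
  rw [tauNorm]
  refine (ENNReal.rpow_le_rpow h1 (by norm_num)).trans_eq ?_
  rw [← ENNReal.rpow_mul]
  norm_num

variable [ProperSpace M] [BorelSpace M]

lemma mem_finiteDomain {m : Measure M} [IsLocallyFiniteMeasure m] {J : Set M} (hJ : IsCompact J)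
    {ν : ProbabilityMeasure M} (hν : ∀ᵐ x ∂(ν : Measure M), x ∈ J) {B : ℝ} (hB : 0 ≤ B)
    (h : (ν : Measure M) ≤ ENNReal.ofReal B • m) : ν ∈ finiteDomain (relEntropy m) := by
  have h1 := relEntropy_eq_integral (absolutelyContinuous_of_le_smul h)
    (integrable_of_le hJ.measurableSet hJ.measure_ne_top hν hB h)
  refine ⟨?_, ?_⟩ <;> rw [h1]
  · exact EReal.coe_ne_top _
  · exact EReal.coe_ne_bot _

/-- Under the curvature-dimension condition, a dualizable pair of measures with bounded densities
has a midpoint whose density obeys the bound suggested by `(K, N)`-convexity, applied to the uniform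
distributions. It is found as a maximizer of the dual entropy among all midpoints: were the bound
violated on a set `A`, the part of the plan through `A` could be replaced partly by a midpoint of
lower entropy, which leaks out of `A`. -/
theorem IsDualSet.exists_midpoint_le (hL : L.IsTame) (hp₀ : 0 < p) (hp₁ : p < 1) {m : Measure M}
    [IsLocallyFiniteMeasure m] {K N : ℝ} (hN : 0 < N) (hTCD : L.WTCD m p K N) {J₀ : Set M}
    (hJ₀ : IsCompact J₀) {μ ν : ProbabilityMeasure M} (hμ : ∀ᵐ x ∂(μ : Measure M), x ∈ J₀)
    (hν : ∀ᵐ x ∂(ν : Measure M), x ∈ J₀) {Γ : Set (M × M)} (h : L.IsDualSet p Γ μ ν)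
    {π₀ : Measure (M × M)} (hπ₀ : L.IsOptimalCoupling p π₀ μ ν) {F G c : ℝ} (hF : 0 < F)
    (hG : 0 < G) (hc : 0 < c) (hμF : (μ : Measure M) ≤ ENNReal.ofReal (F ^ (-N)) • m)
    (hνG : (ν : Measure M) ≤ ENNReal.ofReal (G ^ (-N)) • m) {θ : ℝ≥0∞}
    (hθ : ∀ π, L.IsOptimalCoupling p π μ ν → ∀ᵐ z ∂π, L.τ z.1 z.2 ≤ θ)
    (hdist : ∀ T ≤ θ, ENNReal.ofReal c ≤ distortion K N (1 / 2) T) :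
    ∃ ρ : ProbabilityMeasure M, L.IsMidpoint p ρ μ ν ∧
      (ρ : Measure M) ≤ ENNReal.ofReal ((c * (F + G)) ^ (-N)) • m ∧
      ∃ π, L.IsOptimalCoupling p π μ ν ∧
        distortion K N (1 / 2) (L.tauNorm 2 π) *
          (expFunctional (relEntropy m) N μ + expFunctional (relEntropy m) N ν) ≤
        expFunctional (relEntropy m) N ρ := by
  set J := L.diamond J₀ J₀ with hJdef
  have hJ : IsCompact J := hL.isCompact_diamond J₀ J₀ hJ₀ hJ₀
  have hmJ : m J ≠ ⊤ := hJ.measure_ne_top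
  have hmidJ : ∀ μ' ν' ρ : ProbabilityMeasure M, (∀ᵐ x ∂(μ' : Measure M), x ∈ J₀) →
      (∀ᵐ x ∂(ν' : Measure M), x ∈ J₀) → L.IsMidpoint p ρ μ' ν' → (ρ : Measure M) Jᶜ = 0 :=
    fun μ' ν' ρ h1 h2 h3 => h3.ae_mem hL hJ₀ h1 h2
  set C : ℝ := (c * (F + G)) ^ (-N) with hCdef
  have hC : 0 < C := by positivity
  set κ : Measure M := ENNReal.ofReal C • m.restrict J with hκdef
  have hfinr : IsFiniteMeasure (m.restrict J) := ⟨by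
    rw [Measure.restrict_apply_univ]; exact hmJ.lt_top⟩
  have hfinκ : IsFiniteMeasure κ := Measure.smul_finite _ ENNReal.ofReal_ne_top
  have hpow : ∀ x : ℝ, 0 < x → (x ^ (-N)) ^ (-1 / N) = x := fun x hx => by
    rw [← Real.rpow_mul hx.le, show -N * (-1 / N) = 1 by field_simp, Real.rpow_one]
  -- midpoints of a normalized part of the plan, of relative mass `a`
  have hpart : ∀ (a : ℝ≥0∞) (μ' ν' : ProbabilityMeasure M), a ≠ 0 → a ≠ ⊤ →
      L.IsDualSet p Γ μ' ν' → (∃ π', L.IsOptimalCoupling p π' μ' ν') →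
      a • (μ' : Measure M) ≤ μ → a • (ν' : Measure M) ≤ ν →
      (∀ π, L.IsOptimalCoupling p π μ' ν' → ∀ᵐ z ∂π, L.τ z.1 z.2 ≤ θ) →
      ∃ (π : Measure (M × M)) (ρ : ProbabilityMeasure M), L.IsOptimalCoupling p π μ' ν' ∧
        L.IsMidpoint p ρ μ' ν' ∧ distortion K N (1 / 2) (L.tauNorm 2 π) *
        (expFunctional (relEntropy m) N μ' + expFunctional (relEntropy m) N ν') ≤
        expFunctional (relEntropy m) N ρ ∧ (ρ : Measure M) ≪ m ∧
        Integrable (fun x => realDensity m ρ x * Real.log (realDensity m ρ x)) m ∧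
        ∫ x, realDensity m ρ x * Real.log (realDensity m ρ x) ∂m ≤ Real.log (C / a.toReal) := by
    intro a μ' ν' ha hat hΓ' ⟨π', hπ'⟩ hμ' hν' hθ'
    have hpos : 0 < a.toReal := ENNReal.toReal_pos ha hat
    have hμ'J : ∀ᵐ x ∂(μ' : Measure M), x ∈ J₀ :=
      (Measure.ae_ennreal_smul_measure_iff ha).1 (ae_mono hμ' hμ)
    have hν'J : ∀ᵐ x ∂(ν' : Measure M), x ∈ J₀ :=
      (Measure.ae_ennreal_smul_measure_iff ha).1 (ae_mono hν' hν)
    have hμ'F := Measure.le_ofReal_div_smul ha hat hμ' hμF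
    have hν'G := Measure.le_ofReal_div_smul ha hat hν' hνG
    obtain ⟨π, ρ, h1, h2, h3⟩ := hTCD.exists_midpoint hL hp₀ hp₁ hJ₀ hμ'J hν'J hΓ' hπ'
      (mem_finiteDomain hJ₀ hμ'J (by positivity) hμ'F)
      (mem_finiteDomain hJ₀ hν'J (by positivity) hν'G)
    have h4 := ofReal_rpow_le_expFunctional hN hJ₀.measurableSet hJ₀.measure_ne_top hμ'J
      (by positivity) hμ'F
    have h5 := ofReal_rpow_le_expFunctional hN hJ₀.measurableSet hJ₀.measure_ne_top hν'J
      (by positivity) hν'G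
    have hπp := h1.1.isProbabilityMeasure
    have h6 : ENNReal.ofReal ((C / a.toReal) ^ (-1 / N)) ≤ expFunctional (relEntropy m) N ρ := by
      refine LE.le.trans ?_ h3
      refine LE.le.trans ?_ (mul_le_mul' (hdist _ (tauNorm_two_le (hθ' π h1))) (add_le_add h4 h5))
      rw [← ENNReal.ofReal_add (by positivity) (by positivity), ← ENNReal.ofReal_mul hc.le]
      refine ENNReal.ofReal_le_ofReal (le_of_eq ?_)
      rw [Real.div_rpow hC.le hpos.le, Real.div_rpow (by positivity) hpos.le,
        Real.div_rpow (by positivity) hpos.le, hpow _ hF, hpow _ hG, hCdef, hpow _ (by positivity)]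
      ring
    have h7 : expFunctional (relEntropy m) N ρ ≠ 0 :=
      ((ENNReal.ofReal_pos.2 (by positivity)).trans_le h6).ne'
    have h8 := ne_top_of_expFunctional_ne_zero hN h7
    have hac := absolutelyContinuous_of_relEntropy_ne_top h8
    have hint := integrable_of_relEntropy_ne_top hJ.measurableSet hmJ (hmidJ _ _ _ hμ'J hν'J h2) h8
    exact ⟨π, ρ, h1, h2, h3, hac, hint, le_log_of_rpow_le_expFunctional hN (by positivity)
      (relEntropy_eq_integral hac hint) h6⟩
  obtain ⟨π₁, ρ₁, hπ₁, hρ₁, hU₁, hac₁, hint₁, hlog₁⟩ := hpart 1 μ ν one_ne_zero ENNReal.one_ne_top h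
    ⟨π₀, hπ₀⟩ (by simp) (by simp) hθ
  obtain ⟨ρ, hρ, hmax⟩ := UpperSemicontinuousOn.exists_isMaxOn
    (f := fun ρ : ProbabilityMeasure M => dualEntropy κ ρ) ⟨ρ₁, hρ₁⟩
    (hL.isCompact_midpoints hp₀ hJ₀ hμ hν hπ₀)
    ((upperSemicontinuous_dualEntropy κ).upperSemicontinuousOn _)
  have hρJ := hmidJ _ _ _ hμ hν hρ
  -- the density bound
  have hρκ : (ρ : Measure M) ≤ κ := by
    by_contra hcon
    -- otherwise some part of `ρ`, of mass `a`, is concentrated on a set `A` with `κ A < a`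
    obtain ⟨f, hf, hκf⟩ := exists_nnreal_density (κ := κ) (lam := κ + ρ)
      (Measure.absolutelyContinuous_of_le (Measure.le_add_right le_rfl))
    obtain ⟨g, hg, hρg⟩ := exists_nnreal_density (κ := (ρ : Measure M)) (lam := κ + ρ)
      (Measure.absolutelyContinuous_of_le (Measure.le_add_left le_rfl))
    set A : Set M := {x | f x ≤ g x} with hA
    have hAm : MeasurableSet A := measurableSet_le hf hg
    have hlt : κ A < (ρ : Measure M) A := measure_setOf_density_le_lt hf hg hκf hρg hcon
    set a : ℝ≥0∞ := (ρ : Measure M) A with ha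
    have ha0 : a ≠ 0 := (zero_le.trans_lt hlt).ne'
    have hat : a ≠ ⊤ := measure_ne_top _ _
    have hapos : 0 < a.toReal := ENNReal.toReal_pos ha0 hat
    obtain ⟨Ξ, hΞ, hΞρ⟩ := hρ
    have hfin : L.profit p (Ξ.map fun w => (w.1, w.2.2)) ≠ ⊤ := by
      have := hΞ.1.1.isProbabilityMeasure
      refine hL.profit_ne_top hp₀.le hJ₀ ?_
      filter_upwards [hΞ.1.1.1.ae_fst hμ, hΞ.1.1.1.ae_snd hν] with z h1 h2 using ⟨h1, h2⟩
    obtain ⟨μ', ν', hΓ', hopt', hμ', hν', hrep, hmid⟩ :=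
      hΞ.exists_replacement hp₀ h hΞρ hfin hAm ha.symm ha0
    have hθ' : ∀ π, L.IsOptimalCoupling p π μ' ν' → ∀ᵐ z ∂π, L.τ z.1 z.2 ≤ θ := by
      intro π hπ
      obtain ⟨χ, hχ⟩ := hrep π hπ
      exact (Measure.ae_ennreal_smul_measure_iff ha0).1 (ae_add_measure_iff.1 (hθ _ hχ)).1
    obtain ⟨π', ρ', hπ', hρ', hU', hac', hint', hlog'⟩ := 
      hpart a μ' ν' ha0 hat hΓ' hopt' hμ' hν' hθ'
    have hμ'J : ∀ᵐ x ∂(μ' : Measure M), x ∈ J₀ :=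
      (Measure.ae_ennreal_smul_measure_iff ha0).1 (ae_mono hμ' hμ)
    have hν'J : ∀ᵐ x ∂(ν' : Measure M), x ∈ J₀ :=
      (Measure.ae_ennreal_smul_measure_iff ha0).1 (ae_mono hν' hν)
    have hρ'J := hmidJ _ _ _ hμ'J hν'J hρ'
    -- by Jensen's inequality, a measure on `A` has entropy at least `-log (m (A ∩ J))`
    have hleak : (ρ' : Measure M) Aᶜ ≠ 0 := by
      intro h0
      have hAJ : (ρ' : Measure M) (A ∩ J)ᶜ = 0 := by
        rw [compl_inter]; exact measure_union_null h0 hρ'J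
      have h1 := ofReal_le_dualEntropy (hAm.inter hJ.measurableSet) hAJ
        (C := C / a.toReal) (by positivity) hac' hint'
      have h2 : dualEntropy (ENNReal.ofReal (C / a.toReal) • m.restrict (A ∩ J)) (ρ' : Measure M) ≤
          ENNReal.ofReal (C / a.toReal) * m (A ∩ J) := by
        refine (iInf_le _ (0 : M →ᵇ ℝ≥0)).trans ?_
        simp
      have h3 : ENNReal.ofReal (C / a.toReal) * m (A ∩ J) < 1 := by
        rw [ENNReal.ofReal_div_of_pos hapos, ENNReal.ofReal_toReal hat, div_eq_mul_inv,
          mul_right_comm, ← div_eq_mul_inv]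
        refine (ENNReal.div_lt_iff (Or.inl ha0) (Or.inl hat)).2 ?_
        rw [one_mul]
        have h4 : κ A = ENNReal.ofReal C * m (A ∩ J) := by
          rw [hκdef, Measure.smul_apply, Measure.restrict_apply hAm, smul_eq_mul]
        rwa [← h4]
      have h4 := (h1.trans h2).trans_lt h3
      rw [ENNReal.ofReal_lt_one] at h4
      linarith
    have hρ'lam : (ρ' : Measure M) ≪ κ + ρ := by
      refine Measure.AbsolutelyContinuous.mk fun s hs h0 => ?_
      have h1 : κ s = 0 := (add_eq_zero.1 h0).1
      rw [hκdef, Measure.smul_apply, Measure.restrict_apply hs, smul_eq_mul, mul_eq_zero] at h1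
      have h2 := hac' (h1.resolve_left (ENNReal.ofReal_pos.2 hC).ne')
      refine measure_mono_null (t := (s ∩ J) ∪ Jᶜ) (fun x hx => ?_) (measure_union_null h2 hρ'J)
      by_cases hxJ : x ∈ J
      · exact Or.inl ⟨hx, hxJ⟩
      · exact Or.inr hxJ
    obtain ⟨ε, hε0, hε1, νε, hνε, hlt'⟩ := exists_dualEntropy_lt hf hg ρ ρ' hκf hρg hρ'lam ha0 hleak
    exact absurd (hmax (hmid ρ' hρ' ε hε0 hε1 νε hνε)) (not_le.2 hlt')
  have hρC : (ρ : Measure M) ≤ ENNReal.ofReal C • m := by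
    refine hρκ.trans (Measure.le_iff.2 fun s _ => ?_)
    simp only [hκdef, Measure.smul_apply, smul_eq_mul]
    gcongr
    exact Measure.restrict_le_self
  refine ⟨ρ, hρ, hρC, π₁, hπ₁, hU₁.trans ?_⟩
  -- the maximizer of the dual entropy also minimizes the entropy
  obtain ⟨h1, h2⟩ := dualEntropy_le_ofReal hJ.measurableSet hmJ hρJ hC hρC
  have h3 := ofReal_le_dualEntropy hJ.measurableSet (hmidJ _ _ _ hμ hν hρ₁) hC hac₁ hint₁
  have h4 := (ENNReal.ofReal_le_ofReal_iff h1).1 (h3.trans ((hmax hρ₁).trans h2))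
  rw [expFunctional_eq (relEntropy_eq_integral hac₁ hint₁),
    expFunctional_eq (relEntropy_eq_integral (absolutelyContinuous_of_le_smul hρC)
      (integrable_of_le hJ.measurableSet hmJ hρJ hC.le hρC))]
  refine ENNReal.ofReal_le_ofReal (Real.exp_le_exp.2 (div_le_div_of_nonneg_right ?_ hN.le))
  linarith

end BoundedMidpoint

/-! ### Iterated midpoints -/

section Dyadic

lemma diamond_diamond_subset {M : Type*} [MetricSpace M] {L : LorentzianPreLength M} (K : Set M) :
    L.diamond (L.diamond K K) (L.diamond K K) ⊆ L.diamond K K := by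
  rintro z ⟨⟨x, ⟨⟨x', hx', h1⟩, -⟩, h2⟩, y, ⟨-, y', hy', h3⟩, h4⟩
  exact ⟨⟨x', hx', L.le_trans _ _ _ h1 h2⟩, ⟨y', hy', L.le_trans _ _ _ h4 h3⟩⟩

variable {M : Type*} [MetricSpace M] [MeasurableSpace M] {L : LorentzianPreLength M} {p : ℝ}

variable (L) in
/-- The distribution of `τ` under a coupling. -/
def tauLaw (π : Measure (M × M)) : Measure ℝ≥0∞ := π.map fun z => L.τ z.1 z.2

variable (L p) in
/-- A dualizable pair `(μ, ν)` with an optimal coupling, all of whose optimal couplings transport by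
`2 ^ (-n)` times the distances that occur in some optimal coupling of `(μ₀, μ₁)`. -/
def IsLink (μ₀ μ₁ : ProbabilityMeasure M) (n : ℕ) (μ ν : ProbabilityMeasure M) : Prop :=
  (∃ Γ, L.IsDualSet p Γ μ ν) ∧ (∃ π, L.IsOptimalCoupling p π μ ν) ∧
    ∀ σ, L.IsOptimalCoupling p σ μ ν → ∃ π, L.IsOptimalCoupling p π μ₀ μ₁ ∧
      L.tauLaw π = (L.tauLaw σ).map (2 ^ n * ·)

variable [ProperSpace M] [BorelSpace M]

lemma IsTame.lintegral_tauLaw (hL : L.IsTame) {π σ : Measure (M × M)} {c : ℝ≥0∞}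
    (h : L.tauLaw π = (L.tauLaw σ).map (c * ·)) {φ : ℝ≥0∞ → ℝ≥0∞} (hφ : Measurable φ) :
    ∫⁻ z, φ (L.τ z.1 z.2) ∂π = ∫⁻ z, φ (c * L.τ z.1 z.2) ∂σ := by
  have h1 : Measurable fun t => φ (c * t) := hφ.comp (measurable_const_mul c)
  rw [← lintegral_map hφ hL.measurable_τ, ← tauLaw, h, lintegral_map hφ (measurable_const_mul c),
    tauLaw, lintegral_map h1 hL.measurable_τ]

lemma IsTame.tauNorm_of_tauLaw (hL : L.IsTame) {π σ : Measure (M × M)} {c : ℝ≥0∞} (hc : c ≠ ⊤)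
    (h : L.tauLaw π = (L.tauLaw σ).map (c * ·)) {q : ℝ} (hq : 0 < q) :
    L.tauNorm q π = c * L.tauNorm q σ := by
  rw [tauNorm, tauNorm, hL.lintegral_tauLaw h (φ := fun t => t ^ q) (by fun_prop)]
  simp_rw [ENNReal.mul_rpow_of_nonneg _ _ hq.le]
  rw [lintegral_const_mul' _ _ (ENNReal.rpow_ne_top_of_nonneg hq.le hc),
    ENNReal.mul_rpow_of_nonneg _ _ (by positivity), one_div, ENNReal.rpow_rpow_inv hq.ne']

lemma IsTame.ae_le_of_tauLaw (hL : L.IsTame) {π σ : Measure (M × M)} {c : ℝ≥0∞}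
    (h : L.tauLaw π = (L.tauLaw σ).map (c * ·)) {D : ℝ≥0∞} (hπ : ∀ᵐ z ∂π, L.τ z.1 z.2 ≤ D) :
    ∀ᵐ z ∂σ, c * L.τ z.1 z.2 ≤ D := by
  have h1 : ∀ᵐ t ∂L.tauLaw π, t ≤ D :=
    (ae_map_iff hL.measurable_τ.aemeasurable measurableSet_Iic).2 hπ
  rw [h] at h1
  exact ae_of_ae_map hL.measurable_τ.aemeasurable
    (ae_of_ae_map (measurable_const_mul c).aemeasurable h1)

lemma IsMidPlan.tauLaw (hL : L.IsTame) {μ ν : ProbabilityMeasure M} {Ξ : Measure (M × M × M)}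
    (h : L.IsMidPlan p Ξ μ ν) :
    L.tauLaw (Ξ.map fun w => (w.1, w.2.2)) =
      (L.tauLaw (Ξ.map fun w => (w.1, w.2.1))).map (2 * ·) ∧
    L.tauLaw (Ξ.map fun w => (w.1, w.2.2)) = (L.tauLaw (Ξ.map Prod.snd)).map (2 * ·) := by
  have hm := hL.measurable_τ
  have hm1 : Measurable fun w : M × M × M => L.τ w.1 w.2.1 :=
    hm.comp (f := fun w : M × M × M => (w.1, w.2.1)) (by fun_prop)
  have hm2 : Measurable fun w : M × M × M => L.τ w.2.1 w.2.2 :=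
    hm.comp (f := fun w : M × M × M => w.2) (by fun_prop)
  have h0 : L.tauLaw (Ξ.map fun w => (w.1, w.2.2)) = Ξ.map fun w => L.τ w.1 w.2.2 :=
    Measure.map_map hm (by fun_prop)
  have h1 : L.tauLaw (Ξ.map fun w => (w.1, w.2.1)) = Ξ.map fun w => L.τ w.1 w.2.1 :=
    Measure.map_map hm (by fun_prop)
  have h2 : L.tauLaw (Ξ.map Prod.snd) = Ξ.map fun w => L.τ w.2.1 w.2.2 :=
    Measure.map_map hm (by fun_prop)
  rw [h0, h1, h2, Measure.map_map (measurable_const_mul 2) hm1,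
    Measure.map_map (measurable_const_mul 2) hm2]
  constructor
  · refine Measure.map_congr ?_
    filter_upwards [h.2] with w hw using hw.2.2.2
  · refine Measure.map_congr ?_
    filter_upwards [h.2] with w hw
    exact hw.2.2.2.trans (by rw [hw.2.2.1]; rfl)

/-- A midpoint divides a link into two links of the next generation. -/
lemma IsLink.split (hL : L.IsTame) (hp₀ : 0 < p) (hp₁ : p < 1) {K : Set M} (hK : IsCompact K)
    {μ₀ μ₁ μ ρ ν : ProbabilityMeasure M} {n : ℕ} (h : L.IsLink p μ₀ μ₁ n μ ν)
    (hμ : ∀ᵐ x ∂(μ : Measure M), x ∈ K) (hν : ∀ᵐ x ∂(ν : Measure M), x ∈ K)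
    (hρ : L.IsMidpoint p ρ μ ν) :
    L.IsLink p μ₀ μ₁ (n + 1) μ ρ ∧ L.IsLink p μ₀ μ₁ (n + 1) ρ ν := by
  obtain ⟨⟨Γ, hΓ⟩, -, hlaw⟩ := h
  obtain ⟨Ξ, hΞ, hΞρ⟩ := hρ
  have hm1 : Measurable fun w : M × M × M => (w.1, w.2.1) := by fun_prop
  have hfin : L.profit p (Ξ.map fun w => (w.1, w.2.1)) ≠ ⊤ := by
    have hJ := hL.isCompact_diamond K K hK hK
    have := (hΞ.halves hL hp₀ hΞρ).1.isProbabilityMeasure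
    refine hL.profit_ne_top hp₀.le hJ ((ae_map_iff hm1.aemeasurable
      (hJ.measurableSet.prod hJ.measurableSet)).2 ?_)
    filter_upwards [hΞ.ae_mem hμ hν] with w hw using ⟨subset_diamond K hw.1, hw.2.1⟩
  have hcomp : ∀ κ : Measure ℝ≥0∞,
      (κ.map (2 * ·)).map ((2 : ℝ≥0∞) ^ n * ·) = κ.map (2 ^ (n + 1) * ·) := fun κ => by
    rw [Measure.map_map (measurable_const_mul _) (measurable_const_mul _)]
    congr 1
    ext t
    simp only [Function.comp, pow_succ, mul_assoc]
  refine ⟨⟨⟨_, hΓ.left hL hp₀ hp₁ hΞ hΞρ hfin⟩, ⟨_, hΞ.left_optimal hL hp₀ hp₁ hΞρ hfin⟩,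
    fun σ hσ => ?_⟩, ⟨⟨_, hΓ.right hL hp₀ hp₁ hΞ hΞρ hfin⟩,
    ⟨_, hΞ.right_optimal hL hp₀ hp₁ hΞρ hfin⟩, fun σ hσ => ?_⟩⟩
  · obtain ⟨Ξ', hΞ', rfl, -, -⟩ := hΞ.exists_of_left hL hp₀ hp₁ hΞρ hfin hσ
    obtain ⟨π, hπ, hπlaw⟩ := hlaw _ hΞ'.1
    exact ⟨π, hπ, by rw [hπlaw, (hΞ'.tauLaw hL).1, hcomp]⟩
  · obtain ⟨Ξ', hΞ', -, rfl, -⟩ := hΞ.exists_of_right hL hp₀ hp₁ hΞρ hfin hσ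
    obtain ⟨π, hπ, hπlaw⟩ := hlaw _ hΞ'.1
    exact ⟨π, hπ, by rw [hπlaw, (hΞ'.tauLaw hL).2, hcomp]⟩

/-- Iterated midpoints of `(μ₀, μ₁)`, at the dyadic times `i / 2 ^ n`, for given profiles `g` of the
density bounds and `G` of the exponentiated entropy that are compatible with taking midpoints. -/
theorem exists_dyadic_chain (hL : L.IsTame) (hp₀ : 0 < p) (hp₁ : p < 1) {m : Measure M}
    [IsLocallyFiniteMeasure m] {K N : ℝ} (hN : 0 < N) (hTCD : L.WTCD m p K N) {J : Set M}
    (hJ : IsCompact J) (hJJ : L.diamond J J ⊆ J) {μ₀ μ₁ : ProbabilityMeasure M}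
    (hμ₀ : ∀ᵐ x ∂(μ₀ : Measure M), x ∈ J) (hμ₁ : ∀ᵐ x ∂(μ₁ : Measure M), x ∈ J)
    (hdual : ∃ Γ, L.IsDualSet p Γ μ₀ μ₁) (hopt : ∃ π, L.IsOptimalCoupling p π μ₀ μ₁)
    {D : ℝ≥0∞} (hD : ∀ π, L.IsOptimalCoupling p π μ₀ μ₁ → ∀ᵐ z ∂π, L.τ z.1 z.2 ≤ D)
    {g : ℝ → ℝ} (hg : ∀ t, 0 < g t) {c : ℕ → ℝ} (hc : ∀ n, 0 < c n)
    (hgc : ∀ n t, c n * (g (t - 1 / 2 ^ (n + 1)) + g (t + 1 / 2 ^ (n + 1))) = g t)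
    (hcd : ∀ n, ∀ T ≤ D / 2 ^ n, ENNReal.ofReal (c n) ≤ distortion K N (1 / 2) T)
    {G : ℝ → ℝ≥0∞} (hG : ∀ (n : ℕ) (t : ℝ) (π : Measure (M × M)),
      L.IsOptimalCoupling p π μ₀ μ₁ → 0 ≤ t - 1 / 2 ^ (n + 1) → t + 1 / 2 ^ (n + 1) ≤ 1 →
      G t ≤ distortion K N (1 / 2) (L.tauNorm 2 π / 2 ^ n) *
        (G (t - 1 / 2 ^ (n + 1)) + G (t + 1 / 2 ^ (n + 1))))
    (hμ₀g : (μ₀ : Measure M) ≤ ENNReal.ofReal (g 0 ^ (-N)) • m)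
    (hμ₁g : (μ₁ : Measure M) ≤ ENNReal.ofReal (g 1 ^ (-N)) • m)
    (hμ₀G : G 0 ≤ expFunctional (relEntropy m) N μ₀)
    (hμ₁G : G 1 ≤ expFunctional (relEntropy m) N μ₁) (n : ℕ) :
    ∃ κ : ℕ → ProbabilityMeasure M, κ 0 = μ₀ ∧ κ (2 ^ n) = μ₁ ∧
      (∀ i ≤ 2 ^ n, (∀ᵐ x ∂(κ i : Measure M), x ∈ J) ∧
        (κ i : Measure M) ≤ ENNReal.ofReal (g (i / 2 ^ n) ^ (-N)) • m ∧
        G (i / 2 ^ n) ≤ expFunctional (relEntropy m) N (κ i)) ∧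
      ∀ i < 2 ^ n, L.IsLink p μ₀ μ₁ n (κ i) (κ (i + 1)) := by
  induction n with
  | zero =>
    refine ⟨fun i => if i = 0 then μ₀ else μ₁, rfl, rfl, fun i hi => ?_, fun i hi => ?_⟩
    · have hi' : i = 0 ∨ i = 1 := by simp only [pow_zero] at hi; omega
      rcases hi' with rfl | rfl
      · simpa using ⟨hμ₀, hμ₀g, hμ₀G⟩
      · simpa using ⟨hμ₁, hμ₁g, hμ₁G⟩
    · obtain rfl : i = 0 := by simpa using hi
      refine ⟨hdual, hopt, fun σ hσ => ⟨σ, hσ, ?_⟩⟩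
      simp
  | succ n ih =>
    obtain ⟨κ, hκ0, hκ1, hκ, hlink⟩ := ih
    have h2n : (0 : ℝ) < 2 ^ n := by positivity
    have hmid : ∀ i, ∃ ρ : ProbabilityMeasure M, i < 2 ^ n →
        L.IsMidpoint p ρ (κ i) (κ (i + 1)) ∧ (∀ᵐ x ∂(ρ : Measure M), x ∈ J) ∧
        (ρ : Measure M) ≤ ENNReal.ofReal (g ((2 * i + 1 : ℕ) / 2 ^ (n + 1)) ^ (-N)) • m ∧
        G ((2 * i + 1 : ℕ) / 2 ^ (n + 1)) ≤ expFunctional (relEntropy m) N ρ := by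
      intro i
      by_cases hi : i < 2 ^ n
      · obtain ⟨⟨Γ, hΓ⟩, ⟨π₀, hπ₀⟩, hlaw⟩ := hlink i hi
        obtain ⟨h1, h2, h3⟩ := hκ i hi.le
        obtain ⟨h1', h2', h3'⟩ := hκ (i + 1) hi
        have ht1 : (i : ℝ) / 2 ^ n = (2 * i + 1 : ℕ) / 2 ^ (n + 1) - 1 / 2 ^ (n + 1) := by
          push_cast; field_simp; ring
        have ht2 : ((i + 1 : ℕ) : ℝ) / 2 ^ n = (2 * i + 1 : ℕ) / 2 ^ (n + 1) + 1 / 2 ^ (n + 1) := by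
          push_cast; field_simp; ring
        have h2top : (2 : ℝ≥0∞) ^ n ≠ ⊤ := ENNReal.pow_ne_top ENNReal.ofNat_ne_top
        have h2zero : (2 : ℝ≥0∞) ^ n ≠ 0 := pow_ne_zero _ two_ne_zero
        obtain ⟨ρ, hρ, hρg, π, hπ, hU⟩ := hΓ.exists_midpoint_le hL hp₀ hp₁ hN hTCD hJ h1 h1' hπ₀
          (hg _) (hg _) (hc n) h2 h2' (θ := D / 2 ^ n) (fun σ hσ => by
            obtain ⟨π, hπ, hl⟩ := hlaw σ hσ
            filter_upwards [hL.ae_le_of_tauLaw hl (hD π hπ)] with z hz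
            rw [ENNReal.le_div_iff_mul_le (Or.inl h2zero) (Or.inl h2top), mul_comm]
            exact hz) (hcd n)
        refine ⟨ρ, fun _ => ⟨hρ, ?_, ?_, ?_⟩⟩
        · filter_upwards [hρ.ae_mem hL hJ h1 h1'] with z hz using hJJ hz
        · rw [ht1, ht2, hgc] at hρg
          exact hρg
        · obtain ⟨π', hπ', hl⟩ := hlaw π hπ
          have hT : L.tauNorm 2 π = L.tauNorm 2 π' / 2 ^ n := by
            rw [hL.tauNorm_of_tauLaw h2top hl two_pos, mul_comm,
              ENNReal.mul_div_cancel_right h2zero h2top]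
          rw [hT] at hU
          rw [ht1] at h3
          rw [ht2] at h3'
          have hi' : ((i + 1 : ℕ) : ℝ) ≤ 2 ^ n := by exact_mod_cast hi
          refine (hG n _ π' hπ' ?_ ?_).trans ((mul_le_mul' le_rfl (add_le_add h3 h3')).trans hU)
          · rw [← ht1]; positivity
          · rw [← ht2, div_le_one h2n]; exact hi'
      · exact ⟨μ₀, fun h => absurd h hi⟩
    choose ρ hρ using hmid
    refine ⟨fun i => if i % 2 = 0 then κ (i / 2) else ρ (i / 2), by simpa using hκ0, ?_, ?_, ?_⟩
    · have h1 : 2 ^ (n + 1) % 2 = 0 := by rw [pow_succ]; simp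
      have h2 : 2 ^ (n + 1) / 2 = 2 ^ n := by rw [pow_succ]; simp
      simp only [h1, h2, if_true, hκ1]
    · intro i hi
      rw [pow_succ] at hi
      rcases Nat.even_or_odd' i with ⟨k, rfl | rfl⟩
      · have h1 : 2 * k % 2 = 0 := by omega
        have h2 : 2 * k / 2 = k := by omega
        have h3 : ((2 * k : ℕ) : ℝ) / 2 ^ (n + 1) = k / 2 ^ n := by
          push_cast; field_simp; ring
        simp only [h1, h2, if_true, h3]
        exact hκ k (by omega)
      · have h1 : ¬ (2 * k + 1) % 2 = 0 := by omega
        have h2 : (2 * k + 1) / 2 = k := by omega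
        simp only [h1, h2, if_false]
        exact (hρ k (by omega)).2
    · intro i hi
      rw [pow_succ] at hi
      rcases Nat.even_or_odd' i with ⟨k, rfl | rfl⟩
      · have h1 : 2 * k % 2 = 0 := by omega
        have h2 : 2 * k / 2 = k := by omega
        have h3 : ¬ (2 * k + 1) % 2 = 0 := by omega
        have h4 : (2 * k + 1) / 2 = k := by omega
        have hk : k < 2 ^ n := by omega
        simp only [h1, h2, h3, h4, if_true, if_false]
        exact ((hlink k hk).split hL hp₀ hp₁ hJ (hκ k hk.le).1 (hκ (k + 1) hk).1 (hρ k hk).1).1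
      · have h1 : ¬ (2 * k + 1) % 2 = 0 := by omega
        have h2 : (2 * k + 1) / 2 = k := by omega
        have h3 : (2 * k + 1 + 1) % 2 = 0 := by omega
        have h4 : (2 * k + 1 + 1) / 2 = k + 1 := by omega
        have hk : k < 2 ^ n := by omega
        simp only [h1, h2, h3, h4, if_true, if_false]
        exact ((hlink k hk).split hL hp₀ hp₁ hJ (hκ k hk.le).1 (hκ (k + 1) hk).1 (hρ k hk).1).2

end Dyadic

end LorentzianPreLength

/-! ### The reverse triangle inequality for the transport cost -/

lemma ENNReal.mul_rpow_add_mul_rpow_le {p : ℝ} (hp₀ : 0 < p) (hp₁ : p < 1) {l₁ l₂ : ℝ≥0}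
    (h₁ : l₁ ≠ 0) (h₂ : l₂ ≠ 0) (hl : l₁ + l₂ = 1) {a b : ℝ≥0∞} (ha : a ≠ ⊤) (hb : b ≠ ⊤) :
    (l₁ : ℝ≥0∞) ^ (1 - p) * a ^ p + (l₂ : ℝ≥0∞) ^ (1 - p) * b ^ p ≤ (a + b) ^ p := by
  lift a to ℝ≥0 using ha
  lift b to ℝ≥0 using hb
  have h := (NNReal.concaveOn_rpow hp₀.le hp₁.le).2 (mem_univ (a / l₁)) (mem_univ (b / l₂))
    (zero_le (a := l₁)) (zero_le (a := l₂)) hl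
  simp only [smul_eq_mul] at h
  rw [mul_div_cancel₀ _ h₁, mul_div_cancel₀ _ h₂, NNReal.div_rpow, NNReal.div_rpow] at h
  have hq : ∀ (l x : ℝ≥0), l ≠ 0 → l * (x ^ p / l ^ p) = l ^ (1 - p) * x ^ p := fun l x hl => by
    rw [NNReal.rpow_sub hl, NNReal.rpow_one]
    ring
  rw [hq _ _ h₁, hq _ _ h₂] at h
  rw [← ENNReal.coe_rpow_of_ne_zero h₁, ← ENNReal.coe_rpow_of_ne_zero h₂,
    ← ENNReal.coe_rpow_of_nonneg _ hp₀.le, ← ENNReal.coe_rpow_of_nonneg _ hp₀.le,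
    ← ENNReal.coe_add, ← ENNReal.coe_rpow_of_nonneg _ hp₀.le]
  exact_mod_cast h

/-- Reverse Minkowski inequality, for exponents below `1`. -/
lemma ENNReal.lintegral_rpow_add_ge {Y : Type*} [MeasurableSpace Y] {Ξ : Measure Y} {p : ℝ}
    (hp₀ : 0 < p) (hp₁ : p < 1) {f g h : Y → ℝ≥0∞} (hf : Measurable f) (hft : ∀ y, f y ≠ ⊤)
    (hgt : ∀ y, g y ≠ ⊤) (hh : ∀ᵐ y ∂Ξ, f y + g y ≤ h y)
    (hF : ∫⁻ y, f y ^ p ∂Ξ ≠ ⊤) (hG : ∫⁻ y, g y ^ p ∂Ξ ≠ ⊤) :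
    (∫⁻ y, f y ^ p ∂Ξ) ^ (1 / p) + (∫⁻ y, g y ^ p ∂Ξ) ^ (1 / p) ≤
      (∫⁻ y, h y ^ p ∂Ξ) ^ (1 / p) := by
  have hmono : ∀ k : Y → ℝ≥0∞, (∀ᵐ y ∂Ξ, k y ≤ h y) →
      (∫⁻ y, k y ^ p ∂Ξ) ^ (1 / p) ≤ (∫⁻ y, h y ^ p ∂Ξ) ^ (1 / p) := fun k hk => by
    refine ENNReal.rpow_le_rpow (lintegral_mono_ae ?_) (by positivity)
    filter_upwards [hk] with y hy using ENNReal.rpow_le_rpow hy hp₀.le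
  have hA' : (∫⁻ y, f y ^ p ∂Ξ) ^ (1 / p) ≠ ⊤ := ENNReal.rpow_ne_top_of_nonneg (by positivity) hF
  have hB' : (∫⁻ y, g y ^ p ∂Ξ) ^ (1 / p) ≠ ⊤ := ENNReal.rpow_ne_top_of_nonneg (by positivity) hG
  obtain ⟨A, hA⟩ : ∃ A : ℝ≥0, (A : ℝ≥0∞) = (∫⁻ y, f y ^ p ∂Ξ) ^ (1 / p) :=
    ⟨_, ENNReal.coe_toNNReal hA'⟩
  obtain ⟨B, hB⟩ : ∃ B : ℝ≥0, (B : ℝ≥0∞) = (∫⁻ y, g y ^ p ∂Ξ) ^ (1 / p) :=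
    ⟨_, ENNReal.coe_toNNReal hB'⟩
  have hAp : ∫⁻ y, f y ^ p ∂Ξ = (A : ℝ≥0∞) ^ p := by
    rw [hA, one_div, ENNReal.rpow_inv_rpow hp₀.ne']
  have hBp : ∫⁻ y, g y ^ p ∂Ξ = (B : ℝ≥0∞) ^ p := by
    rw [hB, one_div, ENNReal.rpow_inv_rpow hp₀.ne']
  rcases eq_or_ne A 0 with rfl | hA0
  · rw [← hA, ENNReal.coe_zero, zero_add]
    exact hmono g (hh.mono fun y hy => le_add_self.trans hy)
  rcases eq_or_ne B 0 with rfl | hB0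
  · rw [← hB, ENNReal.coe_zero, add_zero]
    exact hmono f (hh.mono fun y hy => le_self_add.trans hy)
  rw [← hA, ← hB]
  have hAB : A + B ≠ 0 := fun h => hA0 (add_eq_zero.1 h).1
  have hsum : A / (A + B) + B / (A + B) = 1 := by rw [← add_div, div_self hAB]
  have hA1 : A / (A + B) ≠ 0 := div_ne_zero hA0 hAB
  have hB1 : B / (A + B) ≠ 0 := div_ne_zero hB0 hAB
  have key : ((A / (A + B) : ℝ≥0) : ℝ≥0∞) ^ (1 - p) * (A : ℝ≥0∞) ^ p +
      ((B / (A + B) : ℝ≥0) : ℝ≥0∞) ^ (1 - p) * (B : ℝ≥0∞) ^ p ≤ ∫⁻ y, h y ^ p ∂Ξ := by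
    rw [← hAp, ← hBp, ← lintegral_const_mul' _ _ (by simp [← ENNReal.coe_rpow_of_ne_zero hA1]),
      ← lintegral_const_mul' _ _ (by simp [← ENNReal.coe_rpow_of_ne_zero hB1]),
      ← lintegral_add_left ((hf.pow_const p).const_mul _)]
    refine lintegral_mono_ae ?_
    filter_upwards [hh] with y hy
    exact (ENNReal.mul_rpow_add_mul_rpow_le hp₀ hp₁ hA1 hB1 hsum (hft y) (hgt y)).trans
      (ENNReal.rpow_le_rpow hy hp₀.le)
  have hval : ((A / (A + B) : ℝ≥0) : ℝ≥0∞) ^ (1 - p) * (A : ℝ≥0∞) ^ p +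
      ((B / (A + B) : ℝ≥0) : ℝ≥0∞) ^ (1 - p) * (B : ℝ≥0∞) ^ p = ((A : ℝ≥0∞) + B) ^ p := by
    rw [← ENNReal.coe_rpow_of_ne_zero hA1, ← ENNReal.coe_rpow_of_ne_zero hB1,
      ← ENNReal.coe_rpow_of_ne_zero hA0, ← ENNReal.coe_rpow_of_ne_zero hB0, ← ENNReal.coe_add,
      ← ENNReal.coe_rpow_of_ne_zero hAB, ← ENNReal.coe_mul, ← ENNReal.coe_mul, ← ENNReal.coe_add,
      ENNReal.coe_inj, NNReal.div_rpow, NNReal.div_rpow]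
    have hq : ∀ x : ℝ≥0, x ≠ 0 → x ^ (1 - p) / (A + B) ^ (1 - p) * x ^ p =
        x / (A + B) ^ (1 - p) := fun x hx => by
      rw [div_mul_eq_mul_div, ← NNReal.rpow_add hx, sub_add_cancel, NNReal.rpow_one]
    rw [hq _ hA0, hq _ hB0, ← add_div, NNReal.rpow_sub hAB, NNReal.rpow_one, div_div_eq_mul_div,
      mul_div_cancel_left₀ _ hAB]
  rw [hval] at key
  calc (A : ℝ≥0∞) + B = (((A : ℝ≥0∞) + B) ^ p) ^ (1 / p) := by
        rw [one_div, ENNReal.rpow_rpow_inv hp₀.ne']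
    _ ≤ _ := ENNReal.rpow_le_rpow key (by positivity)

namespace LorentzianPreLength

section ReverseTriangle

variable {M : Type*} [MetricSpace M] [MeasurableSpace M] {L : LorentzianPreLength M} {p : ℝ}

lemma tauNorm_le_cost {π : Measure (M × M)} {μ ν : ProbabilityMeasure M}
    (h : L.IsCausalCoupling π μ ν) : (L.tauNorm p π : EReal) ≤ L.cost p μ ν :=
  le_iSup₂ (f := fun σ (_ : L.IsCausalCoupling σ μ ν) => (L.tauNorm p σ : EReal)) π h

lemma IsTame.tauNorm_ne_top (hL : L.IsTame) {q : ℝ} (hq : 0 < q) {K : Set M} (hK : IsCompact K)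
    {π : Measure (M × M)} {μ ν : ProbabilityMeasure M} (h : IsCoupling π μ ν)
    (hμ : ∀ᵐ x ∂(μ : Measure M), x ∈ K) (hν : ∀ᵐ x ∂(ν : Measure M), x ∈ K) :
    L.tauNorm q π ≠ ⊤ := by
  have := h.isProbabilityMeasure
  refine ENNReal.rpow_ne_top_of_nonneg (by positivity) (hL.profit_ne_top hq.le hK ?_)
  filter_upwards [h.ae_fst hμ, h.ae_snd hν] with z h1 h2 using ⟨h1, h2⟩

variable [ProperSpace M] [BorelSpace M]

/-- Transport costs are superadditive. -/
lemma IsTame.exists_tauNorm_add_le (hL : L.IsTame) (hp₀ : 0 < p) (hp₁ : p < 1)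
    {μ ρ ν : ProbabilityMeasure M} {π σ : Measure (M × M)} (hπ : L.IsCausalCoupling π μ ρ)
    (hσ : L.IsCausalCoupling σ ρ ν) (hπt : L.tauNorm p π ≠ ⊤) (hσt : L.tauNorm p σ ≠ ⊤) :
    ∃ χ, L.IsCausalCoupling χ μ ν ∧ L.tauNorm p π + L.tauNorm p σ ≤ L.tauNorm p χ := by
  obtain ⟨Ξ, h1, h2, h3, h4, h5, h6⟩ := hL.exists_causal_glue hπ hσ
  refine ⟨_, h4, ?_⟩
  have hm1 : Measurable fun w : M × M × M => L.τ w.1 w.2.1 :=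
    hL.measurable_τ.comp (f := fun w : M × M × M => (w.1, w.2.1)) (by fun_prop)
  have hfin : ∀ χ : Measure (M × M), L.tauNorm p χ ≠ ⊤ → L.profit p χ ≠ ⊤ := fun χ hχ => by
    rw [profit_eq_tauNorm_rpow hp₀]
    exact ENNReal.rpow_ne_top_of_nonneg hp₀.le hχ
  have hπf := hfin π hπt
  have hσf := hfin σ hσt
  rw [← h1, hL.profit_map (by fun_prop)] at hπf
  rw [← h2, hL.profit_map (by fun_prop)] at hσf
  rw [tauNorm_eq, tauNorm_eq, tauNorm_eq, ← h1, ← h2, hL.profit_map (by fun_prop),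
    hL.profit_map (by fun_prop), hL.profit_map (by fun_prop)]
  refine ENNReal.lintegral_rpow_add_ge hp₀ hp₁ hm1 (fun w => hL.τ_ne_top _ _)
    (fun w => hL.τ_ne_top _ _) ?_ hπf hσf
  filter_upwards [h5, h6] with w h h' using L.reverse_triangle _ _ _ h h'

/-- Along a chain of measures on a compact set, costs add up. -/
lemma IsTame.exists_tauNorm_chain (hL : L.IsTame) (hp₀ : 0 < p) (hp₁ : p < 1) {K : Set M}
    (hK : IsCompact K) {κ : ℕ → ProbabilityMeasure M} {r : ℝ≥0∞} {n : ℕ}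
    (hκ : ∀ i ≤ n, ∀ᵐ x ∂(κ i : Measure M), x ∈ K)
    (hstep : ∀ i < n, ∃ π, L.IsCausalCoupling π (κ i) (κ (i + 1)) ∧ r ≤ L.tauNorm p π)
    {i : ℕ} (k : ℕ) (hik : i + k ≤ n) :
    ∃ π, L.IsCausalCoupling π (κ i) (κ (i + k)) ∧ k * r ≤ L.tauNorm p π := by
  induction k with
  | zero => exact ⟨_, isCausalCoupling_diag _, by simp⟩
  | succ k ih =>
    obtain ⟨π, hπ, h1⟩ := ih (by omega)
    obtain ⟨σ, hσ, h2⟩ := hstep (i + k) (by omega)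
    obtain ⟨χ, hχ, h3⟩ := hL.exists_tauNorm_add_le hp₀ hp₁ hπ hσ
      (hL.tauNorm_ne_top hp₀ hK hπ.1 (hκ _ (by omega)) (hκ _ (by omega)))
      (hL.tauNorm_ne_top hp₀ hK hσ.1 (hκ _ (by omega)) (hκ _ (by omega)))
    refine ⟨χ, hχ, (le_of_eq ?_).trans ((add_le_add h1 h2).trans h3)⟩
    push_cast
    ring

end ReverseTriangle

end LorentzianPreLength

/-! ### Distortion coefficients -/

section Distortion

variable {K N r : ℝ} {θ θ' : ℝ≥0∞}

/-- The distortion coefficients at `θ` are finite and given by their defining formulas. -/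
def IsSubcritical (K N : ℝ) (θ : ℝ≥0∞) : Prop :=
  θ ≠ ⊤ ∧ (K ≤ 0 ∨ K * θ.toReal ^ 2 < N * Real.pi ^ 2)

lemma distortion_of_eq_zero (h : K = 0 ∨ θ = 0) : distortion K N r θ = ENNReal.ofReal r := if_pos h

lemma distortion_of_neg (hK : K < 0) (h0 : θ ≠ 0) (hθ : θ ≠ ⊤) : distortion K N r θ =
    ENNReal.ofReal
      (Real.sinh (r * (θ.toReal * √(-K / N))) / Real.sinh (θ.toReal * √(-K / N))) := by
  rw [distortion, if_neg (by simp [hK.ne, h0]), if_pos hK, if_neg hθ, mul_assoc]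

lemma distortion_of_pos (hK : 0 < K) (h0 : θ ≠ 0) (hθ : θ ≠ ⊤)
    (h : K * θ.toReal ^ 2 < N * Real.pi ^ 2) : distortion K N r θ =
    ENNReal.ofReal
      (Real.sin (r * (θ.toReal * √(K / N))) / Real.sin (θ.toReal * √(K / N))) := by
  rw [distortion, if_neg (by simp [hK.ne', h0]), if_neg hK.not_gt, if_pos ⟨hθ, h⟩, mul_assoc]

lemma distortion_of_not_subcritical (h : ¬ IsSubcritical K N θ) (hK : 0 < K) (hN : 0 < N) :
    distortion K N r θ = ⊤ := by
  have h0 : θ ≠ 0 := by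
    rintro rfl
    refine h ⟨ENNReal.zero_ne_top, Or.inr ?_⟩
    have := Real.pi_pos
    have h1 : 0 < N * Real.pi ^ 2 := by positivity
    simpa using h1
  rw [distortion, if_neg (by simp [hK.ne', h0]), if_neg hK.not_gt,
    if_neg fun h' => h ⟨h'.1, Or.inr h'.2⟩]

lemma mul_sqrt_lt_pi (hK : 0 < K) (hN : 0 < N) {t : ℝ} (h : K * t ^ 2 < N * Real.pi ^ 2) :
    t * √(K / N) < Real.pi := by
  refine lt_of_pow_lt_pow_left₀ 2 Real.pi_pos.le ?_
  rw [mul_pow, Real.sq_sqrt (by positivity), mul_div_assoc', div_lt_iff₀ hN]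
  linarith

lemma distortion_half_of_nonpos (hK : K ≤ 0) (hN : 0 < N) (hθ : θ ≠ ⊤) :
    distortion K N (1 / 2) θ =
      ENNReal.ofReal (1 / (2 * Real.cosh (θ.toReal * √(-K / N) / 2))) := by
  by_cases h : K = 0 ∨ θ = 0
  · rw [distortion_of_eq_zero h]
    rcases h with rfl | rfl <;> simp
  · push Not at h
    have hK' : K < 0 := lt_of_le_of_ne hK h.1
    have hx : 0 < θ.toReal * √(-K / N) :=
      mul_pos (ENNReal.toReal_pos h.2 hθ) (Real.sqrt_pos.2 (div_pos (neg_pos.2 hK') hN))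
    rw [distortion_of_neg hK' h.2 hθ]
    congr 1
    set x := θ.toReal * √(-K / N)
    have h1 : Real.sinh x = 2 * Real.sinh (x / 2) * Real.cosh (x / 2) := by
      rw [← Real.sinh_two_mul]; ring_nf
    have h2 : 0 < Real.sinh (x / 2) := Real.sinh_pos_iff.2 (by linarith)
    have h3 := Real.cosh_pos (x / 2)
    rw [h1, show 1 / 2 * x = x / 2 by ring]
    field_simp

lemma distortion_half_of_pos (hK : 0 < K) (hN : 0 < N) (hθ : IsSubcritical K N θ) :
    distortion K N (1 / 2) θ =
      ENNReal.ofReal (1 / (2 * Real.cos (θ.toReal * √(K / N) / 2))) := by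
  have h' := hθ.2.resolve_left hK.not_ge
  by_cases h0 : θ = 0
  · rw [distortion_of_eq_zero (Or.inr h0), h0]
    simp
  · have hx : 0 < θ.toReal * √(K / N) :=
      mul_pos (ENNReal.toReal_pos h0 hθ.1) (Real.sqrt_pos.2 (div_pos hK hN))
    have hxpi := mul_sqrt_lt_pi hK hN h'
    rw [distortion_of_pos hK h0 hθ.1 h']
    congr 1
    set x := θ.toReal * √(K / N)
    have h1 : Real.sin x = 2 * Real.sin (x / 2) * Real.cos (x / 2) := by
      rw [← Real.sin_two_mul]; ring_nf
    have h2 : 0 < Real.sin (x / 2) := Real.sin_pos_of_pos_of_lt_pi (by linarith) (by linarith)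
    have h3 : 0 < Real.cos (x / 2) :=
      Real.cos_pos_of_mem_Ioo ⟨by linarith [Real.pi_pos], by linarith⟩
    rw [h1, show 1 / 2 * x = x / 2 by ring]
    field_simp

lemma distortion_half_antitone (hK : K ≤ 0) (hN : 0 < N) (h : θ ≤ θ') (hθ' : θ' ≠ ⊤) :
    distortion K N (1 / 2) θ' ≤ distortion K N (1 / 2) θ := by
  rw [distortion_half_of_nonpos hK hN hθ',
    distortion_half_of_nonpos hK hN (ne_top_of_le_ne_top hθ' h)]
  refine ENNReal.ofReal_le_ofReal (one_div_le_one_div_of_le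
    (mul_pos two_pos (Real.cosh_pos _)) (mul_le_mul_of_nonneg_left ?_ two_pos.le))
  have h1 := ENNReal.toReal_mono hθ' h
  refine Real.cosh_le_cosh.2 ?_
  rw [abs_of_nonneg (by positivity), abs_of_nonneg (by positivity)]
  gcongr

lemma distortion_half_monotone (hK : 0 < K) (hN : 0 < N) (h : θ ≤ θ') :
    distortion K N (1 / 2) θ ≤ distortion K N (1 / 2) θ' := by
  by_cases hθ' : IsSubcritical K N θ'
  · have h1 := ENNReal.toReal_mono hθ'.1 h
    have h' := hθ'.2.resolve_left hK.not_ge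
    have hθ : IsSubcritical K N θ := ⟨ne_top_of_le_ne_top hθ'.1 h, Or.inr (lt_of_le_of_lt
      (mul_le_mul_of_nonneg_left (pow_le_pow_left₀ ENNReal.toReal_nonneg h1 2) hK.le) h')⟩
    have hxpi := mul_sqrt_lt_pi hK hN h'
    rw [distortion_half_of_pos hK hN hθ, distortion_half_of_pos hK hN hθ']
    have h2 : θ.toReal * √(K / N) ≤ θ'.toReal * √(K / N) := by gcongr
    have h3 : 0 ≤ θ.toReal * √(K / N) := by positivity
    refine ENNReal.ofReal_le_ofReal (one_div_le_one_div_of_le (mul_pos two_pos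
      (Real.cos_pos_of_mem_Ioo ⟨by linarith [Real.pi_pos], by linarith⟩))
      (mul_le_mul_of_nonneg_left ?_ two_pos.le))
    exact Real.cos_le_cos_of_nonneg_of_le_pi (by linarith) (by linarith) (by linarith)
  · rw [distortion_of_not_subcritical hθ' hK hN]
    exact le_top

lemma le_distortion_half (hN : 0 < N) {b : ℝ} (hb : 0 ≤ b) (h : θ ≤ ENNReal.ofReal b) :
    ENNReal.ofReal (1 / (2 * Real.cosh (b * √(max (-K) 0 / N) / 2))) ≤
      distortion K N (1 / 2) θ := by
  rcases le_or_gt K 0 with hK | hK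
  · refine le_trans (le_of_eq ?_) (distortion_half_antitone hK hN h ENNReal.ofReal_ne_top)
    rw [distortion_half_of_nonpos hK hN ENNReal.ofReal_ne_top, ENNReal.toReal_ofReal hb,
      max_eq_left (by linarith)]
  · refine le_trans ?_ (distortion_half_monotone hK hN (zero_le (a := θ)))
    rw [distortion_of_eq_zero (Or.inr rfl), max_eq_right (by linarith)]
    simp

lemma distortion_zero (hθ : IsSubcritical K N θ) : distortion K N 0 θ = 0 := by
  by_cases h : K = 0 ∨ θ = 0
  · rw [distortion_of_eq_zero h, ENNReal.ofReal_zero]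
  push Not at h
  rcases lt_or_gt_of_ne h.1 with hK | hK
  · rw [distortion_of_neg hK h.2 hθ.1]; simp
  · rw [distortion_of_pos hK h.2 hθ.1 (hθ.2.resolve_left hK.not_ge)]; simp

lemma distortion_one (hθ : IsSubcritical K N θ) (hN : 0 < N) : distortion K N 1 θ = 1 := by
  by_cases h : K = 0 ∨ θ = 0
  · rw [distortion_of_eq_zero h, ENNReal.ofReal_one]
  push Not at h
  have ht := ENNReal.toReal_pos h.2 hθ.1
  rcases lt_or_gt_of_ne h.1 with hK | hK
  · have hx : 0 < θ.toReal * √(-K / N) :=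
      mul_pos ht (Real.sqrt_pos.2 (div_pos (neg_pos.2 hK) hN))
    rw [distortion_of_neg hK h.2 hθ.1, one_mul, div_self (Real.sinh_pos_iff.2 hx).ne',
      ENNReal.ofReal_one]
  · have h' := hθ.2.resolve_left hK.not_ge
    have hx : 0 < θ.toReal * √(K / N) := mul_pos ht (Real.sqrt_pos.2 (div_pos hK hN))
    rw [distortion_of_pos hK h.2 hθ.1 h', one_mul, div_self
      (Real.sin_pos_of_pos_of_lt_pi hx (mul_sqrt_lt_pi hK hN h')).ne', ENNReal.ofReal_one]

lemma continuous_distortion (hθ : IsSubcritical K N θ) :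
    Continuous fun r => distortion K N r θ := by
  by_cases h : K = 0 ∨ θ = 0
  · simp_rw [distortion_of_eq_zero h]
    exact ENNReal.continuous_ofReal
  push Not at h
  rcases lt_or_gt_of_ne h.1 with hK | hK
  · simp_rw [distortion_of_neg hK h.2 hθ.1]
    exact ENNReal.continuous_ofReal.comp ((Real.continuous_sinh.comp
      (continuous_id.mul continuous_const)).div_const _)
  · simp_rw [distortion_of_pos hK h.2 hθ.1 (hθ.2.resolve_left hK.not_ge)]
    exact ENNReal.continuous_ofReal.comp ((Real.continuous_sin.comp
      (continuous_id.mul continuous_const)).div_const _)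

/-- Distortion coefficients solve a linear second order equation in `r`, hence interpolate
exactly. -/
lemma distortion_midpoint (hθ : IsSubcritical K N θ) (hN : 0 < N) {t h : ℝ} (hh : 0 < h)
    (h0 : 0 ≤ t - h) (h1 : t + h ≤ 1) :
    distortion K N (1 / 2) (ENNReal.ofReal (2 * h) * θ) *
      (distortion K N (t - h) θ + distortion K N (t + h) θ) = distortion K N t θ := by
  by_cases hz : K = 0 ∨ θ = 0
  · have hz' : K = 0 ∨ ENNReal.ofReal (2 * h) * θ = 0 := hz.imp id fun h => by rw [h, mul_zero]
    rw [distortion_of_eq_zero hz, distortion_of_eq_zero hz, distortion_of_eq_zero hz,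
      distortion_of_eq_zero hz', ← ENNReal.ofReal_add h0 (by linarith),
      ← ENNReal.ofReal_mul (by norm_num)]
    congr 1
    ring
  push Not at hz
  have ht := ENNReal.toReal_pos hz.2 hθ.1
  have htop : ENNReal.ofReal (2 * h) * θ ≠ ⊤ := ENNReal.mul_ne_top ENNReal.ofReal_ne_top hθ.1
  have hreal : (ENNReal.ofReal (2 * h) * θ).toReal = 2 * h * θ.toReal := by
    rw [ENNReal.toReal_mul, ENNReal.toReal_ofReal (by linarith)]
  rcases lt_or_gt_of_ne hz.1 with hK | hK
  · have hx : 0 < θ.toReal * √(-K / N) :=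
      mul_pos ht (Real.sqrt_pos.2 (div_pos (neg_pos.2 hK) hN))
    rw [distortion_half_of_nonpos hK.le hN htop, distortion_of_neg hK hz.2 hθ.1,
      distortion_of_neg hK hz.2 hθ.1, distortion_of_neg hK hz.2 hθ.1, hreal]
    rw [show 2 * h * θ.toReal * √(-K / N) / 2 = h * (θ.toReal * √(-K / N)) by ring]
    set x := θ.toReal * √(-K / N)
    have hs := Real.sinh_pos_iff.2 hx
    have hc := Real.cosh_pos (h * x)
    have hn : ∀ r, 0 ≤ r → 0 ≤ Real.sinh (r * x) / Real.sinh x := fun r hr =>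
      div_nonneg (Real.sinh_nonneg_iff.2 (mul_nonneg hr hx.le)) hs.le
    rw [← ENNReal.ofReal_add (hn _ h0) (hn _ (by linarith)), ← ENNReal.ofReal_mul (by positivity)]
    congr 1
    rw [sub_mul, add_mul, Real.sinh_sub, Real.sinh_add]
    field_simp
    ring
  · have h' := hθ.2.resolve_left hK.not_ge
    have hx : 0 < θ.toReal * √(K / N) := mul_pos ht (Real.sqrt_pos.2 (div_pos hK hN))
    have hxpi := mul_sqrt_lt_pi hK hN h'
    have h2h : 2 * h ≤ 1 := by linarith
    have hsub : IsSubcritical K N (ENNReal.ofReal (2 * h) * θ) := ⟨htop, Or.inr (by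
      rw [hreal]
      refine lt_of_le_of_lt (mul_le_mul_of_nonneg_left
        (pow_le_pow_left₀ (by positivity) ?_ 2) hK.le) h'
      exact mul_le_of_le_one_left ht.le h2h)⟩
    rw [distortion_half_of_pos hK hN hsub, distortion_of_pos hK hz.2 hθ.1 h',
      distortion_of_pos hK hz.2 hθ.1 h', distortion_of_pos hK hz.2 hθ.1 h', hreal]
    rw [show 2 * h * θ.toReal * √(K / N) / 2 = h * (θ.toReal * √(K / N)) by ring]
    set x := θ.toReal * √(K / N)
    have hs := Real.sin_pos_of_pos_of_lt_pi hx hxpi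
    have hc : 0 < Real.cos (h * x) :=
      Real.cos_pos_of_mem_Ioo ⟨by nlinarith [Real.pi_pos], by nlinarith⟩
    have hn : ∀ r, 0 ≤ r → r ≤ 1 → 0 ≤ Real.sin (r * x) / Real.sin x := fun r hr hr1 =>
      div_nonneg (Real.sin_nonneg_of_nonneg_of_le_pi (mul_nonneg hr hx.le) (by nlinarith)) hs.le
    rw [← ENNReal.ofReal_add (hn _ h0 (by linarith)) (hn _ (by linarith) h1),
      ← ENNReal.ofReal_mul (by positivity)]
    congr 1
    rw [sub_mul, add_mul, Real.sin_sub, Real.sin_add]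
    field_simp
    ring

/-- The two-sided interpolation between values `a` and `b` at the end points, compared with finer
coefficients at scale `2 h`. -/
lemma distortion_interpolation (hθ : IsSubcritical K N θ) (hN : 0 < N) (a b : ℝ≥0∞) {t h : ℝ}
    (hh : 0 < h) (h0 : 0 ≤ t - h) (h1 : t + h ≤ 1) :
    distortion K N (1 - t) θ * a + distortion K N t θ * b =
      distortion K N (1 / 2) (ENNReal.ofReal (2 * h) * θ) *
      ((distortion K N (1 - (t - h)) θ * a + distortion K N (t - h) θ * b) +
        (distortion K N (1 - (t + h)) θ * a + distortion K N (t + h) θ * b)) := by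
  rw [← distortion_midpoint hθ hN hh h0 h1, ← distortion_midpoint (t := 1 - t) hθ hN hh
    (by linarith) (by linarith), show 1 - t - h = 1 - (t + h) by ring,
    show 1 - t + h = 1 - (t - h) by ring]
  ring

end Distortion

/-! ### Stability of the bounds under weak limits -/

section Limits

lemma expFunctional_ne_top {X : Type*} [MeasurableSpace X] {m : Measure X}
    {ν : ProbabilityMeasure X} {J : Set X} {N : ℝ} (hN : 0 < N) (hJ : MeasurableSet J)
    (hmJ : m J ≠ ⊤) (hνJ : (ν : Measure X) Jᶜ = 0) : expFunctional (relEntropy m) N ν ≠ ⊤ := by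
  by_cases h : relEntropy m ν = ⊤
  · by_cases h0 : expFunctional (relEntropy m) N ν = 0
    · rw [h0]; exact ENNReal.zero_ne_top
    · exact absurd h (ne_top_of_expFunctional_ne_zero hN h0)
  · rw [expFunctional_eq (relEntropy_eq_integral (absolutelyContinuous_of_relEntropy_ne_top h)
      (integrable_of_relEntropy_ne_top hJ hmJ hνJ h))]
    exact ENNReal.ofReal_ne_top

variable {X : Type*} [MetricSpace X] [MeasurableSpace X] [BorelSpace X] {m : Measure X}
  [SigmaFinite m] {ν : ProbabilityMeasure X} {J : Set X} {N C : ℝ}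

/-- Among measures with density at most `C`, lower bounds on `exp (-Ent / N)` are lower bounds on
the dual entropy, which is upper semicontinuous. -/
lemma ofReal_le_expFunctional_iff (hN : 0 < N) (hJ : MeasurableSet J) (hmJ : m J ≠ ⊤)
    (hνJ : (ν : Measure X) Jᶜ = 0) (hC : 0 < C) (h : (ν : Measure X) ≤ ENNReal.ofReal C • m)
    {x : ℝ} (hx : 0 < x) :
    ENNReal.ofReal x ≤ expFunctional (relEntropy m) N ν ↔
      ENNReal.ofReal (1 + Real.log C + N * Real.log x) ≤
        dualEntropy (ENNReal.ofReal C • m.restrict J) ν := by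
  have hac := absolutelyContinuous_of_le_smul h
  have hint := integrable_of_le hJ hmJ hνJ hC.le h
  obtain ⟨h1, h2⟩ := dualEntropy_le_ofReal hJ hmJ hνJ hC h
  rw [le_antisymm h2 (ofReal_le_dualEntropy hJ hνJ hC hac hint),
    expFunctional_eq (relEntropy_eq_integral hac hint), ENNReal.ofReal_le_ofReal_iff h1,
    ENNReal.ofReal_le_ofReal_iff (Real.exp_pos _).le, ← Real.log_le_iff_le_exp hx, le_div_iff₀ hN]
  constructor <;> intro h <;> linarith

/-- A weak limit of measures with uniformly bounded densities has the same density bound, and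
inherits lower bounds on `exp (-Ent / N)`. -/
lemma le_of_ultrafilter_limit (hN : 0 < N) (hJ : IsCompact J) (hmJ : m J ≠ ⊤) (hC : 0 < C)
    {u : Ultrafilter ℕ} {κ : ℕ → ProbabilityMeasure X} (hκν : Tendsto κ u (𝓝 ν))
    (hκJ : ∀ n, ∀ᵐ x ∂(κ n : Measure X), x ∈ J)
    (hκC : ∀ n, (κ n : Measure X) ≤ ENNReal.ofReal C • m) :
    (∀ᵐ x ∂(ν : Measure X), x ∈ J) ∧ (ν : Measure X) ≤ ENNReal.ofReal C • m ∧
      ∀ (v : ℕ → ℝ≥0∞) (w : ℝ≥0∞), Tendsto v u (𝓝 w) →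
        (∀ n, v n ≤ expFunctional (relEntropy m) N (κ n)) →
        w ≤ expFunctional (relEntropy m) N ν := by
  have hfinr : IsFiniteMeasure (m.restrict J) := ⟨by
    rw [Measure.restrict_apply_univ]; exact hmJ.lt_top⟩
  have hfin : IsFiniteMeasure (ENNReal.ofReal C • m.restrict J) :=
    Measure.smul_finite _ ENNReal.ofReal_ne_top
  have hνJ : ∀ᵐ x ∂(ν : Measure X), x ∈ J :=
    (ProbabilityMeasure.isClosed_setOf_ae_mem hJ.isClosed).mem_of_tendsto hκν
      (Eventually.of_forall hκJ)
  have hle : (ν : Measure X) ≤ ENNReal.ofReal C • m.restrict J := by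
    refine (ProbabilityMeasure.isClosed_setOf_le _).mem_of_tendsto hκν
      (Eventually.of_forall fun n => ?_)
    change (κ n : Measure X) ≤ _
    rw [← Measure.restrict_eq_self_of_ae_mem (hκJ n), ← Measure.restrict_smul]
    exact Measure.restrict_mono_measure (hκC n) J
  have hνC : (ν : Measure X) ≤ ENNReal.ofReal C • m := by
    rw [← Measure.restrict_smul] at hle
    exact hle.trans Measure.restrict_le_self
  refine ⟨hνJ, hνC, fun v w hvw hv => ?_⟩
  refine le_of_forall_lt fun r hr => ?_
  obtain ⟨y, hry, hyw⟩ := ENNReal.lt_iff_exists_nnreal_btwn.1 hr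
  refine hry.trans_le ?_
  have hy : (0 : ℝ) < y := by
    have : (0 : ℝ≥0∞) < y := zero_le.trans_lt hry
    exact_mod_cast this
  rw [← ENNReal.ofReal_coe_nnreal,
    ofReal_le_expFunctional_iff hN hJ.measurableSet hmJ hνJ hC hνC hy]
  refine ((upperSemicontinuous_dualEntropy _).isClosed_preimage
    (ENNReal.ofReal (1 + Real.log C + N * Real.log y))).mem_of_tendsto hκν ?_
  filter_upwards [hvw.eventually_const_lt hyw] with n hn
  refine (ofReal_le_expFunctional_iff hN hJ.measurableSet hmJ (hκJ n) hC (hκC n) hy).1 ?_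
  rw [ENNReal.ofReal_coe_nnreal]
  exact hn.le.trans (hv n)

end Limits

/-! ### The profile of the density bounds -/

/-- The profile `t ↦ b * cosh ((1 / 2 - t) * a) / cosh (a / 2)`, which solves `g'' = a ^ 2 * g` with
boundary values `b`. -/
def coshProfile (a b t : ℝ) : ℝ := b * (Real.cosh ((1 / 2 - t) * a) / Real.cosh (a / 2))

lemma coshProfile_pos {a b : ℝ} (hb : 0 < b) (t : ℝ) : 0 < coshProfile a b t :=
  mul_pos hb (div_pos (Real.cosh_pos _) (Real.cosh_pos _))

lemma coshProfile_zero (a b : ℝ) : coshProfile a b 0 = b := by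
  rw [coshProfile, sub_zero, one_div_mul_eq_div, div_self (Real.cosh_pos _).ne', mul_one]

lemma coshProfile_one (a b : ℝ) : coshProfile a b 1 = b := by
  rw [coshProfile, show (1 / 2 - 1) * a = -(a / 2) by ring, Real.cosh_neg,
    div_self (Real.cosh_pos _).ne', mul_one]

lemma coshProfile_midpoint (a b t h : ℝ) :
    1 / (2 * Real.cosh (h * a)) * (coshProfile a b (t - h) + coshProfile a b (t + h)) =
      coshProfile a b t := by
  unfold coshProfile
  rw [show (1 / 2 - (t - h)) * a = (1 / 2 - t) * a + h * a by ring,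
    show (1 / 2 - (t + h)) * a = (1 / 2 - t) * a - h * a by ring, Real.cosh_add, Real.cosh_sub]
  have h1 := Real.cosh_pos (h * a)
  have h2 := Real.cosh_pos (a / 2)
  field_simp
  ring

lemma coshProfile_rpow_le {a b N : ℝ} (ha : 0 ≤ a) (hb : 0 < b) (hN : 0 < N) (t : ℝ) :
    coshProfile a b t ^ (-N) ≤ Real.exp (N * a / 2) * b ^ (-N) := by
  have h1 : b * Real.exp (-(a / 2)) ≤ coshProfile a b t := by
    refine mul_le_mul_of_nonneg_left ?_ hb.le
    rw [Real.exp_neg, le_div_iff₀ (Real.cosh_pos _), inv_mul_eq_div]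
    refine le_trans ?_ (Real.one_le_cosh _)
    rw [div_le_one (Real.exp_pos _), Real.cosh_eq]
    have : Real.exp (-(a / 2)) ≤ Real.exp (a / 2) := Real.exp_le_exp.2 (by linarith)
    linarith
  refine (Real.rpow_le_rpow_of_nonpos (by positivity) h1 (by linarith)).trans (le_of_eq ?_)
  rw [Real.mul_rpow hb.le (Real.exp_pos _).le, ← Real.exp_mul, mul_comm]
  congr 2
  ring

namespace LorentzianPreLength

section OptimalCouplings

variable {M : Type*} [MetricSpace M] [ProperSpace M] [MeasurableSpace M] [BorelSpace M]
  {L : LorentzianPreLength M} {p : ℝ}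

lemma IsTame.continuousOn_tauNorm (hL : L.IsTame) {q : ℝ} (hq : 0 ≤ q) {K : Set (M × M)}
    (hK : IsCompact K) : ContinuousOn (fun π : ProbabilityMeasure (M × M) => L.tauNorm q π)
      {π | ∀ᵐ z ∂(π : Measure (M × M)), z ∈ K} :=
  ENNReal.continuous_rpow_const.comp_continuousOn (hL.continuousOn_profit hq hK)

lemma IsTame.isCompact_optimalCouplings (hL : L.IsTame) (hp : 0 < p) {K : Set M}
    (hK : IsCompact K) {μ ν : ProbabilityMeasure M} (hμ : ∀ᵐ x ∂(μ : Measure M), x ∈ K)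
    (hν : ∀ᵐ x ∂(ν : Measure M), x ∈ K) :
    IsCompact {π : ProbabilityMeasure (M × M) | L.IsOptimalCoupling p π μ ν} := by
  rcases eq_empty_or_nonempty
    {π : ProbabilityMeasure (M × M) | L.IsOptimalCoupling p π μ ν} with h | ⟨π₀, hπ₀⟩
  · rw [h]; exact isCompact_empty
  have hc := hL.isCompact_couplings hK hμ hν
  have hcont : ContinuousOn (fun π : ProbabilityMeasure (M × M) => L.profit p π)
      {π | L.IsCausalCoupling π μ ν} :=
    (hL.continuousOn_profit hp.le (hK.prod hK)).mono fun π hπ => by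
      filter_upwards [hπ.1.ae_fst hμ, hπ.1.ae_snd hν] with z h2 h3 using ⟨h2, h3⟩
  convert hc.of_isClosed_subset
    (hcont.preimage_isClosed_of_isClosed hc.isClosed (isClosed_Ici (a := L.profit p π₀)))
    inter_subset_left using 1
  have hopt := (isOptimalCoupling_iff hp).1 hπ₀
  ext π
  constructor
  · exact fun h => ⟨h.1, ((isOptimalCoupling_iff hp).1 h).2 _ hπ₀.1⟩
  · exact fun h => (isOptimalCoupling_iff hp).2 ⟨h.1, fun σ hσ => (hopt.2 σ hσ).trans h.2⟩

/-- Among the optimal couplings there is one whose `L²`-distance is extremal, in the direction that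
makes its distortion coefficients the smallest ones. -/
lemma IsTame.exists_extremal (hL : L.IsTame) (hp : 0 < p) {C : Set M} (hC : IsCompact C)
    {μ ν : ProbabilityMeasure M} (hμ : ∀ᵐ x ∂(μ : Measure M), x ∈ C)
    (hν : ∀ᵐ x ∂(ν : Measure M), x ∈ C) (hopt : ∃ π, L.IsOptimalCoupling p π μ ν) {K : ℝ} :
    ∃ π, L.IsOptimalCoupling p π μ ν ∧ ∀ σ, L.IsOptimalCoupling p σ μ ν →
      (K ≤ 0 → L.tauNorm 2 σ ≤ L.tauNorm 2 π) ∧ (0 < K → L.tauNorm 2 π ≤ L.tauNorm 2 σ) := by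
  obtain ⟨π₀, hπ₀⟩ := hopt
  have hcomp := hL.isCompact_optimalCouplings hp hC hμ hν
  have hne : {π : ProbabilityMeasure (M × M) | L.IsOptimalCoupling p π μ ν}.Nonempty :=
    ⟨⟨π₀, hπ₀.1.isProbabilityMeasure⟩, hπ₀⟩
  have hcont : ContinuousOn (fun π : ProbabilityMeasure (M × M) => L.tauNorm 2 π)
      {π | L.IsOptimalCoupling p π μ ν} :=
    (hL.continuousOn_tauNorm two_pos.le (hC.prod hC)).mono fun π hπ => by
      filter_upwards [hπ.1.1.ae_fst hμ, hπ.1.1.ae_snd hν] with z h2 h3 using ⟨h2, h3⟩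
  rcases le_or_gt K 0 with hK | hK
  · obtain ⟨π, hπ, hmax⟩ := hcomp.exists_isMaxOn hne hcont
    exact ⟨π, hπ, fun σ hσ => ⟨fun _ => hmax (a := ⟨σ, hσ.1.isProbabilityMeasure⟩) hσ,
      fun h => absurd h hK.not_gt⟩⟩
  · obtain ⟨π, hπ, hmin⟩ := hcomp.exists_isMinOn hne hcont
    exact ⟨π, hπ, fun σ hσ => ⟨fun h => absurd h hK.not_ge,
      fun _ => hmin (a := ⟨σ, hσ.1.isProbabilityMeasure⟩) hσ⟩⟩

/-- Weak limits of causal couplings are causal couplings, with convergence of the cost. -/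
lemma IsTame.exists_limit_coupling (hL : L.IsTame) {q : ℝ} (hq : 0 ≤ q) {K : Set M}
    (hK : IsCompact K) {u : Ultrafilter ℕ} {κ κ' : ℕ → ProbabilityMeasure M}
    {μ ν : ProbabilityMeasure M} (hκ : Tendsto κ u (𝓝 μ)) (hκ' : Tendsto κ' u (𝓝 ν))
    (hκK : ∀ n, ∀ᵐ x ∂(κ n : Measure M), x ∈ K) (hκK' : ∀ n, ∀ᵐ x ∂(κ' n : Measure M), x ∈ K)
    {v : ℕ → ℝ≥0∞} {w : ℝ≥0∞} (hv : Tendsto v u (𝓝 w))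
    (h : ∀ n, ∃ π, L.IsCausalCoupling π (κ n) (κ' n) ∧ v n ≤ L.tauNorm q π) :
    ∃ π, L.IsCausalCoupling π μ ν ∧ w ≤ L.tauNorm q π := by
  choose π hπ hvπ using h
  let P : ℕ → ProbabilityMeasure (M × M) := fun n => ⟨π n, (hπ n).isProbabilityMeasure⟩
  have hPK : ∀ n, P n ∈ {π : ProbabilityMeasure (M × M) |
      ∀ᵐ z ∂(π : Measure (M × M)), z ∈ K ×ˢ K} := fun n => by
    change ∀ᵐ z ∂π n, z ∈ K ×ˢ K
    filter_upwards [(hπ n).1.ae_fst (hκK n), (hπ n).1.ae_snd (hκK' n)] with z h2 h3 using ⟨h2, h3⟩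
  obtain ⟨π', hπ'K, hlim⟩ := (ProbabilityMeasure.isCompact_setOf_ae_mem
    (hK.prod hK)).ultrafilter_le_nhds (u.map P)
    (tendsto_principal.2 (Eventually.of_forall hPK))
  replace hlim : Tendsto P u (𝓝 π') := hlim
  refine ⟨π', ⟨⟨?_, ?_⟩, ?_⟩, ?_⟩
  · have h1 := ((ProbabilityMeasure.continuous_map continuous_fst).tendsto π').comp hlim
    have h2 : π'.map continuous_fst.measurable.aemeasurable = μ :=
      tendsto_nhds_unique (h1.congr fun n => Subtype.ext (hπ n).1.1) hκ
    exact congrArg Subtype.val h2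
  · have h1 := ((ProbabilityMeasure.continuous_map continuous_snd).tendsto π').comp hlim
    have h2 : π'.map continuous_snd.measurable.aemeasurable = ν :=
      tendsto_nhds_unique (h1.congr fun n => Subtype.ext (hπ n).1.2) hκ'
    exact congrArg Subtype.val h2
  · exact (ProbabilityMeasure.isClosed_setOf_ae_mem hL.isClosed_le).mem_of_tendsto hlim
      (Eventually.of_forall fun n => (hπ n).2)
  · have h1 : Tendsto (fun n => L.tauNorm q (P n)) u (𝓝 (L.tauNorm q π')) :=
      (hL.continuousOn_tauNorm hq (hK.prod hK) π' hπ'K).tendsto.comp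
        (tendsto_nhdsWithin_iff.2 ⟨hlim, Eventually.of_forall hPK⟩)
    exact le_of_tendsto_of_tendsto' hv h1 hvπ

end OptimalCouplings

end LorentzianPreLength

/-! ### Passing to the limit along dyadic chains -/

lemma tendsto_floor_mul_two_pow_div {t : ℝ} (ht : 0 ≤ t) :
    Tendsto (fun n : ℕ => (⌊t * 2 ^ n⌋₊ : ℝ) / 2 ^ n) atTop (𝓝 t) :=
  (tendsto_nat_floor_mul_div_atTop ht).comp (tendsto_pow_atTop_atTop_of_one_lt one_lt_two)

namespace LorentzianPreLength

section Geodesic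

variable {M : Type*} [MetricSpace M] [ProperSpace M] [MeasurableSpace M] [BorelSpace M]
  {L : LorentzianPreLength M} {p : ℝ}

/-- The extremal `L²`-distance of optimal couplings is subcritical, since the exponentiated entropy
of a midpoint is finite. -/
lemma IsTame.exists_extremal_coupling (hL : L.IsTame) (hp₀ : 0 < p) (hp₁ : p < 1) {m : Measure M}
    [IsLocallyFiniteMeasure m] {K N : ℝ} (hN : 0 < N) (hTCD : L.WTCD m p K N) {J : Set M}
    (hJ : IsCompact J) {μ₀ μ₁ : ProbabilityMeasure M}
    (hμ₀ : ∀ᵐ x ∂(μ₀ : Measure M), x ∈ J) (hμ₁ : ∀ᵐ x ∂(μ₁ : Measure M), x ∈ J)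
    {Γ : Set (M × M)} (hdual : L.IsDualSet p Γ μ₀ μ₁) (hopt : ∃ π, L.IsOptimalCoupling p π μ₀ μ₁)
    {B : ℝ} (hB : 0 < B) (hμ₀B : (μ₀ : Measure M) ≤ ENNReal.ofReal B • m)
    (hμ₁B : (μ₁ : Measure M) ≤ ENNReal.ofReal B • m) :
    ∃ π, L.IsOptimalCoupling p π μ₀ μ₁ ∧ IsSubcritical K N (L.tauNorm 2 π) ∧
      ∀ σ, L.IsOptimalCoupling p σ μ₀ μ₁ → ∀ c : ℝ, distortion K N (1 / 2)
        (ENNReal.ofReal c * L.tauNorm 2 π) ≤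
          distortion K N (1 / 2) (ENNReal.ofReal c * L.tauNorm 2 σ) := by
  obtain ⟨π, hπ, hext⟩ := hL.exists_extremal hp₀ hJ hμ₀ hμ₁ hopt (K := K)
  have htop : ∀ σ, L.IsOptimalCoupling p σ μ₀ μ₁ → L.tauNorm 2 σ ≠ ⊤ := fun σ hσ =>
    hL.tauNorm_ne_top two_pos hJ hσ.1.1 hμ₀ hμ₁
  refine ⟨π, hπ, ⟨htop π hπ, ?_⟩, fun σ hσ c => ?_⟩
  · refine or_iff_not_imp_left.2 fun hK => ?_
    rw [not_le] at hK
    obtain ⟨π', ρ, hπ', hρ, hU⟩ := hTCD.exists_midpoint hL hp₀ hp₁ hJ hμ₀ hμ₁ hdual hπ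
      (mem_finiteDomain hJ hμ₀ hB.le hμ₀B) (mem_finiteDomain hJ hμ₁ hB.le hμ₁B)
    have hJ' := hL.isCompact_diamond J J hJ hJ
    have hUρ : expFunctional (relEntropy m) N ρ ≠ ⊤ :=
      expFunctional_ne_top hN hJ'.measurableSet hJ'.measure_ne_top (hρ.ae_mem hL hJ hμ₀ hμ₁)
    have hU₀ : expFunctional (relEntropy m) N μ₀ ≠ 0 :=
      ((ENNReal.ofReal_pos.2 (Real.rpow_pos_of_pos hB _)).trans_le
        (ofReal_rpow_le_expFunctional hN hJ.measurableSet hJ.measure_ne_top hμ₀ hB hμ₀B)).ne'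
    have hsub : IsSubcritical K N (L.tauNorm 2 π') := by
      by_contra h
      rw [distortion_of_not_subcritical h hK hN, ENNReal.top_mul (by simp [hU₀]), top_le_iff] at hU
      exact hUρ hU
    refine lt_of_le_of_lt (mul_le_mul_of_nonneg_left (pow_le_pow_left₀ ENNReal.toReal_nonneg
      (ENNReal.toReal_mono hsub.1 ((hext π' hπ').2 hK)) 2) hK.le) (hsub.2.resolve_left hK.not_ge)
  · rcases le_or_gt K 0 with hK | hK
    · exact distortion_half_antitone hK hN (mul_le_mul_right ((hext σ hσ).1 hK) _)
        (ENNReal.mul_ne_top ENNReal.ofReal_ne_top (htop π hπ))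
    · exact distortion_half_monotone hK hN (mul_le_mul_right ((hext σ hσ).2 hK) _)

/-- Chains on finer and finer dyadic grids have a limit curve, along a fixed ultrafilter. -/
lemma IsTame.exists_limit_curve (hL : L.IsTame) (hp₀ : 0 < p) (hp₁ : p < 1) {m : Measure M}
    [IsLocallyFiniteMeasure m] {N C : ℝ} (hN : 0 < N) (hC : 0 < C) {J : Set M} (hJ : IsCompact J)
    {μ₀ μ₁ : ProbabilityMeasure M} {G : ℝ → ℝ≥0∞} (hG : Continuous G) {ℓ : ℝ≥0∞} (hℓ : ℓ ≠ ⊤)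
    {κ : ℕ → ℕ → ProbabilityMeasure M} (hκ₀ : ∀ n, κ n 0 = μ₀) (hκ₁ : ∀ n, κ n (2 ^ n) = μ₁)
    (hκJ : ∀ n, ∀ i ≤ 2 ^ n, ∀ᵐ x ∂(κ n i : Measure M), x ∈ J)
    (hκC : ∀ n, ∀ i ≤ 2 ^ n, (κ n i : Measure M) ≤ ENNReal.ofReal C • m)
    (hκG : ∀ n, ∀ i : ℕ, i ≤ 2 ^ n → G (i / 2 ^ n) ≤ expFunctional (relEntropy m) N (κ n i))
    (hκℓ : ∀ n, ∀ i < 2 ^ n, ∃ π, L.IsCausalCoupling π (κ n i) (κ n (i + 1)) ∧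
      ℓ / 2 ^ n ≤ L.tauNorm p π) :
    ∃ μ : unitInterval → ProbabilityMeasure M, μ 0 = μ₀ ∧ μ 1 = μ₁ ∧
      (∀ t, (∀ᵐ x ∂(μ t : Measure M), x ∈ J) ∧ (μ t : Measure M) ≤ ENNReal.ofReal C • m ∧
        G t ≤ expFunctional (relEntropy m) N (μ t)) ∧
      ∀ s t, s ≤ t → ∃ π, L.IsCausalCoupling π (μ s) (μ t) ∧
        ENNReal.ofReal (t - s) * ℓ ≤ L.tauNorm p π := by
  let u : Ultrafilter ℕ := hyperfilter ℕ
  have hu : (u : Filter ℕ) ≤ atTop := Nat.hyperfilter_le_atTop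
  have hfloor : ∀ (t : unitInterval) (n : ℕ), ⌊(t : ℝ) * 2 ^ n⌋₊ ≤ 2 ^ n := fun t n =>
    Nat.floor_le_of_le (by
      push_cast
      exact mul_le_of_le_one_left (by positivity) t.2.2)
  have hlim : ∀ t : unitInterval, ∃ ν : ProbabilityMeasure M,
      Tendsto (fun n => κ n ⌊(t : ℝ) * 2 ^ n⌋₊) u (𝓝 ν) := fun t => by
    obtain ⟨ν, -, hν⟩ := (ProbabilityMeasure.isCompact_setOf_ae_mem hJ).ultrafilter_le_nhds
      (u.map fun n => κ n ⌊(t : ℝ) * 2 ^ n⌋₊)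
      (tendsto_principal.2 (Eventually.of_forall fun n => hκJ n _ (hfloor t n)))
    exact ⟨ν, hν⟩
  choose μ hμ using hlim
  have htime : ∀ t : unitInterval,
      Tendsto (fun n : ℕ => (⌊(t : ℝ) * 2 ^ n⌋₊ : ℝ) / 2 ^ n) u (𝓝 (t : ℝ)) := fun t =>
    (tendsto_floor_mul_two_pow_div t.2.1).mono_left hu
  refine ⟨μ, ?_, ?_, fun t => ?_, fun s t hst => ?_⟩
  · refine tendsto_nhds_unique (hμ 0) (tendsto_const_nhds.congr fun n => ?_)
    simp [hκ₀]
  · refine tendsto_nhds_unique (hμ 1) (tendsto_const_nhds.congr fun n => ?_)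
    have h : ⌊((1 : unitInterval) : ℝ) * 2 ^ n⌋₊ = 2 ^ n := by
      rw [Set.Icc.coe_one, one_mul]
      exact_mod_cast Nat.floor_natCast (R := ℝ) (2 ^ n)
    rw [h, hκ₁]
  · obtain ⟨h1, h2, h3⟩ := le_of_ultrafilter_limit hN hJ hJ.measure_ne_top hC (hμ t)
      (fun n => hκJ n _ (hfloor t n)) (fun n => hκC n _ (hfloor t n))
    exact ⟨h1, h2, h3 _ _ ((hG.tendsto _).comp (htime t)) fun n => hκG n _ (hfloor t n)⟩
  · refine hL.exists_limit_coupling hp₀.le hJ (hμ s) (hμ t) (fun n => hκJ n _ (hfloor s n))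
      (fun n => hκJ n _ (hfloor t n)) (ENNReal.Tendsto.mul_const
        (ENNReal.tendsto_ofReal ((htime t).sub (htime s))) (Or.inr hℓ)) fun n => ?_
    have hle : ⌊(s : ℝ) * 2 ^ n⌋₊ ≤ ⌊(t : ℝ) * 2 ^ n⌋₊ := Nat.floor_mono
      (mul_le_mul_of_nonneg_right hst (by positivity))
    obtain ⟨k, hk⟩ := Nat.exists_eq_add_of_le hle
    obtain ⟨π, hπ, h⟩ := hL.exists_tauNorm_chain hp₀ hp₁ hJ (hκJ n) (hκℓ n)
      (i := ⌊(s : ℝ) * 2 ^ n⌋₊) k (hk ▸ hfloor t n)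
    rw [← hk] at hπ
    refine ⟨π, hπ, (le_of_eq ?_).trans h⟩
    rw [hk, Nat.cast_add, ← sub_div, add_sub_cancel_left, ENNReal.ofReal_div_of_pos (by positivity),
      ENNReal.ofReal_natCast, ENNReal.ofReal_pow two_pos.le, ENNReal.ofReal_ofNat]
    simp only [div_eq_mul_inv]
    ring

/-- If the linear function is a lower bound of the transport cost along a curve, then the curve is a
geodesic, by the reverse triangle inequality. -/
lemma IsTame.isCostGeodesic (hL : L.IsTame) (hp₀ : 0 < p) (hp₁ : p < 1) {J : Set M}
    (hJ : IsCompact J) {μ : unitInterval → ProbabilityMeasure M} {ℓ : ℝ≥0∞} (hℓ₀ : 0 < ℓ)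
    (hℓ : ℓ ≠ ⊤) (hcost : L.cost p (μ 0) (μ 1) = ℓ)
    (hμJ : ∀ t, ∀ᵐ x ∂(μ t : Measure M), x ∈ J)
    (hμ : ∀ s t, s ≤ t → ∃ π, L.IsCausalCoupling π (μ s) (μ t) ∧
      ENNReal.ofReal (t - s) * ℓ ≤ L.tauNorm p π) : L.IsCostGeodesic p μ := by
  have hfin : ∀ {s t : unitInterval} {π : Measure (M × M)}, L.IsCausalCoupling π (μ s) (μ t) →
      L.tauNorm p π ≠ ⊤ := fun h => hL.tauNorm_ne_top hp₀ hJ h.1 (hμJ _) (hμJ _)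
  refine ⟨?_, ?_, fun s t hst => ?_⟩
  · rw [hcost]; exact_mod_cast hℓ₀
  · rw [hcost]; exact lt_top_iff_ne_top.2 (mt EReal.coe_ennreal_eq_top_iff.1 hℓ)
  have hst' : (s : ℝ) ≤ t := hst.le
  rw [hcost, EReal.coe_mul_coe_ennreal (by linarith)]
  refine le_antisymm (iSup₂_le fun π hπ => ?_) ?_
  · obtain ⟨π₀, hπ₀, h₀⟩ := hμ 0 s unitInterval.nonneg'
    obtain ⟨π₁, hπ₁, h₁⟩ := hμ t 1 unitInterval.le_one'
    obtain ⟨χ, hχ, h2⟩ := hL.exists_tauNorm_add_le hp₀ hp₁ hπ₀ hπ (hfin hπ₀) (hfin hπ)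
    obtain ⟨χ', hχ', h3⟩ := hL.exists_tauNorm_add_le hp₀ hp₁ hχ hπ₁ (hfin hχ) (hfin hπ₁)
    have h4 : L.tauNorm p χ' ≤ ℓ := by
      have := tauNorm_le_cost (p := p) hχ'
      rw [hcost] at this
      exact_mod_cast this
    have h5 : ENNReal.ofReal (s - 0) * ℓ + L.tauNorm p π + ENNReal.ofReal (1 - t) * ℓ ≤ ℓ :=
      (add_le_add ((add_le_add_left h₀ _).trans h2) h₁).trans (h3.trans h4)
    have h6 : ENNReal.ofReal (s - 0) * ℓ + ENNReal.ofReal (t - s) * ℓ +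
        ENNReal.ofReal (1 - t) * ℓ = ℓ := by
      have ht1 := t.2.2
      have hs0 := s.2.1
      rw [← add_mul, ← add_mul, ← ENNReal.ofReal_add (by linarith) (by linarith),
        ← ENNReal.ofReal_add (by linarith) (by linarith)]
      ring_nf
      simp
    replace h5 := h5.trans_eq h6.symm
    have h7 := (ENNReal.add_le_add_iff_right
      (ENNReal.mul_ne_top ENNReal.ofReal_ne_top hℓ)).1 h5
    have h8 := (ENNReal.add_le_add_iff_left
      (ENNReal.mul_ne_top ENNReal.ofReal_ne_top hℓ)).1 h7
    exact_mod_cast h8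
  · obtain ⟨π, hπ, h⟩ := hμ s t hst.le
    exact (EReal.coe_ennreal_le_coe_ennreal_iff.2 h).trans (tauNorm_le_cost hπ)

end Geodesic

end LorentzianPreLength

theorem theorem1p2 {M : Type*} [MetricSpace M] [ProperSpace M] [MeasurableSpace M]
    [BorelSpace M] (L : LorentzianPreLength M)
    (m : Measure M) [IsLocallyFiniteMeasure m] [m.IsOpenPosMeasure]
    (hclosed : L.LocallyCausallyClosed) (hhyp : L.KGloballyHyperbolic)
    (hreg : L.IsRegular) (hgeo : L.IsGeodesicSpace)
    (p K N : ℝ) (hp₀ : 0 < p) (hp₁ : p < 1) (hN : 0 < N) (hTCD : L.WTCD m p K N)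
    (μ₀ μ₁ : ProbabilityMeasure M)
    (hc₀ : IsCompact (μ₀ : Measure M).support) (hc₁ : IsCompact (μ₁ : Measure M).support)
    (hac₀ : (μ₀ : Measure M) ≪ m) (hac₁ : (μ₁ : Measure M) ≪ m)
    (hdual : L.StronglyTimelikeDualizable p μ₀ μ₁)
    (hb₀ : densityBound m μ₀ < ⊤) (hb₁ : densityBound m μ₁ < ⊤)
    (D : ℝ≥0∞)
    (hD : D = ⨆ x ∈ (μ₀ : Measure M).support, ⨆ y ∈ (μ₁ : Measure M).support, L.τ x y) :
    D < ⊤ ∧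
    ∃ μ : unitInterval → ProbabilityMeasure M,
      L.IsCostGeodesic p μ ∧ μ 0 = μ₀ ∧ μ 1 = μ₁ ∧ L.IsGood m p K N μ ∧
      ∀ t : unitInterval,
        densityBound m (μ t) ≤
          ENNReal.ofReal (Real.exp (D.toReal * √(max (-K) 0 * N) / 2)) *
            max (densityBound m μ₀) (densityBound m μ₁) := by
  have hL : L.IsTame := LorentzianPreLength.isTame hclosed hhyp hreg hgeo
  set S : Set M := (μ₀ : Measure M).support ∪ (μ₁ : Measure M).support with hS
  have hSc : IsCompact S := hc₀.union hc₁
  have hDtop : D ≠ ⊤ := by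
    obtain ⟨B, hB⟩ := hL.exists_τ_le hSc
    refine ne_top_of_le_ne_top (ENNReal.coe_ne_top (r := B)) (hD ▸ ?_)
    exact iSup₂_le fun x hx => iSup₂_le fun y hy => hB x (Or.inl hx) y (Or.inr hy)
  refine ⟨hDtop.lt_top, ?_⟩
  set J : Set M := L.diamond S S with hJdef
  have hJ : IsCompact J := hL.isCompact_diamond S S hSc hSc
  have hsupp₀ := LorentzianPreLength.ae_mem_support (μ₀ : Measure M)
  have hsupp₁ := LorentzianPreLength.ae_mem_support (μ₁ : Measure M)
  have hμ₀J : ∀ᵐ x ∂(μ₀ : Measure M), x ∈ J := hsupp₀.mono fun x hx =>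
    LorentzianPreLength.subset_diamond S (Or.inl hx)
  have hμ₁J : ∀ᵐ x ∂(μ₁ : Measure M), x ∈ J := hsupp₁.mono fun x hx =>
    LorentzianPreLength.subset_diamond S (Or.inr hx)
  obtain ⟨Γ, hΓ⟩ := hdual.exists_isDualSet
  have hopt := hdual.exists_isOptimalCoupling
  have hπD : ∀ π, L.IsOptimalCoupling p π μ₀ μ₁ → ∀ᵐ z ∂π, L.τ z.1 z.2 ≤ D := fun π hπ => by
    filter_upwards [hπ.1.1.ae_fst hsupp₀, hπ.1.1.ae_snd hsupp₁] with z h0 h1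
    rw [hD]
    exact le_iSup₂_of_le z.1 h0 (le_iSup₂_of_le z.2 h1 le_rfl)
  -- the common density bound of the end points
  set R : ℝ≥0∞ := max (densityBound m μ₀) (densityBound m μ₁) with hR
  have hRtop : R ≠ ⊤ := (max_lt hb₀ hb₁).ne
  have hμ₀R : (μ₀ : Measure M) ≤ R • m := (densityBound_le_iff hac₀).1 (le_max_left _ _)
  have hμ₁R : (μ₁ : Measure M) ≤ R • m := (densityBound_le_iff hac₁).1 (le_max_right _ _)
  have hR0 : R ≠ 0 := fun h => by
    have h1 := hμ₀R univ
    simp [h] at h1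
  set B : ℝ := R.toReal with hBdef
  have hB : 0 < B := ENNReal.toReal_pos hR0 hRtop
  have hRB : R = ENNReal.ofReal B := (ENNReal.ofReal_toReal hRtop).symm
  rw [hRB] at hμ₀R hμ₁R
  -- the profile `g` of the density bounds `g ^ (-N)`, with the value `B ^ (-1 / N)` at both ends
  set a : ℝ := D.toReal * √(max (-K) 0 / N) with ha
  have ha0 : 0 ≤ a := by positivity
  set b : ℝ := B ^ (-1 / N) with hb
  have hb0 : 0 < b := Real.rpow_pos_of_pos hB _
  have hbN : b ^ (-N) = B := by
    rw [hb, ← Real.rpow_mul hB.le, show -1 / N * -N = 1 by field_simp, Real.rpow_one]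
  set C : ℝ := Real.exp (N * a / 2) * B with hC
  have hC0 : 0 < C := by positivity
  have hgC : ∀ t, coshProfile a b t ^ (-N) ≤ C := fun t => by
    rw [hC, ← hbN]; exact coshProfile_rpow_le ha0 hb0 hN t
  -- the profile of the exponentiated entropy
  obtain ⟨π, hπ, hsub, hext⟩ := hL.exists_extremal_coupling hp₀ hp₁ hN hTCD hJ hμ₀J hμ₁J hΓ hopt hB
    hμ₀R hμ₁R
  set T := L.tauNorm 2 π with hT
  set U := expFunctional (relEntropy m) N with hU
  set G : ℝ → ℝ≥0∞ := fun t => distortion K N (1 - t) T * U μ₀ + distortion K N t T * U μ₁ with hG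
  have hG0 : G 0 = U μ₀ := by
    simp only [hG, sub_zero, distortion_zero hsub, distortion_one hsub hN, one_mul, zero_mul,
      add_zero]
  have hG1 : G 1 = U μ₁ := by
    simp only [hG, sub_self, distortion_zero hsub, distortion_one hsub hN, one_mul, zero_mul,
      zero_add]
  have hUtop : ∀ {ν : ProbabilityMeasure M}, (∀ᵐ x ∂(ν : Measure M), x ∈ J) → U ν ≠ ⊤ := fun h =>
    expFunctional_ne_top hN hJ.measurableSet hJ.measure_ne_top h
  have hdc := continuous_distortion hsub
  have hGc : Continuous G :=
    ((ENNReal.continuous_mul_const (hUtop hμ₀J)).comp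
      (hdc.comp (continuous_const.sub continuous_id))).add
      ((ENNReal.continuous_mul_const (hUtop hμ₁J)).comp hdc)
  have hscale : ∀ (n : ℕ) (θ : ℝ≥0∞), ENNReal.ofReal (2 * (1 / 2 ^ (n + 1))) * θ = θ / 2 ^ n := by
    intro n θ
    rw [show (2 : ℝ) * (1 / 2 ^ (n + 1)) = 1 / 2 ^ n by field_simp; ring,
      ENNReal.ofReal_div_of_pos (by positivity), ENNReal.ofReal_one, ENNReal.ofReal_pow two_pos.le,
      ENNReal.ofReal_ofNat, one_div, div_eq_mul_inv, mul_comm]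
  have hchain := LorentzianPreLength.exists_dyadic_chain hL hp₀ hp₁ hN hTCD hJ
    (LorentzianPreLength.diamond_diamond_subset S) hμ₀J hμ₁J ⟨Γ, hΓ⟩ hopt hπD
    (g := coshProfile a b) (coshProfile_pos hb0)
    (c := fun n => 1 / (2 * Real.cosh (1 / 2 ^ (n + 1) * a)))
    (fun n => by have := Real.cosh_pos (1 / 2 ^ (n + 1) * a); positivity)
    (fun n t => coshProfile_midpoint a b t _)
    (fun n θ hθ => by
      have h1 := le_distortion_half (K := K) hN (b := D.toReal / 2 ^ n) (by positivity)
        (hθ.trans_eq (by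
          rw [ENNReal.ofReal_div_of_pos (by positivity), ENNReal.ofReal_toReal hDtop,
            ENNReal.ofReal_pow two_pos.le, ENNReal.ofReal_ofNat]))
      convert h1 using 5
      rw [ha]
      field_simp
      ring)
    (G := G)
    (fun n t σ hσ h0 h1 => by
      have h2 := distortion_interpolation hsub hN (U μ₀) (U μ₁) (t := t)
        (h := 1 / 2 ^ (n + 1)) (by positivity) h0 h1
      have h3 := hext σ hσ (2 * (1 / 2 ^ (n + 1)))
      rw [hscale _ (L.tauNorm 2 σ)] at h3
      exact h2.trans_le (mul_le_mul' h3 le_rfl))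
    (by rw [coshProfile_zero, hbN]; exact hμ₀R) (by rw [coshProfile_one, hbN]; exact hμ₁R)
    hG0.le hG1.le
  choose κ hκ₀ hκ₁ hκ hlink using hchain
  set ℓ := L.tauNorm p π with hℓ
  have hℓtop : ℓ ≠ ⊤ := hL.tauNorm_ne_top hp₀ hJ hπ.1.1 hμ₀J hμ₁J
  have hℓ0 : 0 < ℓ := by
    have h := hΓ.profit_pos hp₀ hL.measurable_τ hπ
    rw [LorentzianPreLength.profit_eq_tauNorm_rpow hp₀] at h
    refine pos_iff_ne_zero.2 fun h0 => h.ne' ?_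
    rw [← hℓ, h0, ENNReal.zero_rpow_of_pos hp₀]
  obtain ⟨μ, hμ0, hμ1, hμ, hμℓ⟩ := hL.exists_limit_curve hp₀ hp₁ hN hC0 hJ hGc hℓtop hκ₀ hκ₁
    (fun n i hi => (hκ n i hi).1)
    (fun n i hi s => ((hκ n i hi).2.1 s).trans
      (mul_le_mul_left (ENNReal.ofReal_le_ofReal (hgC _)) _))
    (fun n i hi => (hκ n i hi).2.2)
    (fun n i hi => by
      -- a link carries `2 ^ (-n)` times the total cost
      obtain ⟨-, ⟨σ, hσ⟩, hlaw⟩ := hlink n i hi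
      obtain ⟨χ, hχ, hl⟩ := hlaw σ hσ
      refine ⟨σ, hσ.1, ?_⟩
      have h2 : ℓ = L.tauNorm p χ := by
        have := hπ.2.symm.trans hχ.2
        exact_mod_cast this
      rw [h2, hL.tauNorm_of_tauLaw (ENNReal.pow_ne_top ENNReal.ofNat_ne_top) hl hp₀, mul_comm,
        ENNReal.mul_div_cancel_right (pow_ne_zero _ two_ne_zero)
          (ENNReal.pow_ne_top ENNReal.ofNat_ne_top)])
  -- all conclusions are inherited by the limit curve
  have hgeod : L.IsCostGeodesic p μ := hL.isCostGeodesic hp₀ hp₁ hJ hℓ0 hℓtop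
    (by rw [hμ0, hμ1]; exact hπ.2) (fun t => (hμ t).1) hμℓ
  have hac : ∀ t, (μ t : Measure M) ≪ m := fun t => absolutelyContinuous_of_le_smul (hμ t).2.1
  have hbound : ∀ t, densityBound m (μ t) ≤ ENNReal.ofReal C := fun t =>
    (densityBound_le_iff (hac t)).2 (hμ t).2.1
  refine ⟨μ, hgeod, hμ0, hμ1, ⟨⟨π, ?_, ?_, hsub.1.lt_top, fun t => ?_⟩,
    fun t => ⟨hac t, LorentzianPreLength.mem_finiteDomain hJ (hμ t).1 hC0.le (hμ t).2.1⟩,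
    (iSup_le hbound).trans_lt ENNReal.ofReal_lt_top⟩, fun t => (hbound t).trans_eq ?_⟩
  · rw [hμ0, hμ1]; exact ⟨hπ.1.1, hΓ.ae_ll hπ⟩
  · rw [hμ0, hμ1]; exact hπ
  · rw [hμ0, hμ1]; exact (hμ t).2.2
  · rw [hC, ENNReal.ofReal_mul (Real.exp_pos _).le, ← hRB]
    congr 3
    rw [ha, ← mul_assoc, mul_comm N, mul_assoc]
    congr 2
    rw [← Real.sqrt_sq hN.le, ← Real.sqrt_mul (sq_nonneg N), Real.sqrt_sq hN.le]
    congr 1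
    field_simp
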